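/- Let $\alpha\in(1,2)$, $m>3$, $\beta\in\{-1,0,1\}$, and let $w:\mathbb R^3\to\mathbb R$ be a locally integrable potential whose (weak) gradient $\nabla w$ is locally integrable, such that, for some $A>0$, $|w(x)|\le A|x|^{-\alpha}$ and $|\nabla w(x)|\le A|x|^{-(\alpha+1)}$ for (almost) all sufficiently large $|x|$. Write $\langle v\rangle=(1+|v|^2)^{1/2}$. For $1\le c\le\infty$ put $v_c(p)=p\,(1+|p|^2/c^2)^{-1/2}$ (so $v_\infty(p)=p$, and $c^{-2}=0$ if $c=\infty$), and consider the Vlasov equation $$\partial_t f_c+v_c(p)\cdot\nabla_x f_c+E_c\cdot\nabla_p f_c=0,\qquad f_c(0)=f^0,\qquad E_c(t,x)=\beta\iint_{\mathbb R^6}\nabla w(x-y)f_c(t,y,p)\,dy\,dp .$$ By a global solution we mean a nonnegative $f_c\in C^1([0,\infty)\times\mathbb R^6)$ satisfying the equation on $[0,\infty)\times\mathbb R^6$, with $f_c(t)\in L^1(\mathbb R^6)$ and the integral defining $E_c(t,x)$ absolutely convergent for all $t\ge0$, $x\in\mathbb R^3$, and such that $E_c$ and $\nabla_xE_c$ exist,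 are continuous on $[0,\infty)\times\mathbb R^3$, and are bounded on $[0,T]\times\mathbb R^3$ for every $T<\infty$. Let $\Phi_c(t):\mathbb R^6\to\mathbb R^6$ be the characteristic flow: $\Phi_c(t)(x,p)=(\mathcal X(t),\mathcal P(t))$, where $\mathcal X'=v_c(\mathcal P)$, $\mathcal P'=E_c(t,\mathcal X)$, $(\mathcal X,\mathcal P)(0)=(x,p)$. Let $\Phi_c^{\rm free}(t)(x,p)=(x+tv_c(p),p)$, and define the finite-time wave operator and the shifted profile by $$\mathcal W_c(t)=\Phi_c^{\rm free}(t)^{-1}\circ\Phi_c(t),\qquad g_c(t,x,p)=f_c(t,x+tv_c(p),p).$$ Then there are constants $\varepsilon>0$ and $C>0$, depending only on $\alpha,m,\beta,w$, such that the following holds. Let $f^0\in C^1(\mathbb R^6)$, $f^0\ge0$, and let $\eta_0$ be a number with $$\eta:=\big\|\langle x\rangle^{m}\langle p\rangle^8f^0\big\|_{L^\infty_{x,p}}+\big\|\langle x\rangle^{m}\langle p\rangle^9\nabla_{(x,p)}f^0\big\|_{L^\infty_{x,p}}<\eta_0\le\varepsilon .$$ Let $1\le c\le\infty$, and let $f_c$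 and $f_\infty$ be global solutions, for the speeds of light $c$ and $\infty$, with the same initial data $f^0$. Then: 1. for all $t\ge1$, $\ \|g_c(t)-g_\infty(t)\|_{L^1_{x,p}(\mathbb R^6)}\le \dfrac{C}{c^2}\,\big\|\langle p\rangle^3\nabla_{(x,p)}f^0\big\|_{L^1_{x,p}(\mathbb R^6)}$; 2. for all $t\ge0$, $\mathcal W_c(t)-\mathcal W_\infty(t)$ is continuous on $\mathbb R^6$, and $\ \displaystyle\sup_{t\ge0}\ \sup_{(x,p)\in\mathbb R^6}\frac{1}{\langle p\rangle^3}\big|\mathcal W_c(t)(x,p)-\mathcal W_\infty(t)(x,p)\big|\le\frac{C\eta_0}{c^2}$; 3. for all $t\ge0$, $\ \|E_c(t)-E_\infty(t)\|_{L^\infty_x(\mathbb R^3)}\le\dfrac{C\eta_0}{c^2\langle t\rangle^{\alpha+1}}$. -/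

import Mathlib

open MeasureTheory Set
open scoped ENNReal ContDiff

noncomputable section

namespace Vlasov

/-- Three-dimensional Euclidean space. -/
abbrev E3 : Type := EuclideanSpace ℝ (Fin 3)

/-- Phase space: pairs `z = (x, p)` of a position and a momentum.  Its `volume` is the product
Lebesgue measure `dx dp`. -/
abbrev Phase : Type := E3 × E3

/-- The Japanese bracket `⟨v⟩ = (1 + |v|²)^{1/2}`. -/
def jb {V : Type*} [Norm V] (v : V) : ℝ := Real.sqrt (1 + ‖v‖ ^ 2)

/-- The Euclidean norm of a point of `ℝ³ × ℝ³ = ℝ⁶` (the norm that Mathlib puts on a product is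
the maximum norm). -/
def norm6 (z : Phase) : ℝ := Real.sqrt (‖z.1‖ ^ 2 + ‖z.2‖ ^ 2)

/-- The position gradient `∇ₓ h`. -/
def gradX (h : Phase → ℝ) (z : Phase) : E3 := gradient (fun x : E3 => h (x, z.2)) z.1

/-- The momentum gradient `∇ₚ h`. -/
def gradP (h : Phase → ℝ) (z : Phase) : E3 := gradient (fun p : E3 => h (z.1, p)) z.2

/-- The full gradient `∇_{(x,p)} h`. -/
def grad6 (h : Phase → ℝ) (z : Phase) : Phase := (gradX h z, gradP h z)

/-- `1 / c` for a speed of light `c ∈ [1, ∞]`, with `1 / ∞ = 0`. -/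
def invSpeed (c : ℝ≥0∞) : ℝ := (c⁻¹).toReal

theorem invSpeed_top : invSpeed ⊤ = 0 := by simp [invSpeed]

theorem invSpeed_ofReal {c : ℝ} (hc : 1 ≤ c) : invSpeed (ENNReal.ofReal c) = 1 / c := by
  have h : (0 : ℝ) ≤ c := by linarith
  simp [invSpeed, ENNReal.toReal_inv, ENNReal.toReal_ofReal h]

/-- `γ_c(p) = (1 + |p|² / c²)^{1/2}`. -/
def gam (c : ℝ≥0∞) (p : E3) : ℝ := Real.sqrt (1 + invSpeed c ^ 2 * ‖p‖ ^ 2)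

/-- The velocity `v_c(p) = p / γ_c(p)`. -/
def vel (c : ℝ≥0∞) (p : E3) : E3 := (gam c p)⁻¹ • p

theorem vel_top (p : E3) : vel ⊤ p = p := by simp [vel, gam, invSpeed_top]

/-- `K` is the weak gradient of the locally integrable function `w`. -/
def IsWeakGradient (w : E3 → ℝ) (K : E3 → E3) : Prop :=
  LocallyIntegrable w volume ∧ LocallyIntegrable K volume ∧
    ∀ φ : E3 → ℝ, ContDiff ℝ ∞ φ → HasCompactSupport φ →
      ∫ x, w x • gradient φ x = - ∫ x, φ x • K x

/-- `w` is an interaction potential with locally integrable gradient `K = ∇w`, and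
`|w(x)| ≤ A |x|^{-α}`, `|∇w(x)| ≤ A |x|^{-(α+1)}` for `|x|` sufficiently large. -/
structure IsDecayingPotential (α : ℝ) (w : E3 → ℝ) (K : E3 → E3) : Prop where
  weakGradient : IsWeakGradient w K
  decay : ∃ A R : ℝ, 0 < A ∧ 0 < R ∧ ∀ᵐ x : E3, R ≤ ‖x‖ →
    |w x| ≤ A * ‖x‖ ^ (-α) ∧ ‖K x‖ ≤ A * ‖x‖ ^ (-(α + 1))

/-- The force field `E(t,x) = β ∬ ∇w(x - y) f(t,y,p) dy dp`, where `K = ∇w`. -/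
def field (β : ℝ) (K : E3 → E3) (f : ℝ → Phase → ℝ) (t : ℝ) (x : E3) : E3 :=
  β • ∫ z : Phase, f t z • K (x - z.1)

/-- `f` is a global classical solution of
`∂ₜ f + v_c(p) · ∇ₓ f + E · ∇ₚ f = 0`, `f(0) = f⁰`, `E = β ∇w * ρ_f` (with `K = ∇w`) on
`[0,∞) × ℝ³ × ℝ³`.  The field is well defined, of class `C¹` in `x`, and, together with its spatial
derivative, continuous on `[0,∞) × ℝ³` and bounded on `[0,T] × ℝ³` for every finite `T`, so that it
has a global characteristic flow.  Nothing is required of `f` at negative times. -/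
structure IsGlobalSolution (β : ℝ) (K : E3 → E3) (c : ℝ≥0∞) (f0 : Phase → ℝ)
    (f : ℝ → Phase → ℝ) : Prop where
  nonneg : ∀ t, 0 ≤ t → ∀ z, 0 ≤ f t z
  contDiffOn : ContDiffOn ℝ 1 (fun q : ℝ × Phase => f q.1 q.2) (Ici 0 ×ˢ univ)
  initial : f 0 = f0
  integrable : ∀ t, 0 ≤ t → Integrable (f t) volume
  integrable_field : ∀ t, 0 ≤ t → ∀ x : E3,
    Integrable (fun z : Phase => f t z • K (x - z.1)) volume
  field_differentiable : ∀ t, 0 ≤ t → Differentiable ℝ (field β K f t)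
  field_continuousOn :
    ContinuousOn (fun q : ℝ × E3 => field β K f q.1 q.2) (Ici 0 ×ˢ univ)
  fderiv_field_continuousOn :
    ContinuousOn (fun q : ℝ × E3 => fderiv ℝ (field β K f q.1) q.2) (Ici 0 ×ˢ univ)
  field_bounded : ∀ T : ℝ, ∃ M : ℝ, ∀ t, 0 ≤ t → t ≤ T → ∀ x : E3,
    ‖field β K f t x‖ ≤ M ∧ ‖fderiv ℝ (field β K f t) x‖ ≤ M
  vlasov : ∀ t, 0 ≤ t → ∀ z : Phase,
    derivWithin (fun s => f s z) (Ici 0) t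
      + inner ℝ (vel c z.2) (gradX (f t) z)
      + inner ℝ (field β K f t z.1) (gradP (f t) z) = 0

/-- `Φ(t)(x,p) = (𝒳(t,0,x,p), 𝒫(t,0,x,p))`, `t ≥ 0`, is the forward characteristic flow of the
force field `E`: `𝒳' = v_c(𝒫)`, `𝒫' = E(t,𝒳)`, `Φ(0) = id`. -/
def IsCharFlow (c : ℝ≥0∞) (E : ℝ → E3 → E3) (Φ : ℝ → Phase → Phase) : Prop :=
  ∀ z : Phase, Φ 0 z = z ∧ ∀ t, 0 ≤ t →
    HasDerivWithinAt (fun s => Φ s z) (vel c (Φ t z).2, E t (Φ t z).1) (Ici 0) t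

/-- The free flow `Φ_c^free(t)(x,p) = (x + t v_c(p), p)`. -/
def freeFlow (c : ℝ≥0∞) (t : ℝ) (z : Phase) : Phase := (z.1 + t • vel c z.2, z.2)

/-- The inverse of the free flow, `(x,p) ↦ (x - t v_c(p), p)`. -/
def freeFlowInv (c : ℝ≥0∞) (t : ℝ) (z : Phase) : Phase := (z.1 - t • vel c z.2, z.2)

theorem freeFlowInv_freeFlow (c : ℝ≥0∞) (t : ℝ) (z : Phase) :
    freeFlowInv c t (freeFlow c t z) = z := by simp [freeFlow, freeFlowInv]

theorem freeFlow_freeFlowInv (c : ℝ≥0∞) (t : ℝ) (z : Phase) :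
    freeFlow c t (freeFlowInv c t z) = z := by simp [freeFlow, freeFlowInv]

/-- The finite-time wave operator `𝒲_c(t) = Φ_c^free(t)⁻¹ ∘ Φ_c(t)`. -/
def waveOp (c : ℝ≥0∞) (Φ : ℝ → Phase → Phase) (t : ℝ) (z : Phase) : Phase :=
  freeFlowInv c t (Φ t z)

/-- The shifted profile `g_c(t,x,p) = f_c(t, x + t v_c(p), p)`. -/
def profile (c : ℝ≥0∞) (f : ℝ → Phase → ℝ) (t : ℝ) (z : Phase) : ℝ := f t (freeFlow c t z)

/-- The size of the initial data,
`η = ‖⟨x⟩^m ⟨p⟩^8 f⁰‖_{L^∞} + ‖⟨x⟩^m ⟨p⟩^9 ∇_{(x,p)} f⁰‖_{L^∞}`, a number in `[0,∞]`. -/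
def dataSize (m : ℝ) (f0 : Phase → ℝ) : ℝ≥0∞ :=
  eLpNorm (fun z : Phase => jb z.1 ^ m * jb z.2 ^ 8 * f0 z) ∞ volume
    + eLpNorm (fun z : Phase => jb z.1 ^ m * jb z.2 ^ 9 * norm6 (grad6 f0 z)) ∞ volume

end Vlasov

end

open Vlasov

open scoped Pointwise

/-! The problem is read in the coordinates (x - t v_c(p), p), where free transport is at rest and
the characteristics become the wave operator 𝒲_c(t). Its velocity is (-s Dv_c(p) E, E), so it is
driven by E with weight 1 + s, and its dependence on the starting point by the variation of E with
weight (1 + s)². If both are dominated by a rate of small integral (`IsEnvelope`), 𝒲_c(t) is a small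
perturbation of the identity, uniformly in t and c, and g_c(t) = f⁰ ∘ 𝒲_c(t)⁻¹ inherits the weighted
bounds of f⁰ (`IsGlobalSolution.profileBound`).

Conversely, such profile bounds make E decay. The density is ∫ g(x - t v_c(p), p) dp, and the
substitution u = v_c(p) spreads it over a ball of radius about t with height t⁻³; convolving with
|∇w| gives (1 + t)^{-(α+1)} (`exists_convolution_bound`). An x-derivative of the density can be
traded for a p-derivative divided by t (`IsProfileBound.mul_rhoD_eq`), so the gradient of E gains
one more power. Since α > 1 the weighted rates are integrable, and a bootstrap in short time steps
closes the loop for small data (`IsGlobalSolution.hasFieldDecay`).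

For the limit c → ∞, suppose that E_c - E_∞ is at most q (1 + t)^{-(α+1)}. Comparing the two
differential equations gives 𝒲_c⁻¹ - 𝒲_∞⁻¹ = O(q + c⁻²) up to the weight ⟨p⟩³. This controls g_c -
g_∞. The densities of one and the same profile at the two speeds differ by O(c⁻²)
(`IsProfileBound.abs_rho_sub_rho_top_le`). Hence q may be replaced by q/2 + O(c⁻²)
(`FieldsClose.improve`), and iteration leaves q = O(η₀ c⁻²), which is claim 3. Gronwall then yields
claim 2. Claim 1 follows by joining 𝒲_c⁻¹ and 𝒲_∞⁻¹ by a segment of near-identity maps, each of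
which distorts volume by a bounded factor (`eLpNorm_comp_sub_comp_le`). -/

noncomputable section
namespace Vlasov

/-! ### The Japanese bracket. -/

section Bracket
variable {V : Type*} [NormedAddCommGroup V]

theorem one_le_jb (v : V) : 1 ≤ jb v := by
  rw [jb, Real.one_le_sqrt]; nlinarith [sq_nonneg ‖v‖]

theorem jb_pos (v : V) : 0 < jb v := lt_of_lt_of_le one_pos (one_le_jb v)

theorem sq_jb (v : V) : jb v ^ 2 = 1 + ‖v‖ ^ 2 := Real.sq_sqrt (by positivity)

theorem norm_le_jb (v : V) : ‖v‖ ≤ jb v := by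
  apply Real.le_sqrt_of_sq_le; linarith

theorem jb_le_one_add_norm (v : V) : jb v ≤ 1 + ‖v‖ := sqrt_one_add_norm_sq_le v

theorem jb_mono {W : Type*} [NormedAddCommGroup W] {v : V} {w : W} (h : ‖v‖ ≤ ‖w‖) :
    jb v ≤ jb w := Real.sqrt_le_sqrt (by gcongr)

theorem jb_le_mul_jb {v w : V} {r : ℝ} (h : ‖v - w‖ ≤ r) : jb v ≤ (1 + r) * jb w := by
  have h0 : 0 ≤ r := (norm_nonneg _).trans h
  have h1 : ‖v‖ ≤ ‖w‖ + r := by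
    have := norm_add_le (v - w) w
    rw [sub_add_cancel] at this; linarith
  rw [jb, Real.sqrt_le_left (by have := jb_pos w; positivity), mul_pow, sq_jb]
  have h2 := norm_nonneg w
  have h3 : ‖v‖ ^ 2 ≤ (‖w‖ + r) ^ 2 := by gcongr
  nlinarith [sq_nonneg (r * ‖w‖), sq_nonneg (‖w‖ - 1), mul_nonneg h0 (sq_nonneg (‖w‖ - 1)), sq_nonneg r]

@[fun_prop]
theorem continuous_jb : Continuous (jb : V → ℝ) := by
  unfold jb; fun_prop

end Bracket

/-! ### The velocity map v_c: derivative, Jacobian, distance to the identity, all uniform in c. -/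

theorem invSpeed_nonneg (c : ℝ≥0∞) : 0 ≤ invSpeed c := ENNReal.toReal_nonneg

theorem invSpeed_le_one {c : ℝ≥0∞} (hc : 1 ≤ c) : invSpeed c ≤ 1 := by
  have h : c⁻¹ ≤ 1 := by simpa using ENNReal.inv_le_inv.2 hc
  simpa [invSpeed] using ENNReal.toReal_mono ENNReal.one_ne_top h

section Velocity
variable (c : ℝ≥0∞)

theorem sq_gam (p : E3) : gam c p ^ 2 = 1 + invSpeed c ^ 2 * ‖p‖ ^ 2 :=
  Real.sq_sqrt (by positivity)

theorem one_le_gam (p : E3) : 1 ≤ gam c p := by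
  rw [gam, Real.one_le_sqrt]; nlinarith [mul_nonneg (sq_nonneg (invSpeed c)) (sq_nonneg ‖p‖)]

theorem gam_pos (p : E3) : 0 < gam c p := lt_of_lt_of_le one_pos (one_le_gam c p)

theorem inv_gam_le_one (p : E3) : (gam c p)⁻¹ ≤ 1 := inv_le_one_of_one_le₀ (one_le_gam c p)

theorem inv_gam_pos (p : E3) : 0 < (gam c p)⁻¹ := inv_pos.2 (gam_pos c p)

theorem gam_le_jb {c : ℝ≥0∞} (hc : 1 ≤ c) (p : E3) : gam c p ≤ jb p := by
  apply Real.sqrt_le_sqrt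
  have := invSpeed_le_one hc
  have h0 := invSpeed_nonneg c
  have : invSpeed c ^ 2 ≤ 1 := pow_le_one₀ h0 this
  nlinarith [sq_nonneg ‖p‖]

theorem invSpeed_mul_norm_le_gam (p : E3) : invSpeed c * ‖p‖ ≤ gam c p := by
  apply Real.le_sqrt_of_sq_le; nlinarith

theorem gam_sub_one_le (p : E3) : gam c p - 1 ≤ invSpeed c ^ 2 * ‖p‖ ^ 2 / 2 := by
  have h1 := one_le_gam c p
  nlinarith [sq_gam c p, sq_nonneg (gam c p - 1)]

theorem one_sub_inv_gam_le (p : E3) : 1 - (gam c p)⁻¹ ≤ invSpeed c ^ 2 * ‖p‖ ^ 2 / 2 := by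
  refine le_trans ?_ (gam_sub_one_le c p)
  have h := gam_pos c p
  have : gam c p - 1 - (1 - (gam c p)⁻¹) = (gam c p - 1) ^ 2 * (gam c p)⁻¹ := by
    field_simp
  have h2 : 0 ≤ (gam c p - 1) ^ 2 * (gam c p)⁻¹ := by positivity
  linarith

theorem norm_vel (p : E3) : ‖vel c p‖ = (gam c p)⁻¹ * ‖p‖ := by
  rw [vel, norm_smul, Real.norm_of_nonneg (inv_gam_pos c p).le]

theorem norm_vel_le (p : E3) : ‖vel c p‖ ≤ ‖p‖ := by
  rw [norm_vel]; exact mul_le_of_le_one_left (norm_nonneg _) (inv_gam_le_one c p)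

theorem invSpeed_mul_norm_vel_le_one (p : E3) : invSpeed c * ‖vel c p‖ ≤ 1 := by
  rw [norm_vel]
  have h := gam_pos c p
  have := invSpeed_mul_norm_le_gam c p
  calc invSpeed c * ((gam c p)⁻¹ * ‖p‖) = (gam c p)⁻¹ * (invSpeed c * ‖p‖) := by ring
    _ ≤ (gam c p)⁻¹ * gam c p := by gcongr
    _ = 1 := inv_mul_cancel₀ h.ne'

theorem norm_vel_sub_self_le (p : E3) : ‖vel c p - p‖ ≤ invSpeed c ^ 2 * ‖p‖ ^ 3 := by
  have : vel c p - p = ((gam c p)⁻¹ - 1) • p := by rw [vel, sub_smul, one_smul]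
  rw [this, norm_smul, Real.norm_eq_abs, abs_sub_comm, abs_of_nonneg (by linarith [inv_gam_le_one c p])]
  have h := one_sub_inv_gam_le c p
  have := norm_nonneg p
  have h3 : 0 ≤ invSpeed c ^ 2 * ‖p‖ ^ 3 := by positivity
  nlinarith

theorem gam_hasFDerivAt (p : E3) :
    HasFDerivAt (gam c) ((invSpeed c ^ 2 * (gam c p)⁻¹) • innerSL ℝ p) p := by
  have h1 : HasFDerivAt (fun q : E3 => 1 + invSpeed c ^ 2 * ‖q‖ ^ 2)
      (invSpeed c ^ 2 • (2 • innerSL ℝ p)) p := by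
    simpa using ((hasStrictFDerivAt_norm_sq p).hasFDerivAt.const_mul (invSpeed c ^ 2)).const_add 1
  have h2 := h1.sqrt (by positivity)
  refine h2.congr_fderiv ?_
  have h := gam_pos c p
  change (1 / (2 * gam c p)) • _ = _
  rw [two_nsmul, smul_add, smul_add, smul_smul, ← add_smul]
  congr 1
  field_simp
  ring

@[fun_prop]
theorem continuous_gam : Continuous (gam c) := by
  unfold gam; fun_prop

@[fun_prop]
theorem continuous_vel : Continuous (vel c) := by
  unfold vel
  exact (Continuous.inv₀ (continuous_gam c) fun p => (gam_pos c p).ne').smul continuous_id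

/-- The derivative `h ↦ γ⁻¹ (h - c⁻² ⟨v, h⟩ v)` of the velocity. -/
def velD (p : E3) : E3 →L[ℝ] E3 :=
  (gam c p)⁻¹ • (ContinuousLinearMap.id ℝ E3
    - (invSpeed c ^ 2) • (innerSL ℝ (vel c p)).smulRight (vel c p))

theorem velD_apply (p h : E3) : velD c p h =
    (gam c p)⁻¹ • (h - (invSpeed c ^ 2 * inner ℝ (vel c p) h) • vel c p) := by
  simp [velD, smul_smul]

theorem hasFDerivAt_vel (p : E3) : HasFDerivAt (vel c) (velD c p) p := by
  have hg := gam_pos c p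
  have h1 := (hasDerivAt_inv hg.ne').comp_hasFDerivAt p (gam_hasFDerivAt c p)
  have h2 := h1.smul (hasFDerivAt_id p)
  refine h2.congr_fderiv ?_
  ext1 v
  simp only [add_apply, smul_apply,
    ContinuousLinearMap.smulRight_apply, velD_apply, ContinuousLinearMap.id_apply, id,
    innerSL_apply_apply, vel, inner_smul_left, smul_smul, smul_sub]
  rw [sub_eq_add_neg]
  congr 1
  rw [← neg_smul]
  congr 1
  simp
  field_simp

/-- Since c⁻¹|v| ≤ 1, the symmetric map I - c⁻² v⊗v has its eigenvalues in [0, 1]. -/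
theorem norm_sub_inner_vel_le (p h : E3) :
    ‖h - (invSpeed c ^ 2 * inner ℝ (vel c p) h) • vel c p‖ ≤ ‖h‖ := by
  have h2 := invSpeed_mul_norm_vel_le_one c p
  have h3 := invSpeed_nonneg c
  have h4 : (invSpeed c * ‖vel c p‖) ^ 2 ≤ 1 := pow_le_one₀ (by positivity) h2
  refine abs_le_of_sq_le_sq' ?_ (norm_nonneg _) |>.2
  rw [norm_sub_sq_real, norm_smul, inner_smul_right, mul_pow, Real.norm_eq_abs, sq_abs,
    real_inner_comm]
  have h5 : 0 ≤ invSpeed c ^ 2 * (inner ℝ h (vel c p)) ^ 2 := by positivity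
  nlinarith

theorem norm_velD_apply_le (p h : E3) : ‖velD c p h‖ ≤ ‖h‖ := by
  rw [velD_apply, norm_smul, Real.norm_of_nonneg (inv_gam_pos c p).le]
  calc _ ≤ 1 * ‖h‖ := by
        gcongr
        · exact inv_gam_le_one c p
        · exact norm_sub_inner_vel_le c p h
    _ = _ := one_mul _

theorem norm_velD_le (p : E3) : ‖velD c p‖ ≤ 1 :=
  ContinuousLinearMap.opNorm_le_bound _ zero_le_one fun h => by
    simpa using norm_velD_apply_le c p h

theorem norm_vel_sub_le (p q : E3) : ‖vel c p - vel c q‖ ≤ ‖p - q‖ := by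
  simpa using (convex_univ (𝕜 := ℝ) (E := E3)).norm_image_sub_le_of_norm_hasFDerivWithin_le
    (fun x _ => (hasFDerivAt_vel c x).hasFDerivWithinAt) (fun x _ => norm_velD_le c x)
    (mem_univ q) (mem_univ p)

theorem norm_gam_fderiv_le (hc : 1 ≤ c) (p : E3) :
    ‖(invSpeed c ^ 2 * (gam c p)⁻¹) • innerSL ℝ p‖ ≤ 1 := by
  have h := gam_pos c p
  have h1 := invSpeed_mul_norm_le_gam c p
  have h2 := invSpeed_nonneg c
  have h3 := invSpeed_le_one hc
  rw [norm_smul, innerSL_apply_norm, Real.norm_of_nonneg (by positivity)]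
  calc invSpeed c ^ 2 * (gam c p)⁻¹ * ‖p‖ = invSpeed c * ((gam c p)⁻¹ * (invSpeed c * ‖p‖)) := by ring
    _ ≤ 1 * ((gam c p)⁻¹ * gam c p) := by gcongr
    _ = 1 := by rw [inv_mul_cancel₀ h.ne', one_mul]

theorem abs_gam_sub_le {c : ℝ≥0∞} (hc : 1 ≤ c) (p q : E3) : |gam c p - gam c q| ≤ ‖p - q‖ := by
  simpa using (convex_univ (𝕜 := ℝ) (E := E3)).norm_image_sub_le_of_norm_hasFDerivWithin_le
    (fun x _ => (gam_hasFDerivAt c x).hasFDerivWithinAt) (fun x _ => norm_gam_fderiv_le c hc x)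
    (mem_univ q) (mem_univ p)

theorem abs_inv_gam_sub_le {c : ℝ≥0∞} (hc : 1 ≤ c) (p q : E3) :
    |(gam c p)⁻¹ - (gam c q)⁻¹| ≤ ‖p - q‖ := by
  have hp := gam_pos c p
  have hq := gam_pos c q
  have : (gam c p)⁻¹ - (gam c q)⁻¹ = (gam c q - gam c p) * ((gam c p)⁻¹ * (gam c q)⁻¹) := by
    field_simp
  rw [this, abs_mul, abs_sub_comm, abs_of_pos (mul_pos (inv_pos.2 hp) (inv_pos.2 hq))]
  calc _ ≤ ‖p - q‖ * (1 * 1) := by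
        gcongr
        · exact abs_gam_sub_le hc p q
        · exact inv_gam_le_one c p
        · exact inv_gam_le_one c q
    _ = _ := by ring

/-- Each of γ⁻¹ and the two factors v in γ⁻¹(I - c⁻² v⊗v) is varied in turn, one unit of the
constant for each. A factor c⁻¹ absorbs the unvaried v, so the bound does not depend on c. -/
theorem norm_velD_sub_apply_le {c : ℝ≥0∞} (hc : 1 ≤ c) (p q h : E3) :
    ‖velD c p h - velD c q h‖ ≤ 3 * ‖p - q‖ * ‖h‖ := by
  have k0 := invSpeed_nonneg c
  have k1 := invSpeed_le_one hc
  set u := vel c p with hu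
  set v := vel c q with hv
  have huv : ‖u - v‖ ≤ ‖p - q‖ := norm_vel_sub_le c p q
  have hu1 : invSpeed c * ‖u‖ ≤ 1 := invSpeed_mul_norm_vel_le_one c p
  have hv1 : invSpeed c * ‖v‖ ≤ 1 := invSpeed_mul_norm_vel_le_one c q
  have key : velD c p h - velD c q h =
      ((gam c p)⁻¹ - (gam c q)⁻¹) • (h - (invSpeed c ^ 2 * inner ℝ u h) • u)
      - (gam c q)⁻¹ • ((invSpeed c ^ 2 * inner ℝ (u - v) h) • u
        + (invSpeed c ^ 2 * inner ℝ v h) • (u - v)) := by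
    rw [velD_apply, velD_apply, ← hu, ← hv, inner_sub_left]
    module
  rw [key]
  have e1 : ‖((gam c p)⁻¹ - (gam c q)⁻¹) • (h - (invSpeed c ^ 2 * inner ℝ u h) • u)‖
      ≤ ‖p - q‖ * ‖h‖ := by
    rw [norm_smul, Real.norm_eq_abs]
    gcongr
    · exact abs_inv_gam_sub_le hc p q
    · exact norm_sub_inner_vel_le c p h
  have e2 : ‖(invSpeed c ^ 2 * inner ℝ (u - v) h) • u‖ ≤ ‖p - q‖ * ‖h‖ := by
    rw [norm_smul, Real.norm_eq_abs, abs_mul, abs_of_nonneg (sq_nonneg _)]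
    calc invSpeed c ^ 2 * |inner ℝ (u - v) h| * ‖u‖
        ≤ invSpeed c ^ 2 * (‖u - v‖ * ‖h‖) * ‖u‖ := by
          gcongr; exact abs_real_inner_le_norm _ _
      _ = invSpeed c * (invSpeed c * ‖u‖) * ‖u - v‖ * ‖h‖ := by ring
      _ ≤ 1 * 1 * ‖p - q‖ * ‖h‖ := by gcongr
      _ = _ := by ring
  have e3 : ‖(invSpeed c ^ 2 * inner ℝ v h) • (u - v)‖ ≤ ‖p - q‖ * ‖h‖ := by
    rw [norm_smul, Real.norm_eq_abs, abs_mul, abs_of_nonneg (sq_nonneg _)]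
    calc invSpeed c ^ 2 * |inner ℝ v h| * ‖u - v‖
        ≤ invSpeed c ^ 2 * (‖v‖ * ‖h‖) * ‖u - v‖ := by
          gcongr; exact abs_real_inner_le_norm _ _
      _ = invSpeed c * (invSpeed c * ‖v‖) * ‖u - v‖ * ‖h‖ := by ring
      _ ≤ 1 * 1 * ‖p - q‖ * ‖h‖ := by gcongr
      _ = _ := by ring
  have e4 : ‖(gam c q)⁻¹ • ((invSpeed c ^ 2 * inner ℝ (u - v) h) • u
        + (invSpeed c ^ 2 * inner ℝ v h) • (u - v))‖ ≤ 2 * (‖p - q‖ * ‖h‖) := by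
    rw [norm_smul, Real.norm_of_nonneg (inv_gam_pos c q).le]
    calc _ ≤ 1 * (‖p - q‖ * ‖h‖ + ‖p - q‖ * ‖h‖) := by
          gcongr
          · exact inv_gam_le_one c q
          · exact (norm_add_le _ _).trans (add_le_add e2 e3)
      _ = _ := by ring
  calc _ ≤ _ := norm_sub_le _ _
    _ ≤ ‖p - q‖ * ‖h‖ + 2 * (‖p - q‖ * ‖h‖) := add_le_add e1 e4
    _ = _ := by ring

theorem norm_velD_apply_sub_self_le (p h : E3) :
    ‖velD c p h - h‖ ≤ 2 * invSpeed c ^ 2 * ‖p‖ ^ 2 * ‖h‖ := by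
  have key : velD c p h - h = ((gam c p)⁻¹ - 1) • h
      - (gam c p)⁻¹ • (invSpeed c ^ 2 * inner ℝ (vel c p) h) • vel c p := by
    rw [velD_apply]; module
  have h1 : ‖((gam c p)⁻¹ - 1) • h‖ ≤ invSpeed c ^ 2 * ‖p‖ ^ 2 / 2 * ‖h‖ := by
    rw [norm_smul, Real.norm_eq_abs, abs_sub_comm,
      abs_of_nonneg (by linarith [inv_gam_le_one c p])]
    gcongr; exact one_sub_inv_gam_le c p
  have h2 : ‖(gam c p)⁻¹ • (invSpeed c ^ 2 * inner ℝ (vel c p) h) • vel c p‖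
      ≤ invSpeed c ^ 2 * ‖p‖ ^ 2 * ‖h‖ := by
    rw [norm_smul, norm_smul, Real.norm_of_nonneg (inv_gam_pos c p).le, Real.norm_eq_abs, abs_mul,
      abs_of_nonneg (sq_nonneg _)]
    calc (gam c p)⁻¹ * (invSpeed c ^ 2 * |inner ℝ (vel c p) h| * ‖vel c p‖)
        ≤ 1 * (invSpeed c ^ 2 * (‖p‖ * ‖h‖) * ‖p‖) := by
          gcongr
          · exact inv_gam_le_one c p
          · exact (abs_real_inner_le_norm _ _).trans (by gcongr; exact norm_vel_le c p)
          · exact norm_vel_le c p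
      _ = _ := by ring
  rw [key]
  have h3 : 0 ≤ invSpeed c ^ 2 * ‖p‖ ^ 2 * ‖h‖ := by positivity
  calc _ ≤ _ := norm_sub_le _ _
    _ ≤ _ := by linarith

/-- `a(p) = γ (h + c⁻² ⟨p, h⟩ p)`, the solution of `Dv(p) a(p) = h`. -/
def dualDir (h p : E3) : E3 := gam c p • (h + (invSpeed c ^ 2 * inner ℝ p h) • p)

/-- Sherman–Morrison: as 1 - c⁻²|v|² = γ⁻² and p = γv, the inverse of I - c⁻² v⊗v is I + c⁻² p⊗p. -/
theorem velD_dualDir (p h : E3) : velD c p (dualDir c h p) = h := by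
  have hg := gam_pos c p
  have h2 := sq_gam c p
  rw [velD_apply, dualDir, vel]
  simp only [inner_smul_left, inner_smul_right, inner_add_right, real_inner_self_eq_norm_sq,
    smul_sub, smul_smul, smul_add]
  have e1 : (gam c p)⁻¹ * gam c p = 1 := inv_mul_cancel₀ hg.ne'
  rw [e1, one_smul, add_sub_assoc, ← sub_smul]
  simp only [add_eq_left, smul_eq_zero]
  left
  simp
  field_simp
  linear_combination (invSpeed c ^ 2 * inner ℝ p h) * h2

theorem norm_dualDir_le {c : ℝ≥0∞} (hc : 1 ≤ c) (p h : E3) :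
    ‖dualDir c h p‖ ≤ jb p ^ 3 * ‖h‖ := by
  have k0 := invSpeed_nonneg c
  have k1 := invSpeed_le_one hc
  rw [dualDir, norm_smul, Real.norm_of_nonneg (gam_pos c p).le]
  have h1 : ‖h + (invSpeed c ^ 2 * inner ℝ p h) • p‖ ≤ jb p ^ 2 * ‖h‖ := by
    calc _ ≤ ‖h‖ + ‖(invSpeed c ^ 2 * inner ℝ p h) • p‖ := norm_add_le _ _
      _ ≤ ‖h‖ + 1 ^ 2 * (‖p‖ * ‖h‖) * ‖p‖ := by
        rw [norm_smul, Real.norm_eq_abs, abs_mul, abs_of_nonneg (sq_nonneg _)]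
        gcongr
        exact abs_real_inner_le_norm _ _
      _ = _ := by rw [sq_jb]; ring
  calc _ ≤ jb p * (jb p ^ 2 * ‖h‖) := by
        gcongr
        · exact (jb_pos p).le
        · exact gam_le_jb hc p
    _ = _ := by ring

theorem one_sub_sq_norm_vel (p : E3) :
    1 - invSpeed c ^ 2 * ‖vel c p‖ ^ 2 = ((gam c p)⁻¹) ^ 2 := by
  have hg := gam_pos c p
  rw [norm_vel]
  field_simp
  linear_combination sq_gam c p

/-- The scalar γ⁻¹ contributes γ⁻³ in dimension three, and the rank-one perturbation contributes 1 -
c⁻²|v|² = γ⁻². -/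
theorem det_velD (p : E3) : (velD c p).det = ((gam c p)⁻¹) ^ 5 := by
  have h : (velD c p : E3 →ₗ[ℝ] E3) = (gam c p)⁻¹ •
      LinearMap.transvection ((-(invSpeed c ^ 2)) • (innerSL ℝ (vel c p) : E3 →ₗ[ℝ] ℝ))
        (vel c p) := by
    ext1 v
    simp only [ContinuousLinearMap.coe_coe, velD_apply, LinearMap.smul_apply,
      LinearMap.transvection.apply]
    congr 1
    simp [sub_eq_add_neg]
  rw [ContinuousLinearMap.det, h, LinearMap.det_smul, LinearMap.transvection.det]
  have h2 := one_sub_sq_norm_vel c p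
  have : ((-(invSpeed c ^ 2)) • (innerSL ℝ (vel c p) : E3 →ₗ[ℝ] ℝ)) (vel c p)
      = - (invSpeed c ^ 2 * ‖vel c p‖ ^ 2) := by
    simp
  rw [this, ← sub_eq_add_neg, h2]
  simp
  ring

theorem vel_injective : Function.Injective (vel c) := by
  intro p q h
  have h1 := one_sub_sq_norm_vel c p
  rw [h, one_sub_sq_norm_vel c q] at h1
  have h2 : (gam c q)⁻¹ = (gam c p)⁻¹ :=
    (pow_left_inj₀ (inv_gam_pos c q).le (inv_gam_pos c p).le two_ne_zero).1 h1
  rw [vel, vel, h2] at h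
  exact smul_right_injective _ (inv_gam_pos c p).ne' h

/-- The preimage is p = u (1 - c⁻²|u|²)^{-1/2}. A velocity below c/√2 thus comes from a momentum at
most c, the region where p and v_c(p) have comparable brackets. -/
theorem exists_vel_eq {u : E3} (hu : invSpeed c ^ 2 * ‖u‖ ^ 2 ≤ 1 / 2) :
    ∃ p, invSpeed c ^ 2 * ‖p‖ ^ 2 ≤ 1 ∧ vel c p = u := by
  set r := 1 - invSpeed c ^ 2 * ‖u‖ ^ 2 with hr
  have hr0 : 0 < r := by linarith
  have hs : 0 < √r := Real.sqrt_pos.2 hr0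
  have hsq : √r ^ 2 = r := Real.sq_sqrt hr0.le
  have hn : ‖(√r)⁻¹ • u‖ ^ 2 = ‖u‖ ^ 2 / r := by
    rw [norm_smul, mul_pow, Real.norm_of_nonneg (inv_nonneg.2 hs.le), inv_pow, hsq]; ring
  refine ⟨(√r)⁻¹ • u, ?_, ?_⟩
  · rw [hn, ← mul_div_assoc, div_le_one hr0]; linarith
  · have : gam c ((√r)⁻¹ • u) = (√r)⁻¹ := by
      rw [gam, hn, ← Real.sqrt_inv]
      congr 1
      field_simp
      linarith
    rw [vel, this, inv_inv, smul_smul, mul_inv_cancel₀ hs.ne', one_smul]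

/-- The derivative of `dualDir`. -/
def dualDirD (h p : E3) : E3 →L[ℝ] E3 :=
  gam c p • ((invSpeed c ^ 2 * inner ℝ p h) • ContinuousLinearMap.id ℝ E3
    + (invSpeed c ^ 2 • innerSL ℝ h).smulRight p)
  + ((invSpeed c ^ 2 * (gam c p)⁻¹) • innerSL ℝ p).smulRight
    (h + (invSpeed c ^ 2 * inner ℝ p h) • p)

theorem hasFDerivAt_dualDir (h p : E3) :
    HasFDerivAt (dualDir c h) (dualDirD c h p) p := by
  have h1 : HasFDerivAt (fun q : E3 => invSpeed c ^ 2 * inner ℝ q h)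
      (invSpeed c ^ 2 • innerSL ℝ h) p := by
    have := ((innerSL ℝ h).hasFDerivAt (x := p)).const_mul (invSpeed c ^ 2)
    refine this.congr_of_eventuallyEq (Filter.Eventually.of_forall fun q => ?_)
    simp [real_inner_comm]
  exact (gam_hasFDerivAt c p).smul ((h1.smul (hasFDerivAt_id p)).const_add h)

/-- The divergence of the dual direction. The 5 is 3 from the identity, 1 from differentiating ⟨p,
h⟩, and 1 from differentiating γ, where 1 + c⁻²|p|² = γ² is used. It grows only like ⟨p⟩², uniformly
in c. -/
theorem sum_dualDirD (h p : E3) :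
    ∑ i : Fin 3, (dualDirD c h p (EuclideanSpace.single i 1)) i
      = 5 * invSpeed c ^ 2 * gam c p * inner ℝ p h := by
  have hg := gam_pos c p
  have h2 := sq_gam c p
  rw [EuclideanSpace.norm_sq_eq] at h2
  simp only [dualDirD, Fin.sum_univ_three, add_apply, smul_apply,
    ContinuousLinearMap.smulRight_apply, ContinuousLinearMap.id_apply, innerSL_apply_apply,
    PiLp.add_apply, PiLp.smul_apply, smul_eq_mul, PiLp.inner_apply, PiLp.single_apply,
    Real.norm_eq_abs, sq_abs, RCLike.inner_apply, conj_trivial] at *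
  simp
  field_simp
  linear_combination (-(invSpeed c ^ 2 * (p 0 * h 0 + p 1 * h 1 + p 2 * h 2))) * h2

end Velocity

/-! ### Model densities of free transport and their dispersion. -/

theorem jb_rpow_le_one {m : ℝ} (hm : 0 ≤ m) (x : E3) : jb x ^ (-m) ≤ 1 :=
  Real.rpow_le_one_of_one_le_of_nonpos (one_le_jb x) (by linarith)

theorem integrable_jb_rpow_neg {m : ℝ} (hm : 3 < m) :
    Integrable (fun x : E3 => jb x ^ (-m)) volume := by
  have h := integrable_rpow_neg_one_add_norm_sq (E := E3) (μ := volume) (r := m) (by simpa using hm)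
  refine h.congr (Filter.Eventually.of_forall fun x => ?_)
  simp only [jb, Real.sqrt_eq_rpow]
  rw [← Real.rpow_mul (by positivity)]
  congr 1; ring

theorem integrable_jb_pow_inv {n : ℕ} (hn : 3 < n) :
    Integrable (fun x : E3 => (jb x ^ n)⁻¹) volume := by
  refine (integrable_jb_rpow_neg (m := n) (by exact_mod_cast hn)).congr
    (Filter.Eventually.of_forall fun x => ?_)
  simp [Real.rpow_neg (jb_pos x).le]

@[fun_prop]
theorem continuous_jb_rpow (m : ℝ) : Continuous (fun x : E3 => jb x ^ m) :=
  continuous_jb.rpow_const fun x => Or.inl (jb_pos x).ne'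

@[fun_prop]
theorem continuous_jb_pow_inv (n : ℕ) : Continuous (fun x : E3 => (jb x ^ n)⁻¹) :=
  (continuous_jb.pow n).inv₀ fun x => (pow_pos (jb_pos x) n).ne'

/-- The weight `⟨y - t v_c(p)⟩^{-m} ⟨p⟩^{-6}`. -/
def modelWeight (m : ℝ) (c : ℝ≥0∞) (t : ℝ) (y p : E3) : ℝ :=
  jb (y - t • vel c p) ^ (-m) * (jb p ^ 6)⁻¹

/-- The spatial density of `modelWeight`. -/
def modelDensity (m : ℝ) (c : ℝ≥0∞) (t : ℝ) (y : E3) : ℝ := ∫ p, modelWeight m c t y p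

theorem modelWeight_nonneg (m : ℝ) (c : ℝ≥0∞) (t : ℝ) (y p : E3) : 0 ≤ modelWeight m c t y p := by
  have := jb_pos (y - t • vel c p)
  have := jb_pos p
  unfold modelWeight; positivity

theorem modelDensity_nonneg (m : ℝ) (c : ℝ≥0∞) (t : ℝ) (y : E3) : 0 ≤ modelDensity m c t y :=
  integral_nonneg fun p => modelWeight_nonneg m c t y p

theorem modelWeight_le {m : ℝ} (hm : 0 ≤ m) (c : ℝ≥0∞) (t : ℝ) (y p : E3) :
    modelWeight m c t y p ≤ (jb p ^ 6)⁻¹ := by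
  have := jb_pos p
  exact mul_le_of_le_one_left (by positivity) (jb_rpow_le_one hm _)

theorem continuous_modelWeight (m : ℝ) (c : ℝ≥0∞) (t : ℝ) :
    Continuous (fun z : Phase => modelWeight m c t z.1 z.2) := by
  unfold modelWeight
  exact ((continuous_jb_rpow (-m)).comp (by fun_prop : Continuous fun z : Phase =>
    z.1 - t • vel c z.2)).mul ((continuous_jb_pow_inv 6).comp continuous_snd)

theorem integrable_modelWeight {m : ℝ} (hm : 0 ≤ m) (c : ℝ≥0∞) (t : ℝ) (y : E3) :
    Integrable (modelWeight m c t y) volume := by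
  refine (integrable_jb_pow_inv (n := 6) (by norm_num)).mono'
    ((continuous_modelWeight m c t).comp (Continuous.prodMk_right y)).aestronglyMeasurable
    (Filter.Eventually.of_forall fun p => ?_)
  rw [Real.norm_of_nonneg (modelWeight_nonneg m c t y p)]
  exact modelWeight_le hm c t y p

theorem integrable_modelWeight_prod {m : ℝ} (hm : 3 < m) (c : ℝ≥0∞) (t : ℝ) :
    Integrable (fun z : Phase => modelWeight m c t z.1 z.2) volume := by
  have hI := integrable_jb_rpow_neg hm
  rw [Measure.volume_eq_prod,
    integrable_prod_iff' (continuous_modelWeight m c t).aestronglyMeasurable]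
  refine ⟨Filter.Eventually.of_forall fun p => ?_, ?_⟩
  · exact (hI.comp_sub_right (t • vel c p)).mul_const ((jb p ^ 6)⁻¹)
  · have h : ∀ p : E3, ∫ y : E3, ‖modelWeight m c t y p‖
        = (∫ x : E3, jb x ^ (-m)) * (jb p ^ 6)⁻¹ := fun p => by
      simp only [Real.norm_of_nonneg (modelWeight_nonneg _ _ _ _ _)]
      simp only [modelWeight]
      rw [integral_mul_const, integral_sub_right_eq_self (fun y : E3 => jb y ^ (-m))]
    simp_rw [h]
    exact (integrable_jb_pow_inv (by norm_num)).const_mul _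

theorem integrable_modelDensity {m : ℝ} (hm : 3 < m) (c : ℝ≥0∞) (t : ℝ) :
    Integrable (modelDensity m c t) volume :=
  (integrable_modelWeight_prod hm c t).integral_prod_left

theorem integral_modelDensity {m : ℝ} (hm : 3 < m) (c : ℝ≥0∞) (t : ℝ) :
    ∫ y, modelDensity m c t y = (∫ x : E3, jb x ^ (-m)) * ∫ p : E3, (jb p ^ 6)⁻¹ := by
  unfold modelDensity
  rw [integral_integral_swap (f := modelWeight m c t)
    (integrable_modelWeight_prod hm c t)]
  simp only [modelWeight, integral_mul_const, integral_sub_right_eq_self (fun y : E3 => jb y ^ (-m))]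
  rw [integral_const_mul]

theorem modelDensity_le {m : ℝ} (hm : 0 ≤ m) (c : ℝ≥0∞) (t : ℝ) (y : E3) :
    modelDensity m c t y ≤ ∫ p : E3, (jb p ^ 6)⁻¹ :=
  integral_mono (integrable_modelWeight hm c t y) (integrable_jb_pow_inv (by norm_num))
    fun p => modelWeight_le hm c t y p

/-- Change of variables `u = v_c(p)`. -/
theorem setIntegral_image_vel (c : ℝ≥0∞) {s : Set E3} (hs : MeasurableSet s) (F : E3 → ℝ) :
    ∫ u in vel c '' s, F u = ∫ p in s, ((gam c p)⁻¹) ^ 5 * F (vel c p) := by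
  rw [integral_image_eq_integral_abs_det_fderiv_smul volume hs
    (fun p _ => (hasFDerivAt_vel c p).hasFDerivWithinAt) (vel_injective c).injOn]
  simp_rw [det_velD, smul_eq_mul, abs_of_pos (pow_pos (inv_gam_pos c _) 5)]

theorem integrableOn_image_vel (c : ℝ≥0∞) {s : Set E3} (hs : MeasurableSet s) (F : E3 → ℝ) :
    IntegrableOn F (vel c '' s) ↔ IntegrableOn (fun p => ((gam c p)⁻¹) ^ 5 * F (vel c p)) s := by
  rw [integrableOn_image_iff_integrableOn_abs_det_fderiv_smul volume hs
    (fun p _ => (hasFDerivAt_vel c p).hasFDerivWithinAt) (vel_injective c).injOn]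
  simp_rw [det_velD, smul_eq_mul, abs_of_pos (pow_pos (inv_gam_pos c _) 5)]

/-- Dispersion: substitute u = v_c(p), then rescale by t. The momentum weight pays for the Jacobian,
since ⟨p⟩⁻⁶ ≤ ⟨p⟩⁻⁵ ≤ γ⁻⁵; this is why the model weight carries such a high power of ⟨p⟩. -/
theorem modelDensity_le_rpow {m : ℝ} (hm : 3 < m) {c : ℝ≥0∞} (hc : 1 ≤ c) {t : ℝ} (ht : 0 < t)
    (y : E3) : modelDensity m c t y ≤ t⁻¹ ^ 3 * ∫ x : E3, jb x ^ (-m) := by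
  have hI := integrable_jb_rpow_neg hm
  set F : E3 → ℝ := fun u => jb (y - t • u) ^ (-m) with hF
  have hFi : Integrable F := by
    have h1 : Integrable (fun u : E3 => jb (y - u) ^ (-m)) := hI.comp_sub_left y
    exact h1.comp_smul ht.ne'
  have hF0 : ∀ u, 0 ≤ F u := fun u => Real.rpow_nonneg (jb_pos _).le _
  have h1 : ∫ u in vel c '' univ, F u ≤ ∫ u, F u :=
    setIntegral_le_integral hFi (Filter.Eventually.of_forall hF0)
  have h2 : ∫ u, F u = t⁻¹ ^ 3 * ∫ x : E3, jb x ^ (-m) := by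
    have e1 := Measure.integral_comp_smul_of_nonneg (μ := (volume : Measure E3))
      (fun u : E3 => jb (y - u) ^ (-m)) t (hR := ht.le)
    rw [integral_sub_left_eq_self (fun u : E3 => jb u ^ (-m)) volume y] at e1
    rw [hF, e1]
    simp
  rw [setIntegral_image_vel c MeasurableSet.univ, setIntegral_univ, h2] at h1
  refine le_trans (integral_mono (integrable_modelWeight (by linarith) c t y) ?_ fun p => ?_) h1
  · have := (integrableOn_image_vel c MeasurableSet.univ F).1 hFi.integrableOn
    simpa using this
  · have h3 := gam_le_jb hc p
    have h4 := gam_pos c p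
    have h5 := one_le_jb p
    rw [modelWeight, mul_comm]
    refine mul_le_mul_of_nonneg_right ?_ (hF0 _)
    rw [← inv_pow]
    calc (jb p)⁻¹ ^ 6 ≤ (jb p)⁻¹ ^ 5 :=
          pow_le_pow_of_le_one (by positivity) (inv_le_one_of_one_le₀ h5) (by norm_num)
      _ ≤ _ := by gcongr

/-- The decay of `modelDensity`. -/
theorem exists_modelDensity_bound {m : ℝ} (hm : 3 < m) : ∃ A : ℝ, 0 < A ∧ ∀ c : ℝ≥0∞, 1 ≤ c →
    ∀ t : ℝ, 0 ≤ t → (∫ y, modelDensity m c t y ≤ A) ∧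
      ∀ y, modelDensity m c t y ≤ A * ((1 + t) ^ 3)⁻¹ := by
  set I : ℝ := ∫ x : E3, jb x ^ (-m)
  set J : ℝ := ∫ p : E3, (jb p ^ 6)⁻¹
  have hI : 0 ≤ I := integral_nonneg fun x => Real.rpow_nonneg (jb_pos _).le _
  have hJ : 0 ≤ J := integral_nonneg fun x => inv_nonneg.2 (pow_nonneg (jb_pos _).le _)
  refine ⟨I * J + 8 * I + 8 * J + 1, by positivity, fun c hc t ht => ⟨?_, fun y => ?_⟩⟩
  · rw [integral_modelDensity hm]; linarith
  · have hA : 8 * (I + J) * ((1 + t) ^ 3)⁻¹ ≤ (I * J + 8 * I + 8 * J + 1) * ((1 + t) ^ 3)⁻¹ := by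
      gcongr
      nlinarith [mul_nonneg hI hJ]
    refine le_trans ?_ hA
    -- Short times use the trivial bound and long times the dispersive one; 8 = 2³ converts either
    -- into (1 + t)⁻³.
    rcases le_total t 1 with h | h
    · refine (modelDensity_le (by linarith) c t y).trans ?_
      rw [← div_eq_mul_inv, le_div_iff₀ (by positivity)]
      have : (1 + t) ^ 3 ≤ 2 ^ 3 := by gcongr; linarith
      calc J * (1 + t) ^ 3 ≤ J * 2 ^ 3 := by gcongr
        _ ≤ _ := by linarith
    · refine (modelDensity_le_rpow hm hc (by linarith) y).trans ?_
      have : (t⁻¹) ^ 3 ≤ 8 * ((1 + t) ^ 3)⁻¹ := by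
        rw [inv_pow, ← div_eq_mul_inv, inv_eq_one_div, div_le_div_iff₀ (by positivity) (by positivity)]
        have : (1 + t) ^ 3 ≤ (2 * t) ^ 3 := by gcongr; linarith
        nlinarith
      calc _ ≤ 8 * ((1 + t) ^ 3)⁻¹ * I := by gcongr
        _ ≤ _ := by
          have : 0 ≤ ((1 + t) ^ 3)⁻¹ := by positivity
          nlinarith [mul_nonneg this hJ]

/-! ### Convolution of the model densities with the force kernel. -/

theorem integrableOn_ball_norm_rpow {s : ℝ} (hs : -3 < s) (r : ℝ) :
    IntegrableOn (fun x : E3 => ‖x‖ ^ s) (Metric.ball 0 r) volume := by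
  rw [integrableOn_fun_norm_addHaar volume (f := fun x => x ^ s)]
  rcases le_or_gt r 0 with hr | hr
  · simp [Ioo_eq_empty_of_le hr]
  have h := (intervalIntegral.integrableOn_Ioo_rpow_iff hr).2 (by linarith : -1 < 2 + s)
  refine h.congr_fun (fun y hy => ?_) measurableSet_Ioo
  have : (0 : ℝ) < y := hy.1
  simp [Real.rpow_add this]

theorem setIntegral_ball_norm_rpow {s : ℝ} {r : ℝ} (hr : 0 < r) :
    ∫ x in Metric.ball (0 : E3) r, ‖x‖ ^ s
      = r ^ (3 + s) * ∫ x in Metric.ball (0 : E3) 1, ‖x‖ ^ s := by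
  have h := Measure.setIntegral_comp_smul_of_pos (μ := (volume : Measure E3))
    (fun x : E3 => ‖x‖ ^ s) (Metric.ball 0 1) hr
  have h2 : r • Metric.ball (0 : E3) 1 = Metric.ball 0 r := by
    rw [smul_ball hr.ne', smul_zero, Real.norm_of_nonneg hr.le, mul_one]
  rw [h2] at h
  have h3 : ∀ x : E3, ‖r • x‖ ^ s = r ^ s * ‖x‖ ^ s := fun x => by
    rw [norm_smul, Real.norm_of_nonneg hr.le, Real.mul_rpow hr.le (norm_nonneg _)]
  simp_rw [h3, integral_const_mul] at h
  rw [smul_eq_mul, finrank_euclideanSpace_fin, inv_mul_eq_div, eq_div_iff (by positivity)] at h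
  rw [← h, Real.rpow_add hr]
  norm_cast
  ring

/-- Convolving `|K|` with a density that is spread over a ball of radius `~ t`. -/
theorem exists_convolution_bound {α m : ℝ} (hα1 : 1 < α) (hα2 : α < 2) (hm : 3 < m) {w : E3 → ℝ}
    {K : E3 → E3} (hw : IsDecayingPotential α w K) : ∃ C : ℝ, 0 < C ∧ ∀ c : ℝ≥0∞, 1 ≤ c →
    ∀ t : ℝ, 0 ≤ t → ∀ x : E3,
      Integrable (fun y => modelDensity m c t (x - y) * ‖K y‖) volume ∧
      ∫ y, modelDensity m c t (x - y) * ‖K y‖ ≤ C * (1 + t) ^ (-(α + 1)) := by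
  obtain ⟨A, hA, hρ⟩ := exists_modelDensity_bound hm
  obtain ⟨B, R, hB, hR, hK⟩ := hw.decay
  have hKm : AEStronglyMeasurable K volume := hw.weakGradient.2.1.aestronglyMeasurable
  have hKR : IntegrableOn (fun y => ‖K y‖) (Metric.ball 0 R) :=
    ((hw.weakGradient.2.1.integrableOn_isCompact (isCompact_closedBall 0 R)).mono_set
      Metric.ball_subset_closedBall).norm
  set N1 := ∫ y in Metric.ball 0 R, ‖K y‖
  set N2 := ∫ y in Metric.ball (0 : E3) 1, ‖y‖ ^ (-(α + 1))
  have hN1 : 0 ≤ N1 := integral_nonneg fun _ => norm_nonneg _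
  have hN2 : 0 ≤ N2 := integral_nonneg fun _ => Real.rpow_nonneg (norm_nonneg _) _
  refine ⟨A * N1 + A * B * R ^ (3 + -(α + 1)) * N2 + A * B * R ^ (-(α + 1)) + 1, by positivity,
    fun c hc t ht x => ?_⟩
  obtain ⟨hρ1, hρ2⟩ := hρ c hc t ht
  set T := 1 + t with hT
  have hT1 : 1 ≤ T := by linarith
  have hT0 : 0 < T := by linarith
  set ρ := modelDensity m c t
  have hρ0 : ∀ y, 0 ≤ ρ y := modelDensity_nonneg m c t
  have hρi : Integrable (fun y => ρ (x - y)) := (integrable_modelDensity hm c t).comp_sub_left x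
  -- Three regions. For |y| < R the kernel is merely integrable, and for R ≤ |y| < RT it has its
  -- power bound; both use the density's height T⁻³. For |y| ≥ RT the kernel is at most
  -- B(RT)^{-(α+1)}, and the mass of the density is used.
  set U : E3 → ℝ := fun y => A * (T ^ 3)⁻¹ * (Metric.ball 0 R).indicator (fun y => ‖K y‖) y
    + A * (T ^ 3)⁻¹ * B * (Metric.ball 0 (R * T)).indicator (fun y => ‖y‖ ^ (-(α + 1))) y
    + B * (R * T) ^ (-(α + 1)) * ρ (x - y) with hU
  have i1 : Integrable ((Metric.ball 0 R).indicator (fun y => ‖K y‖)) :=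
    hKR.integrable_indicator measurableSet_ball
  have i2 : Integrable ((Metric.ball (0 : E3) (R * T)).indicator (fun y => ‖y‖ ^ (-(α + 1)))) :=
    (integrableOn_ball_norm_rpow (by linarith) _).integrable_indicator measurableSet_ball
  have hUi : Integrable U := ((i1.const_mul _).add (i2.const_mul _)).add (hρi.const_mul _)
  have hle : ∀ᵐ y, ρ (x - y) * ‖K y‖ ≤ U y := by
    filter_upwards [hK] with y hy
    have n1 : 0 ≤ (Metric.ball 0 R).indicator (fun y => ‖K y‖) y :=
      indicator_nonneg (fun _ _ => norm_nonneg _) _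
    have n2 : 0 ≤ (Metric.ball (0 : E3) (R * T)).indicator (fun y => ‖y‖ ^ (-(α + 1))) y :=
      indicator_nonneg (fun _ _ => Real.rpow_nonneg (norm_nonneg _) _) _
    have n3 : 0 ≤ B * (R * T) ^ (-(α + 1)) * ρ (x - y) := by
      have := hρ0 (x - y); positivity
    have n4 : 0 ≤ A * (T ^ 3)⁻¹ := by positivity
    rcases lt_or_ge ‖y‖ R with h1 | h1
    · have e1 : (Metric.ball 0 R).indicator (fun y => ‖K y‖) y = ‖K y‖ :=
        indicator_of_mem (by simpa using h1) _
      have : ρ (x - y) * ‖K y‖ ≤ A * (T ^ 3)⁻¹ * ‖K y‖ := by gcongr; exact hρ2 _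
      simp only [hU, e1]
      nlinarith [mul_nonneg (mul_nonneg n4 hB.le) n2]
    · have hKy := (hy h1).2
      rcases lt_or_ge ‖y‖ (R * T) with h2 | h2
      · have e2 : (Metric.ball (0 : E3) (R * T)).indicator (fun y => ‖y‖ ^ (-(α + 1))) y
            = ‖y‖ ^ (-(α + 1)) := indicator_of_mem (by simpa using h2) _
        have : ρ (x - y) * ‖K y‖ ≤ A * (T ^ 3)⁻¹ * (B * ‖y‖ ^ (-(α + 1))) := by
          gcongr; exact hρ2 _
        simp only [hU, e2]
        nlinarith [mul_nonneg n4 n1]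
      · have : ‖y‖ ^ (-(α + 1)) ≤ (R * T) ^ (-(α + 1)) :=
          Real.rpow_le_rpow_of_nonpos (by positivity) h2 (by linarith)
        have : ρ (x - y) * ‖K y‖ ≤ ρ (x - y) * (B * (R * T) ^ (-(α + 1))) := by
          have := hρ0 (x - y)
          gcongr
          exact hKy.trans (by gcongr)
        simp only [hU]
        nlinarith [mul_nonneg n4 n1, mul_nonneg (mul_nonneg n4 hB.le) n2]
  have hint : Integrable (fun y => ρ (x - y) * ‖K y‖) := by
    refine hUi.mono' (hρi.aestronglyMeasurable.mul hKm.norm) ?_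
    filter_upwards [hle] with y hy
    rwa [Real.norm_of_nonneg (mul_nonneg (hρ0 _) (norm_nonneg _))]
  refine ⟨hint, (integral_mono_ae hint hUi hle).trans ?_⟩
  have hUint : ∫ y, U y = A * (T ^ 3)⁻¹ * N1
      + A * (T ^ 3)⁻¹ * B * ((R * T) ^ (3 + -(α + 1)) * N2)
      + B * (R * T) ^ (-(α + 1)) * ∫ y, ρ y := by
    have j1 := i1.const_mul (A * (T ^ 3)⁻¹)
    have j2 := i2.const_mul (A * (T ^ 3)⁻¹ * B)
    have j := integral_add (j1.add j2) (hρi.const_mul (B * (R * T) ^ (-(α + 1))))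
    simp only [Pi.add_apply] at j
    rw [hU, j, integral_add j1 j2, integral_const_mul, integral_const_mul,
      integral_const_mul, integral_indicator measurableSet_ball,
      integral_indicator measurableSet_ball, setIntegral_ball_norm_rpow (by positivity),
      integral_sub_left_eq_self ρ volume x]
  rw [hUint]
  set D := T ^ (-(α + 1)) with hD
  have hD0 : 0 < D := by positivity
  have e3 : (T ^ 3)⁻¹ = T ^ (-3 : ℝ) := by
    rw [Real.rpow_neg hT0.le]; norm_cast
  -- The inner ball decays like T⁻³, which suffices because α + 1 < 3.
  have e4 : (T ^ 3)⁻¹ ≤ D := by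
    rw [e3]; exact Real.rpow_le_rpow_of_exponent_le hT1 (by linarith)
  have e5 : (T ^ 3)⁻¹ * (R * T) ^ (3 + -(α + 1)) = R ^ (3 + -(α + 1)) * D := by
    rw [Real.mul_rpow hR.le hT0.le, e3, hD, mul_left_comm, ← Real.rpow_add hT0]
    congr 2; ring
  have e6 : (R * T) ^ (-(α + 1)) = R ^ (-(α + 1)) * D := Real.mul_rpow hR.le hT0.le
  calc _ = A * N1 * (T ^ 3)⁻¹ + A * B * N2 * ((T ^ 3)⁻¹ * (R * T) ^ (3 + -(α + 1)))
        + B * (R * T) ^ (-(α + 1)) * ∫ y, ρ y := by ring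
    _ ≤ A * N1 * D + A * B * N2 * (R ^ (3 + -(α + 1)) * D) + B * (R ^ (-(α + 1)) * D) * A := by
      rw [e5, e6]; gcongr
    _ ≤ _ := by
      have : 0 ≤ 1 * D := by positivity
      linarith


/-! ### The characteristic flow as a small perturbation of free transport. -/

/-- A Gronwall-type bound in both time directions, for a rate of small integral. -/
theorem norm_le_of_norm_deriv_le {V : Type*} [NormedAddCommGroup V] [NormedSpace ℝ V]
    [CompleteSpace V] {δ δ' : ℝ → V} {a b : ℝ → ℝ} {T κ B : ℝ}
    (hδ : ∀ s ∈ Icc 0 T, HasDerivWithinAt δ (δ' s) (Ici 0) s)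
    (hδ' : ContinuousOn δ' (Icc 0 T)) (ha0 : ∀ s ∈ Icc 0 T, 0 ≤ a s)
    (hai : IntegrableOn a (Icc 0 T)) (hbi : IntegrableOn b (Icc 0 T))
    (hle : ∀ s ∈ Icc 0 T, ‖δ' s‖ ≤ a s * ‖δ s‖ + b s)
    (hκ : ∫ s in Icc 0 T, a s ≤ κ) (hκ2 : κ ≤ 1 / 2) (hB : ∫ s in Icc 0 T, b s ≤ B)
    {s t : ℝ} (hs : s ∈ Icc 0 T) (ht : t ∈ Icc 0 T) :
    ‖δ s‖ ≤ 2 * (‖δ t‖ + B) ∧ ‖δ s - δ t‖ ≤ 2 * κ * (‖δ t‖ + B) + B := by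
  have hcont : ContinuousOn δ (Icc 0 T) := fun r hr =>
    (hδ r hr).continuousWithinAt.mono Icc_subset_Ici_self
  have hne : (Icc 0 T).Nonempty := ⟨s, hs⟩
  -- Instead of an exponential Gronwall factor, the maximum of ‖δ‖ over the whole interval is
  -- absorbed, using κ ≤ 1/2. The argument is insensitive to whether s lies before or after t.
  obtain ⟨r, hr, hmax⟩ := isCompact_Icc.exists_isMaxOn hne hcont.norm
  have hκ0 : 0 ≤ κ := (setIntegral_nonneg measurableSet_Icc ha0).trans hκ
  have hfi : IntegrableOn (fun u => ‖δ' u‖) (Icc 0 T) :=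
    hδ'.norm.integrableOn_compact isCompact_Icc
  have hgi : IntegrableOn (fun u => a u * ‖δ r‖ + b u) (Icc 0 T) :=
    (hai.mul_const _).add hbi
  have key : ∀ u ∈ Icc 0 T, ‖δ u - δ t‖ ≤ κ * ‖δ r‖ + B := by
    intro u hu
    have hsub : uIcc t u ⊆ Icc 0 T := by
      rw [← uIcc_of_le (hs.1.trans hs.2)]
      apply uIcc_subset_uIcc <;> rwa [uIcc_of_le (hs.1.trans hs.2)]
    have hftc : ∫ v in t..u, δ' v = δ u - δ t := by
      apply intervalIntegral.integral_eq_sub_of_hasDeriv_right (hcont.mono hsub)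
      · intro v hv
        have hv' : v ∈ Icc 0 T := hsub (Ioo_subset_Icc_self hv)
        exact (hδ v hv').mono fun w hw => hv'.1.trans (le_of_lt hw)
      · exact (hδ'.mono hsub).intervalIntegrable
    rw [← hftc]
    calc ‖∫ v in t..u, δ' v‖ ≤ ∫ v in uIoc t u, ‖δ' v‖ :=
          intervalIntegral.norm_integral_le_integral_norm_uIoc
      _ ≤ ∫ v in Icc 0 T, ‖δ' v‖ :=
          setIntegral_mono_set hfi (Filter.Eventually.of_forall fun _ => norm_nonneg _)
            (uIoc_subset_uIcc.trans hsub).eventuallyLE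
      _ ≤ ∫ v in Icc 0 T, (a v * ‖δ r‖ + b v) := by
          refine setIntegral_mono_on hfi hgi measurableSet_Icc fun v hv => (hle v hv).trans ?_
          have := hmax hv
          simp only [mem_ofPred_eq] at this
          have := ha0 v hv
          gcongr
      _ = (∫ v in Icc 0 T, a v) * ‖δ r‖ + ∫ v in Icc 0 T, b v := by
          rw [integral_add (hai.mul_const _) hbi, integral_mul_const]
      _ ≤ κ * ‖δ r‖ + B := by gcongr
  have h1 : ‖δ r‖ ≤ ‖δ r - δ t‖ + ‖δ t‖ := by
    simpa using norm_add_le (δ r - δ t) (δ t)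
  have h2 := key r hr
  have h3 : κ * ‖δ r‖ ≤ 1 / 2 * ‖δ r‖ := by gcongr
  have h4 : ‖δ r‖ ≤ 2 * (‖δ t‖ + B) := by linarith
  refine ⟨(hmax hs).trans h4, (key s hs).trans ?_⟩
  nlinarith

/-- The vector field of the characteristics in the coordinates `(x - t v_c(p), p)`. -/
def waveField (c : ℝ≥0∞) (E : ℝ → E3 → E3) (s : ℝ) (z : Phase) : Phase :=
  (-(s • velD c z.2 (E s (z.1 + s • vel c z.2))), E s (z.1 + s • vel c z.2))

/-- On `[0,T]`, the field `E` and its variation are bounded by `a(s) / (1 + s)` and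
`a(s) / (1 + s)²`, and `∫ a ≤ κ`. -/
structure IsEnvelope (E : ℝ → E3 → E3) (T κ : ℝ) (a : ℝ → ℝ) : Prop where
  continuousOn : ContinuousOn (fun q : ℝ × E3 => E q.1 q.2) (Ici 0 ×ˢ univ)
  integrableOn : IntegrableOn a (Icc 0 T)
  integral_le : ∫ s in Icc 0 T, a s ≤ κ
  bound : ∀ s ∈ Icc 0 T, ∀ x, (1 + s) * ‖E s x‖ ≤ a s
  lip : ∀ s ∈ Icc 0 T, ∀ x y, (1 + s) ^ 2 * ‖E s x - E s y‖ ≤ a s * ‖x - y‖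

theorem IsEnvelope.nonneg {E : ℝ → E3 → E3} {T κ : ℝ} {a : ℝ → ℝ} (h : IsEnvelope E T κ a) :
    ∀ s ∈ Icc 0 T, 0 ≤ a s := fun s hs => by
  have h0 : 0 ≤ s := hs.1
  exact le_trans (by positivity) (h.bound s hs 0)

theorem IsEnvelope.const_nonneg {E : ℝ → E3 → E3} {T κ : ℝ} {a : ℝ → ℝ} (h : IsEnvelope E T κ a) :
    0 ≤ κ := (setIntegral_nonneg measurableSet_Icc h.nonneg).trans h.integral_le

theorem IsEnvelope.norm_waveField_le {E : ℝ → E3 → E3} {T κ : ℝ} {a : ℝ → ℝ}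
    (h : IsEnvelope E T κ a) (c : ℝ≥0∞) {s : ℝ} (hs : s ∈ Icc 0 T) (z : Phase) :
    ‖waveField c E s z‖ ≤ a s := by
  have h0 : 0 ≤ s := hs.1
  have h1 := h.bound s hs (z.1 + s • vel c z.2)
  have h2 := norm_nonneg (E s (z.1 + s • vel c z.2))
  rw [waveField, Prod.norm_def]
  apply max_le
  · rw [norm_neg, norm_smul, Real.norm_of_nonneg h0]
    have := norm_velD_apply_le c z.2 (E s (z.1 + s • vel c z.2))
    nlinarith
  · dsimp only; nlinarith

theorem norm_add_smul_vel_sub_le (c : ℝ≥0∞) {s : ℝ} (hs : 0 ≤ s) (z z' : Phase) :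
    ‖z.1 + s • vel c z.2 - (z'.1 + s • vel c z'.2)‖ ≤ (1 + s) * ‖z - z'‖ := by
  have e : z.1 + s • vel c z.2 - (z'.1 + s • vel c z'.2)
      = (z - z').1 + s • (vel c z.2 - vel c z'.2) := by
    simp only [Prod.fst_sub]; module
  rw [e]
  calc _ ≤ ‖(z - z').1‖ + ‖s • (vel c z.2 - vel c z'.2)‖ := norm_add_le _ _
    _ ≤ ‖z - z'‖ + s * ‖z - z'‖ := by
      rw [norm_smul, Real.norm_of_nonneg hs]
      gcongr
      · exact norm_fst_le _
      · exact (norm_vel_sub_le c _ _).trans (norm_snd_le (z - z'))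
    _ = _ := by ring

/-- A displacement of z moves the position x + s v by up to 1 + s times as much, and the first
component carries another factor s; these are the two weights in the envelope's Lipschitz bound. Of
the constant 4, three units come from varying Dv_c and one from varying E. -/
theorem IsEnvelope.norm_waveField_sub_le {E : ℝ → E3 → E3} {T κ : ℝ} {a : ℝ → ℝ}
    (h : IsEnvelope E T κ a) {c : ℝ≥0∞} (hc : 1 ≤ c) {s : ℝ} (hs : s ∈ Icc 0 T) (z z' : Phase) :
    ‖waveField c E s z - waveField c E s z'‖ ≤ 4 * a s * ‖z - z'‖ := by
  have h0 : 0 ≤ s := hs.1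
  have ha := h.nonneg s hs
  set x := z.1 + s • vel c z.2 with hx
  set x' := z'.1 + s • vel c z'.2 with hx'
  have hxx : ‖x - x'‖ ≤ (1 + s) * ‖z - z'‖ := norm_add_smul_vel_sub_le c h0 z z'
  have hE : (1 + s) * ‖E s x - E s x'‖ ≤ a s * ‖z - z'‖ := by
    have h1 := h.lip s hs x x'
    have h2 : (1 + s) ^ 2 * ‖E s x - E s x'‖ ≤ a s * ((1 + s) * ‖z - z'‖) :=
      h1.trans (by gcongr)
    have h3 : 0 < 1 + s := by linarith
    nlinarith
  have hE0 := norm_nonneg (E s x - E s x')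
  have hz0 := norm_nonneg (z - z')
  have hp : ‖z.2 - z'.2‖ ≤ ‖z - z'‖ := norm_snd_le (z - z')
  rw [waveField, waveField, Prod.norm_def, ← hx, ← hx']
  apply max_le
  · have e : -(s • velD c z.2 (E s x)) - -(s • velD c z'.2 (E s x'))
        = -(s • ((velD c z.2 (E s x) - velD c z'.2 (E s x)) + velD c z'.2 (E s x - E s x'))) := by
      rw [map_sub]; module
    simp only [Prod.fst_sub]
    rw [e, norm_neg, norm_smul, Real.norm_of_nonneg h0]
    have e1 := norm_velD_sub_apply_le hc z.2 z'.2 (E s x)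
    have e2 := norm_velD_apply_le c z'.2 (E s x - E s x')
    have e3 := h.bound s hs x
    have e4 : ‖(velD c z.2 (E s x) - velD c z'.2 (E s x)) + velD c z'.2 (E s x - E s x')‖
        ≤ 3 * ‖z - z'‖ * ‖E s x‖ + ‖E s x - E s x'‖ :=
      (norm_add_le _ _).trans (add_le_add (e1.trans (by gcongr)) e2)
    have e5 : s * ‖E s x‖ ≤ a s := by nlinarith [norm_nonneg (E s x)]
    calc _ ≤ s * (3 * ‖z - z'‖ * ‖E s x‖ + ‖E s x - E s x'‖) := by gcongr
      _ = 3 * ‖z - z'‖ * (s * ‖E s x‖) + s * ‖E s x - E s x'‖ := by ring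
      _ ≤ 3 * ‖z - z'‖ * a s + a s * ‖z - z'‖ := by
        have e6 : s * ‖E s x - E s x'‖ ≤ a s * ‖z - z'‖ := by nlinarith
        exact add_le_add (mul_le_mul_of_nonneg_left e5 (by positivity)) e6
      _ = _ := by ring
  · simp only [Prod.snd_sub]
    nlinarith [mul_nonneg ha hz0]

theorem continuousOn_waveField {E : ℝ → E3 → E3} {T : ℝ}
    (hE : ContinuousOn (fun q : ℝ × E3 => E q.1 q.2) (Ici 0 ×ˢ univ)) (c : ℝ≥0∞) {Z : ℝ → Phase}
    (hZ : ContinuousOn Z (Icc 0 T)) : ContinuousOn (fun s => waveField c E s (Z s)) (Icc 0 T) := by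
  have h2 : ContinuousOn (fun s => (Z s).2) (Icc 0 T) := continuous_snd.comp_continuousOn hZ
  have h1 : ContinuousOn (fun s => (Z s).1) (Icc 0 T) := continuous_fst.comp_continuousOn hZ
  have hv : ContinuousOn (fun s => vel c (Z s).2) (Icc 0 T) :=
    (continuous_vel c).comp_continuousOn h2
  have hg : ContinuousOn (fun s => (gam c (Z s).2)⁻¹) (Icc 0 T) :=
    ((continuous_gam c).comp_continuousOn h2).inv₀ fun s _ => (gam_pos c _).ne'
  have hx : ContinuousOn (fun s => (Z s).1 + s • vel c (Z s).2) (Icc 0 T) :=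
    h1.add (continuousOn_id.smul hv)
  have hEx : ContinuousOn (fun s => E s ((Z s).1 + s • vel c (Z s).2)) (Icc 0 T) :=
    hE.comp (continuousOn_id.prodMk hx) fun s hs => ⟨hs.1, mem_univ _⟩
  have hin : ContinuousOn (fun s => inner ℝ (vel c (Z s).2) (E s ((Z s).1 + s • vel c (Z s).2)))
      (Icc 0 T) := ContinuousOn.inner hv hEx
  have hD : ContinuousOn (fun s => velD c (Z s).2 (E s ((Z s).1 + s • vel c (Z s).2)))
      (Icc 0 T) := by
    simp only [velD_apply]
    exact hg.smul (hEx.sub ((hin.const_mul _).smul hv))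
  exact ContinuousOn.prodMk (continuousOn_id.smul hD).neg hEx

/-- The derivative of x - t v_c(p) is v_c - v_c - t Dv_c(p) E: free transport cancels and only the
force remains. -/
theorem hasDerivWithinAt_waveOp {c : ℝ≥0∞} {E : ℝ → E3 → E3} {Φ : ℝ → Phase → Phase}
    (hΦ : IsCharFlow c E Φ) (z : Phase) {s : ℝ} (hs : 0 ≤ s) :
    HasDerivWithinAt (fun t => waveOp c Φ t z) (waveField c E s (waveOp c Φ s z)) (Ici 0) s := by
  have h := (hΦ z).2 s hs
  have h1 : HasDerivWithinAt (fun t => (Φ t z).1) (vel c (Φ s z).2) (Ici 0) s := h.fst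
  have h2 : HasDerivWithinAt (fun t => (Φ t z).2) (E s (Φ s z).1) (Ici 0) s := h.snd
  have h3 : HasDerivWithinAt (fun t => vel c (Φ t z).2) (velD c (Φ s z).2 (E s (Φ s z).1))
      (Ici 0) s := HasFDerivAt.comp_hasDerivWithinAt (f := fun t => (Φ t z).2) s
    (hasFDerivAt_vel c (Φ s z).2) h2
  have h4 := h1.sub ((hasDerivWithinAt_id s (Ici 0)).smul h3)
  refine (h4.prodMk h2).congr_deriv ?_
  simp [waveField, waveOp, freeFlowInv]

theorem freeFlow_waveOp (c : ℝ≥0∞) (Φ : ℝ → Phase → Phase) (t : ℝ) (z : Phase) :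
    freeFlow c t (waveOp c Φ t z) = Φ t z := freeFlow_freeFlowInv c t _

theorem waveOp_zero {c : ℝ≥0∞} {E : ℝ → E3 → E3} {Φ : ℝ → Phase → Phase}
    (hΦ : IsCharFlow c E Φ) (z : Phase) : waveOp c Φ 0 z = z := by
  simp [waveOp, freeFlowInv, (hΦ z).1]

section Wave
variable {c : ℝ≥0∞} {E : ℝ → E3 → E3} {Φ : ℝ → Phase → Phase} {T κ : ℝ} {a : ℝ → ℝ}

theorem continuousOn_waveOp_time (hΦ : IsCharFlow c E Φ) (z : Phase) :
    ContinuousOn (fun s => waveOp c Φ s z) (Icc 0 T) := fun _ hs =>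
  (hasDerivWithinAt_waveOp hΦ z hs.1).continuousWithinAt.mono Icc_subset_Ici_self

theorem IsEnvelope.norm_waveOp_sub_le (h : IsEnvelope E T κ a) (hΦ : IsCharFlow c E Φ)
    {s t : ℝ} (hs : s ∈ Icc 0 T) (ht : t ∈ Icc 0 T) (z : Phase) :
    ‖waveOp c Φ s z - waveOp c Φ t z‖ ≤ κ := by
  -- With zero linear rate the Gronwall bound reduces to integrating the speed.
  have := (norm_le_of_norm_deriv_le (κ := 0) (a := fun _ => 0) (b := a)
    (fun r hr => hasDerivWithinAt_waveOp hΦ z hr.1)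
    (continuousOn_waveField h.continuousOn c (continuousOn_waveOp_time hΦ z)) (by simp) (by simp)
    h.integrableOn (fun r hr => by simpa using h.norm_waveField_le c hr _) (by simp) (by norm_num)
    h.integral_le hs ht).2
  simpa using this

/-- The difference of two trajectories solves a linear inequality of rate 4a, whose integral is at
most 4/32 = 1/8; doubling in the Gronwall bound gives 1/4. The reference time t is free, so the
inverse map is covered too. -/
theorem IsEnvelope.waveOp_lip (h : IsEnvelope E T κ a) (hκ : κ ≤ 1 / 32) (hc : 1 ≤ c)
    (hΦ : IsCharFlow c E Φ) {s t : ℝ} (hs : s ∈ Icc 0 T) (ht : t ∈ Icc 0 T) (z z' : Phase) :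
    ‖(waveOp c Φ s z - waveOp c Φ s z') - (waveOp c Φ t z - waveOp c Φ t z')‖
      ≤ 1 / 4 * ‖waveOp c Φ t z - waveOp c Φ t z'‖ := by
  have := (norm_le_of_norm_deriv_le (κ := 1 / 8) (B := 0) (a := fun s => 4 * a s) (b := fun _ => 0)
    (fun r hr => (hasDerivWithinAt_waveOp hΦ z hr.1).sub (hasDerivWithinAt_waveOp hΦ z' hr.1))
    ((continuousOn_waveField h.continuousOn c (continuousOn_waveOp_time hΦ z)).sub
      (continuousOn_waveField h.continuousOn c (continuousOn_waveOp_time hΦ z')))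
    (fun r hr => by have := h.nonneg r hr; positivity) (h.integrableOn.const_mul 4)
    (by simp) (fun r hr => by
      simpa using h.norm_waveField_sub_le hc hr (waveOp c Φ r z) (waveOp c Φ r z'))
    (by rw [integral_const_mul]; linarith [h.integral_le]) (by norm_num) (by simp) hs ht).2
  simp only [Pi.sub_apply] at this
  linarith

/-- `𝒲_c(t)` is a homeomorphism. -/
theorem IsEnvelope.exists_homeomorph (h : IsEnvelope E T κ a) (hκ : κ ≤ 1 / 32) (hc : 1 ≤ c)
    (hΦ : IsCharFlow c E Φ) {t : ℝ} (ht : t ∈ Icc 0 T) :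
    ∃ W : Phase ≃ₜ Phase, ∀ z, W z = waveOp c Φ t z := by
  have h0 : (0 : ℝ) ∈ Icc 0 T := ⟨le_rfl, ht.1.trans ht.2⟩
  -- Distance 1/4 < 1 to the identity in the Lipschitz sense gives bijectivity and continuity of the
  -- inverse at once.
  have hA : ApproximatesLinearOn (waveOp c Φ t)
      ((ContinuousLinearEquiv.refl ℝ Phase : Phase ≃L[ℝ] Phase) : Phase →L[ℝ] Phase) univ
      (1 / 4 : NNReal) := by
    intro z _ z' _
    have := h.waveOp_lip hκ hc hΦ ht h0 z z'
    simp only [waveOp_zero hΦ] at this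
    simpa using this
  refine ⟨hA.toHomeomorph _ (Or.inr ?_), fun z => rfl⟩
  have h1 : ‖(((ContinuousLinearEquiv.refl ℝ Phase).symm : Phase ≃L[ℝ] Phase) : Phase →L[ℝ] Phase)‖₊
      ≤ 1 := ContinuousLinearMap.norm_id_le
  refine lt_of_lt_of_le (b := (1 : NNReal)) ?_ ?_
  · rw [one_div]; exact inv_lt_one_of_one_lt₀ (by norm_num)
  · refine (one_le_inv₀ ?_).2 h1
    refine pos_iff_ne_zero.2 fun h0 => ?_
    have h2 : (((ContinuousLinearEquiv.refl ℝ Phase).symm : Phase ≃L[ℝ] Phase) : Phase →L[ℝ] Phase)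
      = 0 := nnnorm_eq_zero.1 h0
    obtain ⟨x, hx⟩ := exists_ne (0 : Phase)
    exact hx (by simpa using congrArg (fun f : Phase →L[ℝ] Phase => f x) h2)

end Wave

/-- The inverse of the finite-time wave operator. -/
def waveInv (c : ℝ≥0∞) (Φ : ℝ → Phase → Phase) (t : ℝ) : Phase → Phase :=
  Function.invFun (waveOp c Φ t)

section Wave
variable {c : ℝ≥0∞} {E : ℝ → E3 → E3} {Φ : ℝ → Phase → Phase} {T κ : ℝ} {a : ℝ → ℝ}

theorem IsEnvelope.waveOp_waveInv (h : IsEnvelope E T κ a) (hκ : κ ≤ 1 / 32) (hc : 1 ≤ c)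
    (hΦ : IsCharFlow c E Φ) {t : ℝ} (ht : t ∈ Icc 0 T) (z : Phase) :
    waveOp c Φ t (waveInv c Φ t z) = z := by
  obtain ⟨W, hW⟩ := h.exists_homeomorph hκ hc hΦ ht
  exact Function.invFun_eq ⟨W.symm z, by rw [← hW, W.apply_symm_apply]⟩

theorem IsEnvelope.continuous_waveOp (h : IsEnvelope E T κ a) (hκ : κ ≤ 1 / 32) (hc : 1 ≤ c)
    (hΦ : IsCharFlow c E Φ) {t : ℝ} (ht : t ∈ Icc 0 T) : Continuous (waveOp c Φ t) := by
  obtain ⟨W, hW⟩ := h.exists_homeomorph hκ hc hΦ ht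
  exact W.continuous.congr hW

theorem IsEnvelope.norm_waveInv_sub_le (h : IsEnvelope E T κ a) (hκ : κ ≤ 1 / 32) (hc : 1 ≤ c)
    (hΦ : IsCharFlow c E Φ) {t : ℝ} (ht : t ∈ Icc 0 T) (z : Phase) :
    ‖waveInv c Φ t z - z‖ ≤ κ := by
  have h0 : (0 : ℝ) ∈ Icc 0 T := ⟨le_rfl, ht.1.trans ht.2⟩
  have := h.norm_waveOp_sub_le hΦ h0 ht (waveInv c Φ t z)
  rwa [h.waveOp_waveInv hκ hc hΦ ht, waveOp_zero hΦ] at this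

/-- The same trajectory estimate, with the reference at time t and evaluation at time 0. -/
theorem IsEnvelope.waveInv_lip (h : IsEnvelope E T κ a) (hκ : κ ≤ 1 / 32) (hc : 1 ≤ c)
    (hΦ : IsCharFlow c E Φ) {t : ℝ} (ht : t ∈ Icc 0 T) (z z' : Phase) :
    ‖(waveInv c Φ t z - waveInv c Φ t z') - (z - z')‖ ≤ 1 / 4 * ‖z - z'‖ := by
  have h0 : (0 : ℝ) ∈ Icc 0 T := ⟨le_rfl, ht.1.trans ht.2⟩
  have := h.waveOp_lip hκ hc hΦ h0 ht (waveInv c Φ t z) (waveInv c Φ t z')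
  rwa [h.waveOp_waveInv hκ hc hΦ ht, h.waveOp_waveInv hκ hc hΦ ht, waveOp_zero hΦ,
    waveOp_zero hΦ] at this

theorem IsEnvelope.norm_waveInv_sub_waveInv_le (h : IsEnvelope E T κ a) (hκ : κ ≤ 1 / 32)
    (hc : 1 ≤ c) (hΦ : IsCharFlow c E Φ) {t : ℝ} (ht : t ∈ Icc 0 T) (z z' : Phase) :
    ‖waveInv c Φ t z - waveInv c Φ t z'‖ ≤ 2 * ‖z - z'‖ := by
  have h1 := h.waveInv_lip hκ hc hΦ ht z z'
  have h2 := norm_add_le ((waveInv c Φ t z - waveInv c Φ t z') - (z - z')) (z - z')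
  rw [sub_add_cancel] at h2
  linarith [norm_nonneg (z - z')]

end Wave

theorem velD_top (p h : E3) : velD ⊤ p h = h := by simp [velD_apply, gam, invSpeed_top]

/-! ### Wave operators for speeds c and ∞. -/

section Compare
variable {c : ℝ≥0∞} {E E' : ℝ → E3 → E3} {Φ Φ' : ℝ → Phase → Phase} {T κ : ℝ} {a : ℝ → ℝ}

/-- Three errors: the fields differ by D, the positions differ by s|v_c(p) - p| ≤ s c⁻²⟨p⟩³, and
Dv_c(p) differs from the identity by 2c⁻²|p|². The last two together give 3c⁻²⟨p⟩³ a(s). -/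
theorem IsEnvelope.norm_waveField_sub_top_le (h' : IsEnvelope E' T κ a) {s : ℝ}
    (hs : s ∈ Icc 0 T) {D : ℝ} (hD : ∀ x, ‖E s x - E' s x‖ ≤ D) (z : Phase) :
    ‖waveField c E s z - waveField ⊤ E' s z‖
      ≤ (1 + s) * D + 3 * a s * invSpeed c ^ 2 * jb z.2 ^ 3 := by
  have h0 : 0 ≤ s := hs.1
  have ha := h'.nonneg s hs
  set k := invSpeed c
  set p := z.2
  set x := z.1 + s • vel c p with hx
  set x' := z.1 + s • vel ⊤ p with hx'
  have hj := one_le_jb p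
  have hp3 : ‖p‖ ^ 3 ≤ jb p ^ 3 := by gcongr; exact norm_le_jb p
  have hp2 : ‖p‖ ^ 2 ≤ jb p ^ 3 := by
    calc ‖p‖ ^ 2 ≤ jb p ^ 2 := by gcongr; exact norm_le_jb p
      _ ≤ jb p ^ 3 := pow_le_pow_right₀ hj (by norm_num)
  have hxx : ‖x - x'‖ ≤ s * (k ^ 2 * jb p ^ 3) := by
    have e : x - x' = s • (vel c p - p) := by rw [hx, hx', vel_top]; module
    rw [e, norm_smul, Real.norm_of_nonneg h0]
    gcongr
    exact (norm_vel_sub_self_le c p).trans (by gcongr)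
  have hk : 0 ≤ k ^ 2 * jb p ^ 3 := by have := jb_pos p; positivity
  have hl := h'.lip s hs x x'
  have hE1 : (1 + s) * ‖E' s x - E' s x'‖ ≤ a s * (k ^ 2 * jb p ^ 3) := by
    have h1 : (1 + s) ^ 2 * ‖E' s x - E' s x'‖ ≤ a s * ((1 + s) * (k ^ 2 * jb p ^ 3)) :=
      hl.trans (by gcongr; nlinarith)
    have : 0 < 1 + s := by linarith
    nlinarith
  have hE2 : (1 + s) * ‖E s x - E' s x'‖ ≤ (1 + s) * D + a s * (k ^ 2 * jb p ^ 3) := by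
    have h1 : ‖E s x - E' s x'‖ ≤ D + ‖E' s x - E' s x'‖ :=
      (norm_sub_le_norm_sub_add_norm_sub _ (E' s x) _).trans (by gcongr; exact hD x)
    calc _ ≤ (1 + s) * (D + ‖E' s x - E' s x'‖) := by gcongr
      _ ≤ _ := by linarith
  have hn := norm_nonneg (E s x - E' s x')
  have hak : 0 ≤ a s * (k ^ 2 * jb p ^ 3) := by positivity
  rw [waveField, waveField, Prod.norm_def, ← hx, ← hx']
  apply max_le
  · have e : -(s • velD c p (E s x)) - -(s • velD ⊤ p (E' s x'))
        = -(s • (velD c p (E s x - E' s x') + (velD c p (E' s x') - E' s x'))) := by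
      rw [map_sub, velD_top]; module
    simp only [Prod.fst_sub]
    rw [e, norm_neg, norm_smul, Real.norm_of_nonneg h0]
    have e1 := norm_velD_apply_le c p (E s x - E' s x')
    have e2 := norm_velD_apply_sub_self_le c p (E' s x')
    have e3 := h'.bound s hs x'
    have e4 : s * ‖E' s x'‖ ≤ a s := by nlinarith [norm_nonneg (E' s x')]
    calc _ ≤ s * (‖E s x - E' s x'‖ + 2 * k ^ 2 * ‖p‖ ^ 2 * ‖E' s x'‖) := by
          gcongr; exact (norm_add_le _ _).trans (add_le_add e1 e2)
      _ = s * ‖E s x - E' s x'‖ + 2 * k ^ 2 * ‖p‖ ^ 2 * (s * ‖E' s x'‖) := by ring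
      _ ≤ (1 + s) * ‖E s x - E' s x'‖ + 2 * k ^ 2 * jb p ^ 3 * a s := by
        gcongr
        linarith
      _ ≤ _ := by linarith
  · simp only [Prod.snd_sub]
    nlinarith

/-- The trajectories are matched at an arbitrary time t. Matching at 0 compares the wave operators,
while matching at t and reading off at 0 compares their inverses. -/
theorem norm_waveOp_sub_waveOp_top_le (h : IsEnvelope E T κ a) (h' : IsEnvelope E' T κ a)
    (hκ : κ ≤ 1 / 32) (hc : 1 ≤ c) (hΦ : IsCharFlow c E Φ) (hΦ' : IsCharFlow ⊤ E' Φ')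
    {D : ℝ → ℝ} (hDi : IntegrableOn D (Icc 0 T)) (hD : ∀ s ∈ Icc 0 T, ∀ x,
      (1 + s) * ‖E s x - E' s x‖ ≤ D s) {s t : ℝ} (hs : s ∈ Icc 0 T) (ht : t ∈ Icc 0 T)
    {z z' : Phase} (heq : waveOp c Φ t z = waveOp ⊤ Φ' t z') :
    ‖waveOp c Φ s z - waveOp ⊤ Φ' s z'‖ ≤ 2 * ((∫ r in Icc 0 T, D r)
      + 24 * κ * invSpeed c ^ 2 * jb (waveOp ⊤ Φ' t z').2 ^ 3) := by
  set P := jb (waveOp ⊤ Φ' t z').2 with hP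
  have hP0 : 0 < P := jb_pos _
  have hκ0 := h.const_nonneg
  -- Momenta drift by at most κ ≤ 1, so brackets at most double along a trajectory; 8 = 2³, whence
  -- 24 = 3 · 8.
  have hjb : ∀ r ∈ Icc 0 T, jb (waveOp ⊤ Φ' r z').2 ^ 3 ≤ 8 * P ^ 3 := by
    intro r hr
    have h1 : ‖(waveOp ⊤ Φ' r z').2 - (waveOp ⊤ Φ' t z').2‖ ≤ 1 :=
      (norm_snd_le (waveOp ⊤ Φ' r z' - waveOp ⊤ Φ' t z')).trans
        ((h'.norm_waveOp_sub_le hΦ' hr ht z').trans (by linarith))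
    have h2 := jb_le_mul_jb h1
    have h3 := jb_pos (waveOp ⊤ Φ' r z').2
    calc jb (waveOp ⊤ Φ' r z').2 ^ 3 ≤ ((1 + 1) * P) ^ 3 := by gcongr
      _ = _ := by ring
  have hbi : IntegrableOn (fun s => D s + 24 * invSpeed c ^ 2 * P ^ 3 * a s) (Icc 0 T) :=
    hDi.add (h.integrableOn.const_mul _)
  have := (norm_le_of_norm_deriv_le (κ := 1 / 8) (a := fun s => 4 * a s)
    (b := fun s => D s + 24 * invSpeed c ^ 2 * P ^ 3 * a s)
    (B := (∫ r in Icc 0 T, D r) + 24 * κ * invSpeed c ^ 2 * P ^ 3)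
    (fun r hr => (hasDerivWithinAt_waveOp hΦ z hr.1).sub (hasDerivWithinAt_waveOp hΦ' z' hr.1))
    ((continuousOn_waveField h.continuousOn c (continuousOn_waveOp_time hΦ z)).sub
      (continuousOn_waveField h'.continuousOn ⊤ (continuousOn_waveOp_time hΦ' z')))
    (fun r hr => by have := h.nonneg r hr; positivity) (h.integrableOn.const_mul 4)
    hbi (fun r hr => by
      have ha := h.nonneg r hr
      have hr0 : 0 < 1 + r := by linarith [hr.1]
      have e1 := h.norm_waveField_sub_le hc hr (waveOp c Φ r z) (waveOp ⊤ Φ' r z')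
      have e2 := h'.norm_waveField_sub_top_le (c := c) (E := E) hr (D := D r / (1 + r))
        (fun x => by rw [le_div_iff₀ hr0, mul_comm]; exact hD r hr x) (waveOp ⊤ Φ' r z')
      rw [mul_div_cancel₀ _ hr0.ne'] at e2
      have e3 := norm_sub_le_norm_sub_add_norm_sub (waveField c E r (waveOp c Φ r z))
        (waveField c E r (waveOp ⊤ Φ' r z')) (waveField ⊤ E' r (waveOp ⊤ Φ' r z'))
      have e4 : 3 * a r * invSpeed c ^ 2 * jb (waveOp ⊤ Φ' r z').2 ^ 3
          ≤ 3 * a r * invSpeed c ^ 2 * (8 * P ^ 3) := by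
        gcongr; exact hjb r hr
      simp only [Pi.sub_apply]
      linarith)
    (by rw [integral_const_mul]; linarith [h.integral_le]) (by norm_num)
    (by
      rw [integral_add hDi (h.integrableOn.const_mul _), integral_const_mul]
      have := h.integral_le
      have : 24 * invSpeed c ^ 2 * P ^ 3 * (∫ s in Icc 0 T, a s)
        ≤ 24 * invSpeed c ^ 2 * P ^ 3 * κ := by gcongr
      linarith) hs ht).1
  simpa [heq] using this

end Compare

/-! ### Gradients, and pointwise bounds on the initial data. -/

section Gradient
variable {h : Phase → ℝ}

theorem hasFDerivAt_left {z : Phase} (hd : DifferentiableAt ℝ h z) :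
    HasFDerivAt (fun x : E3 => h (x, z.2))
      ((fderiv ℝ h z).comp (ContinuousLinearMap.inl ℝ E3 E3)) z.1 :=
  HasFDerivAt.comp (f := fun x : E3 => (x, z.2)) z.1 (g := h) hd.hasFDerivAt
    (hasFDerivAt_prodMk_left z.1 z.2)

theorem hasFDerivAt_right {z : Phase} (hd : DifferentiableAt ℝ h z) :
    HasFDerivAt (fun p : E3 => h (z.1, p))
      ((fderiv ℝ h z).comp (ContinuousLinearMap.inr ℝ E3 E3)) z.2 :=
  HasFDerivAt.comp (f := fun p : E3 => (z.1, p)) z.2 (g := h) hd.hasFDerivAt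
    (hasFDerivAt_prodMk_right z.1 z.2)

theorem gradX_eq {z : Phase} (hd : DifferentiableAt ℝ h z) :
    gradX h z = (InnerProductSpace.toDual ℝ E3).symm
      ((fderiv ℝ h z).comp (ContinuousLinearMap.inl ℝ E3 E3)) := by
  rw [gradX, gradient, (hasFDerivAt_left hd).fderiv]

theorem gradP_eq {z : Phase} (hd : DifferentiableAt ℝ h z) :
    gradP h z = (InnerProductSpace.toDual ℝ E3).symm
      ((fderiv ℝ h z).comp (ContinuousLinearMap.inr ℝ E3 E3)) := by
  rw [gradP, gradient, (hasFDerivAt_right hd).fderiv]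

theorem inner_gradX {z : Phase} (hd : DifferentiableAt ℝ h z) (v : E3) :
    inner ℝ v (gradX h z) = fderiv ℝ h z (v, 0) := by
  rw [gradX_eq hd, real_inner_comm, InnerProductSpace.toDual_symm_apply]; simp

theorem inner_gradP {z : Phase} (hd : DifferentiableAt ℝ h z) (v : E3) :
    inner ℝ v (gradP h z) = fderiv ℝ h z (0, v) := by
  rw [gradP_eq hd, real_inner_comm, InnerProductSpace.toDual_symm_apply]; simp

theorem norm6_nonneg (z : Phase) : 0 ≤ norm6 z := Real.sqrt_nonneg _

theorem norm_fst_le_norm6 (z : Phase) : ‖z.1‖ ≤ norm6 z :=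
  Real.le_sqrt_of_sq_le (by nlinarith [sq_nonneg ‖z.2‖])

theorem norm_snd_le_norm6 (z : Phase) : ‖z.2‖ ≤ norm6 z :=
  Real.le_sqrt_of_sq_le (by nlinarith [sq_nonneg ‖z.1‖])

theorem norm6_le (z : Phase) : norm6 z ≤ 2 * ‖z‖ := by
  have h1 := norm_fst_le z
  have h2 := norm_snd_le z
  rw [norm6, Real.sqrt_le_left (by positivity)]
  nlinarith [norm_nonneg z.1, norm_nonneg z.2, norm_nonneg z]

theorem abs_fderiv_apply_le {z : Phase} (hd : DifferentiableAt ℝ h z) (ζ : Phase) :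
    |fderiv ℝ h z ζ| ≤ 2 * norm6 (grad6 h z) * ‖ζ‖ := by
  have e : fderiv ℝ h z ζ = inner ℝ ζ.1 (gradX h z) + inner ℝ ζ.2 (gradP h z) := by
    rw [inner_gradX hd, inner_gradP hd, ← map_add]; simp
  rw [e]
  have h1 : |inner ℝ ζ.1 (gradX h z)| ≤ ‖ζ‖ * norm6 (grad6 h z) :=
    (abs_real_inner_le_norm _ _).trans (by
      gcongr
      · exact norm_fst_le ζ
      · exact norm_fst_le_norm6 (grad6 h z))
  have h2 : |inner ℝ ζ.2 (gradP h z)| ≤ ‖ζ‖ * norm6 (grad6 h z) :=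
    (abs_real_inner_le_norm _ _).trans (by
      gcongr
      · exact norm_snd_le ζ
      · exact norm_snd_le_norm6 (grad6 h z))
  have h3 := abs_add_le (inner ℝ ζ.1 (gradX h z)) (inner ℝ ζ.2 (gradP h z))
  linarith

theorem continuous_norm6_grad6 (hh : ContDiff ℝ 1 h) : Continuous (fun z => norm6 (grad6 h z)) := by
  have hd := hh.continuous_fderiv one_ne_zero
  have hD : ∀ z, DifferentiableAt ℝ h z := fun z => (hh.differentiable one_ne_zero) z
  have e : (fun z => norm6 (grad6 h z)) = fun z =>
      Real.sqrt (‖(fderiv ℝ h z).comp (ContinuousLinearMap.inl ℝ E3 E3)‖ ^ 2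
        + ‖(fderiv ℝ h z).comp (ContinuousLinearMap.inr ℝ E3 E3)‖ ^ 2) := by
    ext z
    simp only [norm6, grad6, gradX_eq (hD z), gradP_eq (hD z), LinearIsometryEquiv.norm_map]
  rw [e]
  have h1 : Continuous fun z => (fderiv ℝ h z).comp (ContinuousLinearMap.inl ℝ E3 E3) :=
    hd.clm_comp continuous_const
  have h2 : Continuous fun z => (fderiv ℝ h z).comp (ContinuousLinearMap.inr ℝ E3 E3) :=
    hd.clm_comp continuous_const
  exact ((h1.norm.pow 2).add (h2.norm.pow 2)).sqrt

end Gradient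

/-- An essential bound on a continuous function holds everywhere, because a set of full measure is
dense. -/
theorem norm_le_of_eLpNorm_top_le {h : Phase → ℝ} (hh : Continuous h) {r : ℝ≥0∞}
    (hr : eLpNorm h ∞ volume ≤ r) (z : Phase) : ENNReal.ofReal ‖h z‖ ≤ r := by
  have h1 : ∀ᵐ y : Phase, ENNReal.ofReal ‖h y‖ ≤ r := by
    filter_upwards [ae_le_eLpNormEssSup (f := h) (μ := volume)] with y hy
    rw [ofReal_norm]
    exact hy.trans (by simpa using hr)
  have hc : IsClosed {y | ENNReal.ofReal ‖h y‖ ≤ r} :=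
    isClosed_le (ENNReal.continuous_ofReal.comp hh.norm) continuous_const
  have := (Measure.dense_of_ae h1).closure_eq
  rw [hc.closure_eq] at this
  have hz : z ∈ {y | ENNReal.ofReal ‖h y‖ ≤ r} := by rw [this]; exact mem_univ z
  exact hz

/-- The weight `⟨x⟩^{-m} ⟨p⟩^{-n}`. -/
def wt (m : ℝ) (n : ℕ) (z : Phase) : ℝ := jb z.1 ^ (-m) * (jb z.2 ^ n)⁻¹

theorem wt_pos (m : ℝ) (n : ℕ) (z : Phase) : 0 < wt m n z := by
  have := jb_pos z.1
  have := jb_pos z.2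
  unfold wt; positivity

theorem rpow_neg_jb_le {m : ℝ} (hm : 0 ≤ m) {x y : E3} {r : ℝ} (h : ‖x - y‖ ≤ r) :
    jb y ^ (-m) ≤ (1 + r) ^ m * jb x ^ (-m) := by
  have h0 : 0 ≤ r := (norm_nonneg _).trans h
  have hx := jb_pos x
  have hy := jb_pos y
  have h1 : jb x ^ m ≤ (1 + r) ^ m * jb y ^ m := by
    rw [← Real.mul_rpow (by positivity) hy.le]
    exact Real.rpow_le_rpow hx.le (jb_le_mul_jb h) hm
  rw [Real.rpow_neg hy.le, Real.rpow_neg hx.le, ← div_eq_mul_inv, inv_eq_one_div,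
    div_le_div_iff₀ (by positivity) (by positivity)]
  linarith

theorem wt_le {m : ℝ} (hm : 0 ≤ m) (n : ℕ) {z z' : Phase} (h : ‖z - z'‖ ≤ 2) :
    wt m n z' ≤ 3 ^ m * 3 ^ n * wt m n z := by
  have h1 := rpow_neg_jb_le hm ((norm_fst_le (z - z')).trans h)
  have h2 := jb_le_mul_jb ((norm_snd_le (z - z')).trans h)
  have hx := jb_pos z.1
  have hp := jb_pos z.2
  have hp' := jb_pos z'.2
  norm_num at h1 h2
  have h3 : (jb z'.2 ^ n)⁻¹ ≤ 3 ^ n * (jb z.2 ^ n)⁻¹ := by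
    rw [← div_eq_mul_inv, inv_eq_one_div, div_le_div_iff₀ (by positivity) (by positivity), one_mul,
      ← mul_pow]
    gcongr
  unfold wt
  calc jb z'.1 ^ (-m) * (jb z'.2 ^ n)⁻¹ ≤ (3 ^ m * jb z.1 ^ (-m)) * (3 ^ n * (jb z.2 ^ n)⁻¹) := by
        gcongr
    _ = _ := by ring

theorem le_wt_of_mul_le {m : ℝ} {n : ℕ} {z : Phase} {u r : ℝ}
    (h : jb z.1 ^ m * jb z.2 ^ n * u ≤ r) : u ≤ r * wt m n z := by
  have hx := jb_pos z.1
  have hp := jb_pos z.2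
  have hx' := Real.rpow_pos_of_pos hx m
  rw [wt, Real.rpow_neg hx.le, ← mul_inv, ← div_eq_mul_inv, le_div_iff₀ (by positivity)]
  linarith

section Data
variable {m η₀ : ℝ} {f0 : Phase → ℝ}

theorem pos_of_dataSize_lt (h : dataSize m f0 < ENNReal.ofReal η₀) : 0 < η₀ :=
  ENNReal.ofReal_pos.1 (bot_le.trans_lt h)

theorem continuous_weight (m : ℝ) (n : ℕ) : Continuous fun z : Phase => jb z.1 ^ m * jb z.2 ^ n :=
  ((continuous_jb_rpow m).comp continuous_fst).mul ((continuous_jb.comp continuous_snd).pow n)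

theorem initial_le (hf : ContDiff ℝ 1 f0) (h : dataSize m f0 < ENNReal.ofReal η₀) (z : Phase) :
    |f0 z| ≤ η₀ * wt m 8 z := by
  have hη := pos_of_dataSize_lt h
  apply le_wt_of_mul_le
  have h1 := norm_le_of_eLpNorm_top_le ((continuous_weight m 8).mul hf.continuous)
    ((le_self_add).trans h.le) z
  have := (ENNReal.ofReal_le_ofReal_iff hη.le).1 h1
  have hx := jb_pos z.1
  have hp := jb_pos z.2
  rwa [Pi.mul_apply, norm_mul, Real.norm_eq_abs, abs_of_pos (by positivity), Real.norm_eq_abs] at this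

theorem norm6_grad6_initial_le (hf : ContDiff ℝ 1 f0) (h : dataSize m f0 < ENNReal.ofReal η₀)
    (z : Phase) : norm6 (grad6 f0 z) ≤ η₀ * wt m 9 z := by
  have hη := pos_of_dataSize_lt h
  apply le_wt_of_mul_le
  have h1 := norm_le_of_eLpNorm_top_le ((continuous_weight m 9).mul (continuous_norm6_grad6 hf))
    ((le_add_self).trans h.le) z
  have := (ENNReal.ofReal_le_ofReal_iff hη.le).1 h1
  exact (le_abs_self _).trans this

/-- The mean value inequality on the convex unit ball around z, on which the weight varies by at
most 3^m 3⁹. The factor 2 passes from the Euclidean to the maximum norm. -/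
theorem initial_lip (hm : 0 ≤ m) (hf : ContDiff ℝ 1 f0) (h : dataSize m f0 < ENNReal.ofReal η₀)
    {z z1 z2 : Phase} (h1 : ‖z1 - z‖ ≤ 1) (h2 : ‖z2 - z‖ ≤ 1) :
    |f0 z1 - f0 z2| ≤ 2 * (3 ^ m * 3 ^ 9) * η₀ * wt m 9 z * ‖z1 - z2‖ := by
  have hη := pos_of_dataSize_lt h
  have hd := hf.differentiable one_ne_zero
  refine (convex_closedBall z 1).norm_image_sub_le_of_norm_fderiv_le (𝕜 := ℝ)
    (fun y _ => hd y) (fun y hy => ?_) (mem_closedBall_iff_norm.2 h2) (mem_closedBall_iff_norm.2 h1)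
  have hw := wt_pos m 9 z
  refine ContinuousLinearMap.opNorm_le_bound _ (by positivity) fun ζ => ?_
  refine (abs_fderiv_apply_le (hd y) ζ).trans ?_
  have hy' : ‖z - y‖ ≤ 2 := by
    rw [norm_sub_rev]; exact (mem_closedBall_iff_norm.1 hy).trans (by norm_num)
  have h3 : norm6 (grad6 f0 y) ≤ η₀ * (3 ^ m * 3 ^ 9 * wt m 9 z) :=
    (norm6_grad6_initial_le hf h y).trans (by gcongr; exact wt_le hm 9 hy')
  refine mul_le_mul_of_nonneg_right ?_ (norm_nonneg _)
  linarith

end Data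

theorem contDiff_vel (c : ℝ≥0∞) : ContDiff ℝ 1 (vel c) := by
  have hg : ContDiff ℝ 1 (gam c) :=
    ContDiff.sqrt (contDiff_const.add (contDiff_const.mul (contDiff_norm_sq ℝ)))
      fun p => by positivity
  have hi : ContDiff ℝ 1 (fun p => (gam c p)⁻¹) := hg.inv fun p => (gam_pos c p).ne'
  have hid : ContDiff ℝ 1 (id : E3 → E3) := contDiff_id
  exact hi.smul hid

theorem contDiff_freeFlow (c : ℝ≥0∞) (t : ℝ) : ContDiff ℝ 1 (freeFlow c t) := by
  unfold freeFlow
  have hv : ContDiff ℝ 1 (fun z : Phase => vel c z.2) := (contDiff_vel c).comp contDiff_snd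
  exact (contDiff_fst.add (hv.const_smul t)).prodMk contDiff_snd

/-! ### Transport along characteristics and bounds on the shifted profile. -/

section Transport
variable {β : ℝ} {K : E3 → E3} {c : ℝ≥0∞} {f0 : Phase → ℝ} {f : ℝ → Phase → ℝ}
  {Φ : ℝ → Phase → Phase}

theorem IsGlobalSolution.contDiff (hf : IsGlobalSolution β K c f0 f) {t : ℝ} (ht : 0 ≤ t) :
    ContDiff ℝ 1 (f t) := by
  have h : ContDiff ℝ 1 (fun z : Phase => (t, z)) := contDiff_const.prodMk contDiff_id
  exact hf.contDiffOn.comp_contDiff h fun z => ⟨ht, mem_univ _⟩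

/-- The chain rule turns the left-hand side of the Vlasov equation into the derivative along a
characteristic. Derivatives are taken within t ≥ 0, since nothing is known at negative times. -/
theorem IsGlobalSolution.hasDerivWithinAt_comp (hf : IsGlobalSolution β K c f0 f)
    (hΦ : IsCharFlow c (field β K f) Φ) (z : Phase) {t : ℝ} (ht : 0 ≤ t) :
    HasDerivWithinAt (fun s => f s (Φ s z)) 0 (Ici 0) t := by
  set F : ℝ × Phase → ℝ := fun q => f q.1 q.2
  set A : Set (ℝ × Phase) := Ici 0 ×ˢ univ
  set q : ℝ × Phase := (t, Φ t z)
  have hq : q ∈ A := ⟨ht, mem_univ _⟩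
  have hF : HasFDerivWithinAt F (fderivWithin ℝ F A q) A q :=
    (hf.contDiffOn.differentiableOn one_ne_zero q hq).hasFDerivWithinAt
  set L := fderivWithin ℝ F A q
  have h1 : HasDerivWithinAt (fun s => f s (Φ t z)) (L (1, 0)) (Ici 0) t :=
    HasFDerivWithinAt.comp_hasDerivWithinAt (f := fun s : ℝ => ((s, Φ t z) : ℝ × Phase)) t hF
      ((hasDerivWithinAt_id t (Ici 0)).prodMk (hasDerivWithinAt_const t (Ici 0) (Φ t z)))
      fun s hs => ⟨hs, mem_univ _⟩
  have h2 : HasFDerivAt (f t) (L.comp (ContinuousLinearMap.inr ℝ ℝ Phase)) (Φ t z) := by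
    have := HasFDerivWithinAt.comp (f := fun y : Phase => ((t, y) : ℝ × Phase)) (s := univ)
      (Φ t z) hF (hasFDerivAt_prodMk_right t (Φ t z)).hasFDerivWithinAt
      fun y _ => ⟨ht, mem_univ _⟩
    exact hasFDerivWithinAt_univ.1 this
  have h3 := HasFDerivWithinAt.comp_hasDerivWithinAt
      (f := fun s : ℝ => ((s, Φ s z) : ℝ × Phase)) t hF
      ((hasDerivWithinAt_id t (Ici 0)).prodMk ((hΦ z).2 t ht)) fun s hs => ⟨hs, mem_univ _⟩
  refine h3.congr_deriv ?_
  have hv := hf.vlasov t ht (Φ t z)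
  rw [h1.derivWithin (uniqueDiffOn_Ici 0 t ht), inner_gradX h2.differentiableAt,
    inner_gradP h2.differentiableAt, h2.fderiv] at hv
  rw [← hv]
  simp only [ContinuousLinearMap.comp_apply, ContinuousLinearMap.inr_apply]
  rw [← map_add, ← map_add]
  simp

theorem IsGlobalSolution.comp_charFlow (hf : IsGlobalSolution β K c f0 f)
    (hΦ : IsCharFlow c (field β K f) Φ) (z : Phase) {t : ℝ} (ht : 0 ≤ t) :
    f t (Φ t z) = f0 z := by
  have h := constant_of_has_deriv_right_zero (f := fun s => f s (Φ s z)) (a := 0) (b := t)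
    (fun s hs => (hf.hasDerivWithinAt_comp hΦ z hs.1).continuousWithinAt.mono Icc_subset_Ici_self)
    (fun s hs => (hf.hasDerivWithinAt_comp hΦ z hs.1).mono (Ici_subset_Ici.2 hs.1))
    t (right_mem_Icc.2 ht)
  rw [h, (hΦ z).1, hf.initial]

theorem IsGlobalSolution.contDiff_profile (hf : IsGlobalSolution β K c f0 f) {t : ℝ} (ht : 0 ≤ t) :
    ContDiff ℝ 1 (profile c f t) := (hf.contDiff ht).comp (contDiff_freeFlow c t)

theorem profile_freeFlowInv (c : ℝ≥0∞) (f : ℝ → Phase → ℝ) (t : ℝ) (z : Phase) :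
    profile c f t (freeFlowInv c t z) = f t z := by
  rw [profile, freeFlow_freeFlowInv]

/-- Pointwise bounds for a nonnegative profile and its gradient. -/
structure IsProfileBound (m B : ℝ) (g : Phase → ℝ) : Prop where
  contDiff : ContDiff ℝ 1 g
  bound : ∀ z, |g z| ≤ B * wt m 8 z
  fderiv_bound : ∀ z, ‖fderiv ℝ g z‖ ≤ B * wt m 9 z

/-- The constant of the profile bounds. -/
def profileConst (m : ℝ) : ℝ := 4 * (3 ^ m * 3 ^ 9)

theorem profileConst_pos (m : ℝ) : 0 < profileConst m := by unfold profileConst; positivity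

variable {T κ m η₀ : ℝ} {a : ℝ → ℝ}

theorem IsGlobalSolution.profile_eq (hf : IsGlobalSolution β K c f0 f)
    (hΦ : IsCharFlow c (field β K f) Φ) (h : IsEnvelope (field β K f) T κ a) (hκ : κ ≤ 1 / 32)
    (hc : 1 ≤ c) {t : ℝ} (ht : t ∈ Icc 0 T) (z : Phase) :
    profile c f t z = f0 (waveInv c Φ t z) := by
  have h1 := h.waveOp_waveInv hκ hc hΦ ht z
  conv_lhs => rw [← h1]
  rw [profile, freeFlow_waveOp, hf.comp_charFlow hΦ _ ht.1]

/-- The profile is f⁰ ∘ 𝒲⁻¹, with 𝒲⁻¹ within 1/32 of the identity and 2-Lipschitz. The constant is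
the 2 · 3^m 3⁹ of the data times this 2. It does not involve κ, which is what lets the bootstrap
close. -/
theorem IsGlobalSolution.profileBound (hf : IsGlobalSolution β K c f0 f)
    (hΦ : IsCharFlow c (field β K f) Φ) (h : IsEnvelope (field β K f) T κ a) (hκ : κ ≤ 1 / 32)
    (hc : 1 ≤ c) (hm : 0 ≤ m) (hf0 : ContDiff ℝ 1 f0)
    (hη : dataSize m f0 < ENNReal.ofReal η₀) {t : ℝ} (ht : t ∈ Icc 0 T) :
    IsProfileBound m (profileConst m * η₀) (profile c f t) := by
  have hη0 := pos_of_dataSize_lt hη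
  have hS : ∀ z, ‖waveInv c Φ t z - z‖ ≤ 1 / 32 := fun z =>
    (h.norm_waveInv_sub_le hκ hc hΦ ht z).trans hκ
  refine ⟨hf.contDiff_profile ht.1, fun z => ?_, fun z => ?_⟩
  · rw [hf.profile_eq hΦ h hκ hc ht]
    have h1 : ‖z - waveInv c Φ t z‖ ≤ 2 := by
      rw [norm_sub_rev]; exact (hS z).trans (by norm_num)
    have hw := wt_pos m 8 z
    calc _ ≤ η₀ * wt m 8 (waveInv c Φ t z) := initial_le hf0 hη _
      _ ≤ η₀ * (3 ^ m * 3 ^ 8 * wt m 8 z) := by gcongr; exact wt_le hm 8 h1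
      _ = (3 ^ m * 3 ^ 8) * η₀ * wt m 8 z := by ring
      _ ≤ _ := by
        gcongr
        rw [profileConst]
        have : (0 : ℝ) < 3 ^ m := by positivity
        linarith
  · have hd : DifferentiableAt ℝ (profile c f t) z :=
      (hf.contDiff_profile ht.1).differentiable one_ne_zero z
    have hw := wt_pos m 9 z
    have hC := profileConst_pos m
    -- The profile is differentiable because f is C¹, so a local Lipschitz bound suffices and 𝒲⁻¹
    -- need not be differentiated.
    refine hd.hasFDerivAt.le_of_lip' (by positivity) ?_
    filter_upwards [Metric.ball_mem_nhds z (by norm_num : (0 : ℝ) < 1 / 4)] with y hy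
    rw [mem_ball_iff_norm] at hy
    rw [hf.profile_eq hΦ h hκ hc ht, hf.profile_eq hΦ h hκ hc ht]
    have h1 : ‖waveInv c Φ t y - z‖ ≤ 1 :=
      (norm_sub_le_norm_sub_add_norm_sub _ y _).trans (by linarith [hS y])
    have h2 : ‖waveInv c Φ t z - z‖ ≤ 1 := (hS z).trans (by norm_num)
    refine (initial_lip hm hf0 hη h1 h2).trans ?_
    have h3 := h.norm_waveInv_sub_waveInv_le hκ hc hΦ ht y z
    calc _ ≤ 2 * (3 ^ m * 3 ^ 9) * η₀ * wt m 9 z * (2 * ‖y - z‖) := by gcongr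
      _ = _ := by rw [profileConst]; ring

end Transport

/-! ### Spatial densities, and trading x-derivatives for p-derivatives. -/

/-- The integral of an integrable divergence vanishes. -/
theorem integral_divergence_eq_zero {G : E3 → E3} {G' : E3 → E3 →L[ℝ] E3} {b : E3 → ℝ}
    (hG : ∀ p, HasFDerivAt G (G' p) p) (hi : Integrable G) (hb : Integrable b)
    (hle : ∀ p, ‖G' p‖ ≤ b p) :
    ∫ p, ∑ i : Fin 3, (G' p (EuclideanSpace.single i 1)) i = 0 := by
  have hGi : ∀ (i : Fin 3) p, HasFDerivAt (fun q => G q i)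
      ((EuclideanSpace.proj i : E3 →L[ℝ] ℝ).comp (G' p)) p := fun i p =>
    (EuclideanSpace.proj i : E3 →L[ℝ] ℝ).hasFDerivAt.comp p (hG p)
  have hf : ∀ (i : Fin 3) p, (G' p (EuclideanSpace.single i 1)) i
      = fderiv ℝ (fun q => G q i) p (EuclideanSpace.single i 1) := fun i p => by
    rw [(hGi i p).fderiv]; rfl
  have hint : ∀ i : Fin 3, Integrable (fun p => (G' p (EuclideanSpace.single i 1)) i) := by
    intro i
    refine hb.mono' ?_ (Filter.Eventually.of_forall fun p => ?_)
    · simp_rw [hf]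
      exact (measurable_fderiv_apply_const ℝ _ _).aestronglyMeasurable
    · calc ‖(G' p (EuclideanSpace.single i 1)) i‖ ≤ ‖G' p (EuclideanSpace.single i 1)‖ :=
            PiLp.norm_apply_le _ _
        _ ≤ ‖G' p‖ * ‖(EuclideanSpace.single i 1 : E3)‖ := (G' p).le_opNorm _
        _ ≤ b p := by simpa using hle p
  have hGint : ∀ i : Fin 3, Integrable (fun p => G p i) := fun i =>
    (EuclideanSpace.proj i : E3 →L[ℝ] ℝ).integrable_comp hi
  rw [integral_finsetSum _ fun i _ => hint i]
  refine Finset.sum_eq_zero fun i _ => ?_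
  -- Each partial derivative is integrated by parts against the constant 1.
  have h := integral_mul_fderiv_eq_neg_fderiv_mul_of_integrable (μ := (volume : Measure E3))
    (f := fun _ : E3 => (1 : ℝ)) (g := fun q => G q i) (v := EuclideanSpace.single i 1)
    (by simp) (by simpa only [one_mul, ← hf] using hint i)
    (by simpa only [one_mul] using hGint i)
    (fun _ _ => differentiableAt_const _) (fun p _ => (hGi i p).differentiableAt)
  simpa [← hf] using h

theorem norm_dualDirD_le {c : ℝ≥0∞} (hc : 1 ≤ c) (h p : E3) :
    ‖dualDirD c h p‖ ≤ 3 * jb p ^ 2 * ‖h‖ := by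
  have k0 := invSpeed_nonneg c
  have k1 := invSpeed_le_one hc
  have hg := gam_pos c p
  have hgj := gam_le_jb hc p
  have hj := jb_pos p
  have hpj := norm_le_jb p
  have hk2 : invSpeed c ^ 2 ≤ 1 := pow_le_one₀ k0 k1
  refine ContinuousLinearMap.opNorm_le_bound _ (by positivity) fun v => ?_
  have e : dualDirD c h p v = gam c p • ((invSpeed c ^ 2 * inner ℝ p h) • v
      + (invSpeed c ^ 2 * inner ℝ h v) • p)
      + (invSpeed c ^ 2 * (gam c p)⁻¹ * inner ℝ p v) • (h + (invSpeed c ^ 2 * inner ℝ p h) • p) := by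
    simp [dualDirD]
  have a1 : ‖(invSpeed c ^ 2 * inner ℝ p h) • v‖ ≤ jb p * ‖h‖ * ‖v‖ := by
    rw [norm_smul, Real.norm_eq_abs, abs_mul, abs_of_nonneg (sq_nonneg _)]
    calc _ ≤ 1 * (‖p‖ * ‖h‖) * ‖v‖ := by gcongr; exact abs_real_inner_le_norm _ _
      _ ≤ 1 * (jb p * ‖h‖) * ‖v‖ := by gcongr
      _ = _ := by ring
  have a2 : ‖(invSpeed c ^ 2 * inner ℝ h v) • p‖ ≤ jb p * ‖h‖ * ‖v‖ := by
    rw [norm_smul, Real.norm_eq_abs, abs_mul, abs_of_nonneg (sq_nonneg _)]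
    calc _ ≤ 1 * (‖h‖ * ‖v‖) * jb p := by gcongr; exact abs_real_inner_le_norm _ _
      _ = _ := by ring
  have a3 : ‖h + (invSpeed c ^ 2 * inner ℝ p h) • p‖ ≤ jb p ^ 2 * ‖h‖ := by
    calc _ ≤ ‖h‖ + ‖(invSpeed c ^ 2 * inner ℝ p h) • p‖ := norm_add_le _ _
      _ ≤ ‖h‖ + 1 * (‖p‖ * ‖h‖) * ‖p‖ := by
        rw [norm_smul, Real.norm_eq_abs, abs_mul, abs_of_nonneg (sq_nonneg _)]
        gcongr
        exact abs_real_inner_le_norm _ _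
      _ = _ := by rw [sq_jb]; ring
  have a4 : |invSpeed c ^ 2 * (gam c p)⁻¹ * inner ℝ p v| ≤ ‖v‖ := by
    rw [abs_mul, abs_of_nonneg (by positivity)]
    calc _ ≤ invSpeed c ^ 2 * (gam c p)⁻¹ * (‖p‖ * ‖v‖) := by
          gcongr; exact abs_real_inner_le_norm _ _
      _ = invSpeed c * ((gam c p)⁻¹ * (invSpeed c * ‖p‖)) * ‖v‖ := by ring
      _ ≤ 1 * ((gam c p)⁻¹ * gam c p) * ‖v‖ := by
        gcongr; exact invSpeed_mul_norm_le_gam c p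
      _ = ‖v‖ := by rw [inv_mul_cancel₀ hg.ne']; ring
  rw [e]
  calc _ ≤ gam c p * (jb p * ‖h‖ * ‖v‖ + jb p * ‖h‖ * ‖v‖) + ‖v‖ * (jb p ^ 2 * ‖h‖) := by
        refine (norm_add_le _ _).trans (add_le_add ?_ ?_)
        · rw [norm_smul, Real.norm_of_nonneg hg.le]
          gcongr
          exact (norm_add_le _ _).trans (add_le_add a1 a2)
        · rw [norm_smul, Real.norm_eq_abs]
          gcongr
    _ ≤ jb p * (jb p * ‖h‖ * ‖v‖ + jb p * ‖h‖ * ‖v‖) + ‖v‖ * (jb p ^ 2 * ‖h‖) := by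
        gcongr
    _ = _ := by ring

/-- The density at time `t` of the particle distribution with profile `g`. -/
def rho (c : ℝ≥0∞) (t : ℝ) (g : Phase → ℝ) (x : E3) : ℝ := ∫ p, g (freeFlowInv c t (x, p))

theorem continuous_freeFlowInv (c : ℝ≥0∞) (t : ℝ) : Continuous (freeFlowInv c t) := by
  unfold freeFlowInv; fun_prop

/-- The surplus over the sixth power: n = 2 for the profile and n = 3 for its gradient. These powers
pay for the growth of the dual direction and for the c⁻² errors. -/
theorem wt_freeFlowInv_le (m : ℝ) (c : ℝ≥0∞) (t : ℝ) (x p : E3) (n : ℕ) :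
    wt m (6 + n) (freeFlowInv c t (x, p)) * jb p ^ n = modelWeight m c t x p := by
  have := jb_pos p
  simp only [wt, freeFlowInv, modelWeight, pow_add]
  field_simp

section Density
variable {m B : ℝ} {g : Phase → ℝ} {c : ℝ≥0∞} {t : ℝ}

theorem IsProfileBound.nonneg (hg : IsProfileBound m B g) : 0 ≤ B := by
  have h := (abs_nonneg _).trans (hg.bound 0)
  exact nonneg_of_mul_nonneg_left h (wt_pos _ _ _)

theorem IsProfileBound.mul_sq_le (hg : IsProfileBound m B g) (c : ℝ≥0∞) (t : ℝ) (x p : E3) :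
    |g (freeFlowInv c t (x, p))| * jb p ^ 2 ≤ B * modelWeight m c t x p := by
  rw [← wt_freeFlowInv_le m c t x p 2, ← mul_assoc]
  have := jb_pos p
  gcongr
  exact hg.bound _

theorem IsProfileBound.le (hg : IsProfileBound m B g) (c : ℝ≥0∞) (t : ℝ) (x p : E3) :
    |g (freeFlowInv c t (x, p))| ≤ B * modelWeight m c t x p := by
  refine le_trans ?_ (hg.mul_sq_le c t x p)
  exact le_mul_of_one_le_right (abs_nonneg _) (one_le_pow₀ (one_le_jb p))

theorem IsProfileBound.fderiv_mul_cube_le (hg : IsProfileBound m B g) (c : ℝ≥0∞) (t : ℝ) (x p : E3) :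
    ‖fderiv ℝ g (freeFlowInv c t (x, p))‖ * jb p ^ 3 ≤ B * modelWeight m c t x p := by
  rw [← wt_freeFlowInv_le m c t x p 3, ← mul_assoc]
  have := jb_pos p
  gcongr
  exact hg.fderiv_bound _

theorem IsProfileBound.fderiv_le (hg : IsProfileBound m B g) (c : ℝ≥0∞) (t : ℝ) (x p : E3) :
    ‖fderiv ℝ g (freeFlowInv c t (x, p))‖ ≤ B * modelWeight m c t x p := by
  refine le_trans ?_ (hg.fderiv_mul_cube_le c t x p)
  exact le_mul_of_one_le_right (norm_nonneg _) (one_le_pow₀ (one_le_jb p))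

theorem IsProfileBound.continuous_comp (hg : IsProfileBound m B g) (c : ℝ≥0∞) (t : ℝ) :
    Continuous (fun z : Phase => g (freeFlowInv c t z)) :=
  hg.contDiff.continuous.comp (continuous_freeFlowInv c t)

theorem IsProfileBound.continuous_fderiv_comp (hg : IsProfileBound m B g) (c : ℝ≥0∞) (t : ℝ) :
    Continuous (fun z : Phase => fderiv ℝ g (freeFlowInv c t z)) :=
  (hg.contDiff.continuous_fderiv one_ne_zero).comp (continuous_freeFlowInv c t)

theorem IsProfileBound.integrable (hg : IsProfileBound m B g) (hm : 0 ≤ m) (c : ℝ≥0∞) (t : ℝ)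
    (x : E3) : Integrable (fun p => g (freeFlowInv c t (x, p))) := by
  refine ((integrable_modelWeight hm c t x).const_mul B).mono'
    ((hg.continuous_comp c t).comp (Continuous.prodMk_right x)).aestronglyMeasurable
    (Filter.Eventually.of_forall fun p => ?_)
  exact hg.le c t x p

theorem IsProfileBound.abs_rho_le (hg : IsProfileBound m B g) (hm : 0 ≤ m) (c : ℝ≥0∞) (t : ℝ)
    (x : E3) : |rho c t g x| ≤ B * modelDensity m c t x := by
  rw [rho, modelDensity, ← integral_const_mul, ← Real.norm_eq_abs]
  refine norm_integral_le_of_norm_le ((integrable_modelWeight hm c t x).const_mul B)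
    (Filter.Eventually.of_forall fun p => ?_)
  exact hg.le c t x p

theorem IsProfileBound.aestronglyMeasurable_rho (hg : IsProfileBound m B g) (c : ℝ≥0∞) (t : ℝ) :
    AEStronglyMeasurable (rho c t g) volume :=
  AEStronglyMeasurable.integral_prod_right' (ν := (volume : Measure E3))
    (f := fun z : Phase => g (freeFlowInv c t z)) (hg.continuous_comp c t).aestronglyMeasurable

/-- The derivative of the density in the direction `h`. -/
def rhoD (c : ℝ≥0∞) (t : ℝ) (g : Phase → ℝ) (h x : E3) : ℝ :=
  ∫ p, fderiv ℝ g (freeFlowInv c t (x, p)) (h, 0)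

theorem norm_inl_le (h : E3) : ‖((h, 0) : Phase)‖ ≤ ‖h‖ := by simp [Prod.norm_def]

theorem norm_inr_le (h : E3) : ‖((0, h) : Phase)‖ ≤ ‖h‖ := by simp [Prod.norm_def]

theorem IsProfileBound.abs_fderiv_inl_le (hg : IsProfileBound m B g) (c : ℝ≥0∞) (t : ℝ)
    (h x p : E3) : |fderiv ℝ g (freeFlowInv c t (x, p)) (h, 0)|
      ≤ B * ‖h‖ * modelWeight m c t x p := by
  have hw := modelWeight_nonneg m c t x p
  have hB := hg.nonneg
  refine ((fderiv ℝ g (freeFlowInv c t (x, p))).le_opNorm (h, 0)).trans ?_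
  calc _ ≤ B * modelWeight m c t x p * ‖h‖ := by
        gcongr
        · exact hg.fderiv_le c t x p
        · exact norm_inl_le h
    _ = _ := by ring

theorem IsProfileBound.abs_rhoD_le (hg : IsProfileBound m B g) (hm : 0 ≤ m) (c : ℝ≥0∞) (t : ℝ)
    (h x : E3) : |rhoD c t g h x| ≤ B * ‖h‖ * modelDensity m c t x := by
  rw [rhoD, modelDensity, ← integral_const_mul, ← Real.norm_eq_abs]
  refine norm_integral_le_of_norm_le ((integrable_modelWeight hm c t x).const_mul _)
    (Filter.Eventually.of_forall fun p => ?_)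
  exact hg.abs_fderiv_inl_le c t h x p

theorem IsProfileBound.hasDerivAt_rho (hg : IsProfileBound m B g) (hm : 0 ≤ m) (c : ℝ≥0∞) (t : ℝ)
    (h x : E3) (θ : ℝ) :
    HasDerivAt (fun θ : ℝ => rho c t g (x + θ • h)) (rhoD c t g h (x + θ • h)) θ := by
  have hB := hg.nonneg
  refine (hasDerivAt_integral_of_dominated_loc_of_deriv_le (s := univ) (μ := (volume : Measure E3))
    (F := fun θ p => g (freeFlowInv c t (x + θ • h, p)))
    (F' := fun θ p => fderiv ℝ g (freeFlowInv c t (x + θ • h, p)) (h, 0))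
    (bound := fun p => B * (jb p ^ 6)⁻¹ * ‖h‖) Filter.univ_mem ?_ ?_ ?_ ?_ ?_ ?_).2
  · exact Filter.Eventually.of_forall fun θ =>
      (hg.integrable hm c t (x + θ • h)).aestronglyMeasurable
  · exact hg.integrable hm c t (x + θ • h)
  · exact (((hg.continuous_fderiv_comp c t).comp (Continuous.prodMk_right (x + θ • h))).clm_apply
      continuous_const).aestronglyMeasurable
  · refine Filter.Eventually.of_forall fun p θ _ => ?_
    refine (hg.abs_fderiv_inl_le c t h _ p).trans ?_
    rw [mul_right_comm]
    gcongr
    exact modelWeight_le hm _ _ _ _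
  · exact ((integrable_jb_pow_inv (by norm_num)).const_mul B).mul_const ‖h‖
  · refine Filter.Eventually.of_forall fun p θ _ => ?_
    have h1 : HasDerivAt (fun θ : ℝ => freeFlowInv c t (x + θ • h, p)) ((h, 0) : Phase) θ := by
      have : HasDerivAt (fun θ : ℝ => x + θ • h - t • vel c p) h θ := by
        simpa using (((hasDerivAt_id θ).smul_const h).const_add x).sub_const (t • vel c p)
      exact this.prodMk (hasDerivAt_const θ p)
    exact ((hg.contDiff.differentiable one_ne_zero) _).hasFDerivAt.comp_hasDerivAt θ h1

/-- Integration by parts in the momentum: `t ∂_h ρ` has no factor `t`. -/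
theorem IsProfileBound.mul_rhoD_eq (hg : IsProfileBound m B g) (hm : 0 ≤ m) (hc : 1 ≤ c)
    (ht : 0 ≤ t) (h x : E3) : t * rhoD c t g h x =
      ∫ p, (fderiv ℝ g (freeFlowInv c t (x, p)) (0, dualDir c h p)
        + g (freeFlowInv c t (x, p)) * (5 * invSpeed c ^ 2 * gam c p * inner ℝ p h)) := by
  have hB := hg.nonneg
  set q : E3 → Phase := fun p => freeFlowInv c t (x, p)
  set q' : E3 → E3 →L[ℝ] Phase := fun p => (-(t • velD c p)).prod (ContinuousLinearMap.id ℝ E3)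
  have hq : ∀ p, HasFDerivAt q (q' p) p := fun p => by
    have h1 : HasFDerivAt (fun p => x - t • vel c p) (-(t • velD c p)) p := by
      simpa using ((hasFDerivAt_vel c p).const_smul t).const_sub x
    exact h1.prodMk (hasFDerivAt_id p)
  have hq' : ∀ p, ‖q' p‖ ≤ 1 + t := fun p => by
    refine ContinuousLinearMap.opNorm_le_bound _ (by positivity) fun v => ?_
    change ‖((-(t • velD c p v), v) : Phase)‖ ≤ _
    rw [Prod.norm_def]
    apply max_le
    · simp only [norm_neg, norm_smul, Real.norm_of_nonneg ht]
      have := norm_velD_apply_le c p v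
      nlinarith [norm_nonneg v]
    · have := norm_nonneg v
      dsimp only; nlinarith
  have hgd := hg.contDiff.differentiable one_ne_zero
  set ψ' : E3 → E3 →L[ℝ] ℝ := fun p => (fderiv ℝ g (q p)).comp (q' p)
  have hψ : ∀ p, HasFDerivAt (fun p => g (q p)) (ψ' p) p := fun p =>
    HasFDerivAt.comp (f := q) p (hgd (q p)).hasFDerivAt (hq p)
  -- The divergence theorem is applied in p to g(x - t v_c(p), p) a(p), where a solves Dv_c(p) a =
  -- h.
  set G' : E3 → E3 →L[ℝ] E3 := fun p =>
    g (q p) • dualDirD c h p + (ψ' p).smulRight (dualDir c h p)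
  have hG : ∀ p, HasFDerivAt (fun p => g (q p) • dualDir c h p) (G' p) p := fun p =>
    (hψ p).smul (hasFDerivAt_dualDir c h p)
  have hcg : Continuous fun p => g (q p) :=
    (hg.continuous_comp c t).comp (Continuous.prodMk_right x)
  have hcd : Continuous (dualDir c h) := by unfold dualDir; fun_prop
  have hcf : Continuous fun p => fderiv ℝ g (q p) :=
    (hg.continuous_fderiv_comp c t).comp (Continuous.prodMk_right x)
  have hGi : Integrable (fun p => g (q p) • dualDir c h p) := by
    refine ((integrable_jb_pow_inv (n := 5) (by norm_num)).const_mul (B * ‖h‖)).mono'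
      (hcg.smul hcd).aestronglyMeasurable (Filter.Eventually.of_forall fun p => ?_)
    have hj := jb_pos p
    rw [norm_smul, Real.norm_eq_abs]
    have h8 : |g (q p)| ≤ B * (1 * (jb p ^ 8)⁻¹) := by
      refine (hg.bound _).trans (mul_le_mul_of_nonneg_left (?_ :
        jb (x - t • vel c p) ^ (-m) * (jb p ^ 8)⁻¹ ≤ _) hB)
      gcongr
      exact jb_rpow_le_one hm _
    calc _ ≤ B * (1 * (jb p ^ 8)⁻¹) * (jb p ^ 3 * ‖h‖) := by
          gcongr
          exact norm_dualDir_le hc p h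
      _ = _ := by field_simp
  have hw := integrable_modelWeight hm c t x
  have hG'b : ∀ p, ‖G' p‖ ≤ (4 + t) * ‖h‖ * B * modelWeight m c t x p := fun p => by
    have hj := jb_pos p
    have e1 : ‖g (q p) • dualDirD c h p‖ ≤ 3 * ‖h‖ * (B * modelWeight m c t x p) := by
      rw [norm_smul, Real.norm_eq_abs]
      calc _ ≤ |g (q p)| * (3 * jb p ^ 2 * ‖h‖) := by gcongr; exact norm_dualDirD_le hc h p
        _ = 3 * ‖h‖ * (|g (q p)| * jb p ^ 2) := by ring
        _ ≤ _ := mul_le_mul_of_nonneg_left (hg.mul_sq_le c t x p) (by positivity)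
    have e2 : ‖(ψ' p).smulRight (dualDir c h p)‖ ≤ (1 + t) * ‖h‖ * (B * modelWeight m c t x p) := by
      rw [ContinuousLinearMap.norm_smulRight_apply]
      calc _ ≤ (‖fderiv ℝ g (q p)‖ * (1 + t)) * (jb p ^ 3 * ‖h‖) := by
            gcongr
            · exact (ContinuousLinearMap.opNorm_comp_le _ _).trans (by gcongr; exact hq' p)
            · exact norm_dualDir_le hc p h
        _ = (1 + t) * ‖h‖ * (‖fderiv ℝ g (q p)‖ * jb p ^ 3) := by ring
        _ ≤ _ := mul_le_mul_of_nonneg_left (hg.fderiv_mul_cube_le c t x p) (by positivity)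
    have := norm_add_le (g (q p) • dualDirD c h p) ((ψ' p).smulRight (dualDir c h p))
    linarith
  have hdiv := integral_divergence_eq_zero hG hGi (hw.const_mul ((4 + t) * ‖h‖ * B)) hG'b
  have hsum : ∀ p, ∑ i : Fin 3, (G' p (EuclideanSpace.single i 1)) i
      = (fderiv ℝ g (q p) (0, dualDir c h p)
        + g (q p) * (5 * invSpeed c ^ 2 * gam c p * inner ℝ p h))
        - t * fderiv ℝ g (q p) (h, 0) := by
    intro p
    have s1 : ∑ i : Fin 3, (ψ' p (EuclideanSpace.single i 1)) * dualDir c h p i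
        = ψ' p (dualDir c h p) := by
      conv_rhs => rw [← (EuclideanSpace.basisFun (Fin 3) ℝ).sum_repr (dualDir c h p)]
      rw [map_sum]
      refine Finset.sum_congr rfl fun i _ => ?_
      rw [map_smul, smul_eq_mul, mul_comm]
      simp
    -- Moving p along a shifts the position by -t Dv_c(p) a = -t h, which produces exactly the
    -- x-derivative to be eliminated.
    have s2 : ψ' p (dualDir c h p)
        = fderiv ℝ g (q p) (0, dualDir c h p) - t * fderiv ℝ g (q p) (h, 0) := by
      change fderiv ℝ g (q p) (-(t • velD c p (dualDir c h p)), dualDir c h p) = _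
      rw [velD_dualDir, ← smul_eq_mul, ← map_smul, ← map_sub]
      simp
    have s3 : ∀ i : Fin 3, (G' p (EuclideanSpace.single i 1)) i
        = g (q p) * (dualDirD c h p (EuclideanSpace.single i 1)) i
          + ψ' p (EuclideanSpace.single i 1) * dualDir c h p i := fun i => by
      simp [G']
    simp_rw [s3]
    rw [Finset.sum_add_distrib, ← Finset.mul_sum, sum_dualDirD, s1, s2]
    ring
  have i1 : Integrable (fun p => fderiv ℝ g (q p) (0, dualDir c h p)
        + g (q p) * (5 * invSpeed c ^ 2 * gam c p * inner ℝ p h)) := by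
    have h1 : Integrable (fun p => ∑ i : Fin 3, (G' p (EuclideanSpace.single i 1)) i
        + t * fderiv ℝ g (q p) (h, 0)) := by
      refine Integrable.add ?_ (Integrable.const_mul ?_ t)
      · refine ((hw.const_mul ((4 + t) * ‖h‖ * B)).const_mul 3).mono' ?_
          (Filter.Eventually.of_forall fun p => ?_)
        · simp_rw [hsum]
          exact ((((hcf.clm_apply (continuous_const.prodMk hcd))).add
            (hcg.mul (by fun_prop))).sub (continuous_const.mul
              (hcf.clm_apply continuous_const))).aestronglyMeasurable
        · calc _ ≤ ∑ i : Fin 3, ‖(G' p (EuclideanSpace.single i 1)) i‖ := norm_sum_le _ _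
            _ ≤ ∑ i : Fin 3, (4 + t) * ‖h‖ * B * modelWeight m c t x p := by
              refine Finset.sum_le_sum fun i _ => (PiLp.norm_apply_le _ _).trans ?_
              refine ((G' p).le_opNorm _).trans ?_
              simpa using hG'b p
            _ = _ := by simp
      · refine (hw.const_mul (B * ‖h‖)).mono' (hcf.clm_apply continuous_const).aestronglyMeasurable
          (Filter.Eventually.of_forall fun p => ?_)
        exact hg.abs_fderiv_inl_le c t h x p
    refine h1.congr (Filter.Eventually.of_forall fun p => ?_)
    simp only [hsum]; ring
  have i2 : Integrable (fun p => t * fderiv ℝ g (q p) (h, 0)) := by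
    refine Integrable.const_mul ?_ t
    refine (hw.const_mul (B * ‖h‖)).mono' (hcf.clm_apply continuous_const).aestronglyMeasurable
      (Filter.Eventually.of_forall fun p => ?_)
    exact hg.abs_fderiv_inl_le c t h x p
  simp_rw [hsum] at hdiv
  rw [integral_sub i1 i2, integral_const_mul, sub_eq_zero] at hdiv
  exact hdiv.symm

/-- The direct bound serves small t, the integrated-by-parts identity large t. In the identity the
p-derivative contributes 1 and the divergence 5. -/
theorem IsProfileBound.abs_rhoD_le_div (hg : IsProfileBound m B g) (hm : 0 ≤ m) (hc : 1 ≤ c)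
    (ht : 0 ≤ t) (h x : E3) :
    |rhoD c t g h x| ≤ 12 * B * (1 + t)⁻¹ * ‖h‖ * modelDensity m c t x := by
  have hB := hg.nonneg
  have hρ := modelDensity_nonneg m c t x
  have h1 := hg.abs_rhoD_le hm c t h x
  have h2 : t * |rhoD c t g h x| ≤ 6 * B * ‖h‖ * modelDensity m c t x := by
    rw [← abs_of_nonneg ht, ← abs_mul, abs_of_nonneg ht, hg.mul_rhoD_eq hm hc ht, modelDensity,
      ← integral_const_mul, ← Real.norm_eq_abs]
    refine norm_integral_le_of_norm_le ((integrable_modelWeight hm c t x).const_mul _)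
      (Filter.Eventually.of_forall fun p => ?_)
    have hj := jb_pos p
    have e1 : |fderiv ℝ g (freeFlowInv c t (x, p)) (0, dualDir c h p)|
        ≤ ‖h‖ * (B * modelWeight m c t x p) := by
      refine ((fderiv ℝ g (freeFlowInv c t (x, p))).le_opNorm (0, dualDir c h p)).trans ?_
      calc _ ≤ ‖fderiv ℝ g (freeFlowInv c t (x, p))‖ * (jb p ^ 3 * ‖h‖) := by
            gcongr; exact (norm_inr_le _).trans (norm_dualDir_le hc p h)
        _ = ‖h‖ * (‖fderiv ℝ g (freeFlowInv c t (x, p))‖ * jb p ^ 3) := by ring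
        _ ≤ _ := mul_le_mul_of_nonneg_left (hg.fderiv_mul_cube_le c t x p) (by positivity)
    have e2 : |g (freeFlowInv c t (x, p)) * (5 * invSpeed c ^ 2 * gam c p * inner ℝ p h)|
        ≤ 5 * ‖h‖ * (B * modelWeight m c t x p) := by
      have hk : invSpeed c ^ 2 ≤ 1 := pow_le_one₀ (invSpeed_nonneg c) (invSpeed_le_one hc)
      have hgm := gam_pos c p
      rw [abs_mul, abs_mul, abs_of_nonneg (by positivity : 0 ≤ 5 * invSpeed c ^ 2 * gam c p)]
      calc _ ≤ |g (freeFlowInv c t (x, p))| * (5 * 1 * jb p * (jb p * ‖h‖)) := by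
            gcongr
            · exact gam_le_jb hc p
            · exact (abs_real_inner_le_norm _ _).trans (by gcongr; exact norm_le_jb p)
        _ = 5 * ‖h‖ * (|g (freeFlowInv c t (x, p))| * jb p ^ 2) := by ring
        _ ≤ _ := mul_le_mul_of_nonneg_left (hg.mul_sq_le c t x p) (by positivity)
    rw [Real.norm_eq_abs]
    have := abs_add_le (fderiv ℝ g (freeFlowInv c t (x, p)) (0, dualDir c h p))
      (g (freeFlowInv c t (x, p)) * (5 * invSpeed c ^ 2 * gam c p * inner ℝ p h))
    linarith
  have h3 : 0 ≤ B * ‖h‖ * modelDensity m c t x := by positivity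
  have e : 12 * B * (1 + t)⁻¹ * ‖h‖ * modelDensity m c t x
      = 12 * (B * ‖h‖ * modelDensity m c t x) / (1 + t) := by
    field_simp
  rw [e, le_div_iff₀ (by positivity)]
  nlinarith

theorem modelDensity_le_of_norm_sub_le (hm : 0 ≤ m) (c : ℝ≥0∞) (t : ℝ) {x y : E3}
    (h : ‖x - y‖ ≤ 1) : modelDensity m c t y ≤ 2 ^ m * modelDensity m c t x := by
  rw [modelDensity, modelDensity, ← integral_const_mul]
  refine integral_mono (integrable_modelWeight hm c t y)
    ((integrable_modelWeight hm c t x).const_mul _) fun p => ?_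
  have h1 : ‖x - t • vel c p - (y - t • vel c p)‖ ≤ 1 := by simpa using h
  have h2 := rpow_neg_jb_le hm h1
  have hj := jb_pos p
  norm_num at h2
  simp only [modelWeight]
  rw [← mul_assoc]
  gcongr

theorem IsProfileBound.abs_rho_sub_le (hg : IsProfileBound m B g) (hm : 0 ≤ m) (hc : 1 ≤ c)
    (ht : 0 ≤ t) {h : E3} (hh : ‖h‖ ≤ 1) (x : E3) :
    |rho c t g (x + h) - rho c t g x|
      ≤ 12 * 2 ^ m * B * (1 + t)⁻¹ * ‖h‖ * modelDensity m c t x := by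
  have hB := hg.nonneg
  have := norm_image_sub_le_of_norm_deriv_le_segment_01'
    (f := fun θ : ℝ => rho c t g (x + θ • h))
    (f' := fun θ : ℝ => rhoD c t g h (x + θ • h))
    (C := 12 * 2 ^ m * B * (1 + t)⁻¹ * ‖h‖ * modelDensity m c t x)
    (fun θ _ => (hg.hasDerivAt_rho hm c t h x θ).hasDerivWithinAt) fun θ hθ => by
      refine (hg.abs_rhoD_le_div hm hc ht h (x + θ • h)).trans ?_
      have h1 : ‖x - (x + θ • h)‖ ≤ 1 := by
        have h0 : |θ| ≤ 1 := by rw [abs_of_nonneg hθ.1]; exact hθ.2.le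
        rw [sub_add_cancel_left, norm_neg, norm_smul, Real.norm_eq_abs]
        exact mul_le_one₀ h0 (norm_nonneg _) hh
      have h2 := modelDensity_le_of_norm_sub_le hm c t h1
      calc _ ≤ 12 * B * (1 + t)⁻¹ * ‖h‖ * (2 ^ m * modelDensity m c t x) := by gcongr
        _ = _ := by ring
  simpa using this

end Density

/-! ### Decay of the force field and the bootstrap. -/

/-- `C` bounds the convolution of `|K|` with the model densities. -/
structure IsConvolutionConst (α m : ℝ) (K : E3 → E3) (C : ℝ) : Prop where
  pos : 0 < C
  aestronglyMeasurable : AEStronglyMeasurable K volume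
  integrable : ∀ c : ℝ≥0∞, 1 ≤ c → ∀ t : ℝ, 0 ≤ t → ∀ x : E3,
    Integrable (fun y => modelDensity m c t (x - y) * ‖K y‖) volume
  integral_le : ∀ c : ℝ≥0∞, 1 ≤ c → ∀ t : ℝ, 0 ≤ t → ∀ x : E3,
    ∫ y, modelDensity m c t (x - y) * ‖K y‖ ≤ C * (1 + t) ^ (-(α + 1))

theorem exists_isConvolutionConst {α m : ℝ} (hα1 : 1 < α) (hα2 : α < 2) (hm : 3 < m) {w : E3 → ℝ}
    {K : E3 → E3} (hw : IsDecayingPotential α w K) : ∃ C, IsConvolutionConst α m K C := by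
  obtain ⟨C, hC, h⟩ := exists_convolution_bound hα1 hα2 hm hw
  exact ⟨C, hC, hw.weakGradient.2.1.aestronglyMeasurable, fun c hc t ht x => (h c hc t ht x).1,
    fun c hc t ht x => (h c hc t ht x).2⟩

section Conv
variable {α m C : ℝ} {K : E3 → E3} {c : ℝ≥0∞} {t : ℝ}

theorem IsConvolutionConst.integrable_smul (hC : IsConvolutionConst α m K C) (hc : 1 ≤ c)
    (ht : 0 ≤ t) {r : E3 → ℝ} {B : ℝ} (hr : AEStronglyMeasurable r volume)
    (hle : ∀ y, |r y| ≤ B * modelDensity m c t y) (x : E3) :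
    Integrable (fun y => r (x - y) • K y) := by
  have hr' : AEStronglyMeasurable (fun y => r (x - y)) volume :=
    hr.comp_measurePreserving (Measure.measurePreserving_sub_left volume x)
  refine ((hC.integrable c hc t ht x).const_mul B).mono' (hr'.smul hC.aestronglyMeasurable)
    (Filter.Eventually.of_forall fun y => ?_)
  · rw [norm_smul, ← mul_assoc, Real.norm_eq_abs]
    gcongr
    exact hle _

theorem IsConvolutionConst.norm_integral_le (hC : IsConvolutionConst α m K C) (hc : 1 ≤ c)
    (ht : 0 ≤ t) {r : E3 → ℝ} {B : ℝ} (hB : 0 ≤ B)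
    (x : E3) (hle : ∀ y, |r (x - y)| ≤ B * modelDensity m c t (x - y)) :
    ‖∫ y, r (x - y) • K y‖ ≤ B * C * (1 + t) ^ (-(α + 1)) := by
  calc _ ≤ ∫ y, B * (modelDensity m c t (x - y) * ‖K y‖) := by
        refine norm_integral_le_of_norm_le ((hC.integrable c hc t ht x).const_mul B)
          (Filter.Eventually.of_forall fun y => ?_)
        rw [norm_smul, ← mul_assoc, Real.norm_eq_abs]
        gcongr
        exact hle _
    _ ≤ B * (C * (1 + t) ^ (-(α + 1))) := by
        rw [integral_const_mul]; gcongr; exact hC.integral_le c hc t ht x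
    _ = _ := by ring

end Conv

section Field
variable {α m β C η₀ : ℝ} {K : E3 → E3} {c : ℝ≥0∞} {f0 : Phase → ℝ} {f : ℝ → Phase → ℝ}
  {Φ : ℝ → Phase → Phase} {T κ : ℝ} {a : ℝ → ℝ}

/-- Fubini, with the convolution written so that x enters through the density: the kernel is only
locally integrable and cannot be differentiated. -/
theorem IsGlobalSolution.field_eq (hf : IsGlobalSolution β K c f0 f) {t : ℝ} (ht : 0 ≤ t) (x : E3) :
    field β K f t x = β • ∫ y, rho c t (profile c f t) (x - y) • K y := by
  have h := integral_sub_left_eq_self (fun y => rho c t (profile c f t) y • K (x - y))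
    (volume : Measure E3) x
  simp only [sub_sub_cancel] at h
  rw [field, h, Measure.volume_eq_prod, integral_prod _ (hf.integrable_field t ht x)]
  congr 1
  refine integral_congr_ae (Filter.Eventually.of_forall fun y => ?_)
  simp only [integral_smul_const, rho, profile_freeFlowInv]

variable {B : ℝ}

theorem IsGlobalSolution.norm_field_le (hf : IsGlobalSolution β K c f0 f)
    (hC : IsConvolutionConst α m K C) (hm : 0 ≤ m) (hβ : |β| ≤ 1) (hc : 1 ≤ c) {t : ℝ} (ht : 0 ≤ t)
    (hg : IsProfileBound m B (profile c f t)) (x : E3) :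
    ‖field β K f t x‖ ≤ B * C * (1 + t) ^ (-(α + 1)) := by
  have h1 := hC.norm_integral_le hc ht hg.nonneg x fun y => hg.abs_rho_le hm c t (x - y)
  rw [hf.field_eq ht, norm_smul, Real.norm_eq_abs]
  exact (mul_le_of_le_one_left (norm_nonneg _) hβ).trans h1

/-- Differentiability of the field is given, so it is enough to bound increments E(x') - E(x). These
are convolutions with density increments, which carry the extra (1 + t)⁻¹. -/
theorem IsGlobalSolution.norm_fderiv_field_le (hf : IsGlobalSolution β K c f0 f)
    (hC : IsConvolutionConst α m K C) (hm : 0 ≤ m) (hβ : |β| ≤ 1) (hc : 1 ≤ c) {t : ℝ} (ht : 0 ≤ t)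
    (hg : IsProfileBound m B (profile c f t)) (x : E3) :
    ‖fderiv ℝ (field β K f t) x‖ ≤ 12 * 2 ^ m * B * C * (1 + t) ^ (-(α + 2)) := by
  have hB := hg.nonneg
  have hC0 := hC.pos
  have hd := hf.field_differentiable t ht x
  have e : (1 + t) ^ (-(α + 2)) = (1 + t)⁻¹ * (1 + t) ^ (-(α + 1)) := by
    rw [← Real.rpow_neg_one, ← Real.rpow_add (by positivity)]; congr 1; ring
  refine hd.hasFDerivAt.le_of_lip' (by positivity) ?_
  filter_upwards [Metric.ball_mem_nhds x one_pos] with x' hx'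
  rw [mem_ball_iff_norm] at hx'
  set h := x' - x with hh
  set ρ := rho c t (profile c f t)
  have hmeas : AEStronglyMeasurable ρ volume := hg.aestronglyMeasurable_rho c t
  have hle : ∀ y, |ρ y| ≤ B * modelDensity m c t y := fun y => hg.abs_rho_le hm c t y
  have hE : field β K f t x' - field β K f t x
      = β • ∫ y, (fun y => ρ (y + h) - ρ y) (x - y) • K y := by
    rw [hf.field_eq ht, hf.field_eq ht, ← smul_sub,
      ← integral_sub (hC.integrable_smul hc ht hmeas hle x') (hC.integrable_smul hc ht hmeas hle x)]
    congr 2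
    ext1 y
    rw [← sub_smul]
    congr 3
    rw [hh]; abel
  rw [hE, norm_smul, Real.norm_eq_abs]
  refine (mul_le_of_le_one_left (norm_nonneg _) hβ).trans ?_
  have h1 := hC.norm_integral_le hc ht (r := fun y => ρ (y + h) - ρ y)
    (B := 12 * 2 ^ m * B * (1 + t)⁻¹ * ‖h‖) (by positivity) x
    fun y => hg.abs_rho_sub_le hm hc ht hx'.le (x - y)
  refine h1.trans (le_of_eq ?_)
  rw [e]; ring

/-- The decay constant of the field. -/
def fieldConst (m C : ℝ) : ℝ := 12 * 2 ^ m * profileConst m * C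

theorem fieldConst_pos (hC : 0 < C) : 0 < fieldConst m C := by
  have := profileConst_pos m
  unfold fieldConst; positivity

theorem profileConst_mul_le_fieldConst (hm : 0 ≤ m) (hC : 0 < C) :
    profileConst m * C ≤ fieldConst m C := by
  have := profileConst_pos m
  have h2 : (1 : ℝ) ≤ 2 ^ m := Real.one_le_rpow (by norm_num) hm
  have h3 : 0 < profileConst m * C := by positivity
  unfold fieldConst
  nlinarith

/-- `E` and `∇E` decay on `[0,T]` like the field of a free solution. -/
def HasFieldDecay (α A : ℝ) (E : ℝ → E3 → E3) (T : ℝ) : Prop :=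
  ∀ t ∈ Icc 0 T, ∀ x, ‖E t x‖ ≤ A * (1 + t) ^ (-(α + 1)) ∧
    ‖fderiv ℝ (E t) x‖ ≤ A * (1 + t) ^ (-(α + 2))

/-- The gain of the bootstrap: any envelope of mass at most 1/32, however crude, yields decay with a
constant independent of that envelope. -/
theorem IsGlobalSolution.hasFieldDecay_of_isEnvelope (hf : IsGlobalSolution β K c f0 f)
    (hΦ : IsCharFlow c (field β K f) Φ) (hC : IsConvolutionConst α m K C) (hm : 0 ≤ m)
    (hβ : |β| ≤ 1) (hc : 1 ≤ c) (hf0 : ContDiff ℝ 1 f0) (hη : dataSize m f0 < ENNReal.ofReal η₀)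
    (h : IsEnvelope (field β K f) T κ a) (hκ : κ ≤ 1 / 32) :
    HasFieldDecay α (fieldConst m C * η₀) (field β K f) T := by
  intro t ht x
  have hη0 := pos_of_dataSize_lt hη
  have hg := hf.profileBound hΦ h hκ hc hm hf0 hη ht
  have ht0 : 0 ≤ t := ht.1
  constructor
  · refine (hf.norm_field_le hC hm hβ hc ht.1 hg x).trans ?_
    have := profileConst_mul_le_fieldConst hm hC.pos
    gcongr ?_ * _
    nlinarith
  · refine (hf.norm_fderiv_field_le hC hm hβ hc ht.1 hg x).trans (le_of_eq ?_)
    unfold fieldConst; ring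

theorem integrableOn_one_add_rpow (s T : ℝ) :
    IntegrableOn (fun t : ℝ => (1 + t) ^ s) (Icc 0 T) := by
  refine ContinuousOn.integrableOn_compact isCompact_Icc fun t ht => ?_
  have : 1 + t ≠ 0 := by linarith [ht.1]
  exact ((continuousAt_const.add continuousAt_id).rpow_const (Or.inl this)).continuousWithinAt

theorem integral_one_add_rpow_le (hα : 1 < α) (T : ℝ) :
    ∫ t in Icc 0 T, (1 + t) ^ (-α) ≤ (α - 1)⁻¹ := by
  rcases lt_or_ge T 0 with hT | hT
  · rw [Icc_eq_empty (by linarith), setIntegral_empty]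
    exact inv_nonneg.2 (by linarith)
  · rw [integral_Icc_eq_integral_Ioc, ← intervalIntegral.integral_of_le hT,
      intervalIntegral.integral_comp_add_left (fun t : ℝ => t ^ (-α)) 1,
      integral_rpow (Or.inr ⟨by linarith, by
        rw [uIcc_of_le (by linarith)]; intro h; linarith [h.1]⟩)]
    have h1 : 0 ≤ (1 + T) ^ (-α + 1) := Real.rpow_nonneg (by linarith) _
    have h2 : 0 < α - 1 := by linarith
    rw [add_zero, Real.one_rpow, show -α + 1 = -(α - 1) by ring, div_neg, ← neg_div, neg_sub,
      div_eq_mul_inv]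
    have h3 : 1 - (1 + T) ^ (-(α - 1)) ≤ 1 := by
      rw [show -α + 1 = -(α - 1) by ring] at h1; linarith
    exact mul_le_of_le_one_left (inv_nonneg.2 h2.le) h3

theorem IsGlobalSolution.isEnvelope (hf : IsGlobalSolution β K c f0 f)
    (hint : IntegrableOn a (Icc 0 T)) (hle : ∫ s in Icc 0 T, a s ≤ κ)
    (hE : ∀ s ∈ Icc 0 T, ∀ x, (1 + s) * ‖field β K f s x‖ ≤ a s)
    (hD : ∀ s ∈ Icc 0 T, ∀ x, (1 + s) ^ 2 * ‖fderiv ℝ (field β K f s) x‖ ≤ a s) :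
    IsEnvelope (field β K f) T κ a where
  continuousOn := hf.field_continuousOn
  integrableOn := hint
  integral_le := hle
  bound := hE
  lip := fun s hs x y => by
    have hs0 : 0 < (1 + s) ^ 2 := by have := hs.1; positivity
    have := convex_univ.norm_image_sub_le_of_norm_fderiv_le (𝕜 := ℝ) (C := a s / (1 + s) ^ 2)
      (fun z _ => hf.field_differentiable s hs.1 z)
      (fun z _ => by rw [le_div_iff₀ hs0, mul_comm]; exact hD s hs z) (mem_univ y) (mem_univ x)
    rw [div_mul_eq_mul_div, le_div_iff₀ hs0] at this
    linarith

theorem one_add_mul_le {A t : ℝ} {v : ℝ} (ht : 0 ≤ t) (h : v ≤ A * (1 + t) ^ (-(α + 1))) :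
    (1 + t) * v ≤ A * (1 + t) ^ (-α) := by
  calc (1 + t) * v ≤ (1 + t) * (A * (1 + t) ^ (-(α + 1))) := by gcongr
    _ = A * ((1 + t) ^ (1 : ℝ) * (1 + t) ^ (-(α + 1))) := by rw [Real.rpow_one]; ring
    _ = _ := by rw [← Real.rpow_add (by positivity)]; congr 2; ring

theorem one_add_sq_mul_le {A t : ℝ} {v : ℝ} (ht : 0 ≤ t) (h : v ≤ A * (1 + t) ^ (-(α + 2))) :
    (1 + t) ^ 2 * v ≤ A * (1 + t) ^ (-α) := by
  calc (1 + t) ^ 2 * v ≤ (1 + t) ^ 2 * (A * (1 + t) ^ (-(α + 2))) := by gcongr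
    _ = A * ((1 + t) ^ (2 : ℝ) * (1 + t) ^ (-(α + 2))) := by rw [Real.rpow_two]; ring
    _ = _ := by rw [← Real.rpow_add (by positivity)]; congr 2; ring

theorem IsGlobalSolution.isEnvelope_of_hasFieldDecay (hf : IsGlobalSolution β K c f0 f)
    (hα : 1 < α) {A : ℝ} (hA : 0 ≤ A) (h : HasFieldDecay α A (field β K f) T) :
    IsEnvelope (field β K f) T (A * (α - 1)⁻¹) (fun s => A * (1 + s) ^ (-α)) := by
  refine hf.isEnvelope ((integrableOn_one_add_rpow _ _).const_mul A) ?_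
    (fun s hs x => one_add_mul_le hs.1 (h s hs x).1)
    (fun s hs x => one_add_sq_mul_le hs.1 (h s hs x).2)
  rw [integral_const_mul]
  exact mul_le_mul_of_nonneg_left (integral_one_add_rpow_le hα T) hA

/-- Bootstrap with a uniform step. Decay on [0,T] uses half of the allowed mass 1/32; the a priori
bound on [0,S] costs at most the other half on a further interval of length τ. Decay then extends
there with the same constant. -/
theorem IsGlobalSolution.hasFieldDecay (hf : IsGlobalSolution β K c f0 f)
    (hΦ : IsCharFlow c (field β K f) Φ) (hC : IsConvolutionConst α m K C) (hα : 1 < α) (hm : 0 ≤ m)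
    (hβ : |β| ≤ 1) (hc : 1 ≤ c) (hf0 : ContDiff ℝ 1 f0) (hη : dataSize m f0 < ENNReal.ofReal η₀)
    (hsmall : fieldConst m C * η₀ * (α - 1)⁻¹ ≤ 1 / 64) {S : ℝ} (hS : 0 ≤ S) :
    HasFieldDecay α (fieldConst m C * η₀) (field β K f) S := by
  set A := fieldConst m C * η₀
  have hA : 0 ≤ A := mul_nonneg (fieldConst_pos hC.pos).le (pos_of_dataSize_lt hη).le
  obtain ⟨M, hM⟩ := hf.field_bounded S
  have hM0 : 0 ≤ M := (norm_nonneg _).trans (hM 0 le_rfl hS 0).1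
  set M' := M * (1 + S) ^ 2 with hM'
  have hM'0 : 0 ≤ M' := by positivity
  have hM'E : ∀ s ∈ Icc 0 S, ∀ x, (1 + s) * ‖field β K f s x‖ ≤ M' := fun s hs x => by
    have h1 := (hM s hs.1 hs.2 x).1
    have h2 : 1 + s ≤ (1 + S) ^ 2 := by nlinarith [hs.1, hs.2]
    rw [hM', mul_comm M]
    gcongr
  have hM'D : ∀ s ∈ Icc 0 S, ∀ x, (1 + s) ^ 2 * ‖fderiv ℝ (field β K f s) x‖ ≤ M' :=
    fun s hs x => by
      have h1 := (hM s hs.1 hs.2 x).2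
      have h2 : (1 + s) ^ 2 ≤ (1 + S) ^ 2 := by
        have := hs.1; gcongr; exact hs.2
      rw [hM', mul_comm M]
      gcongr
  -- Chosen so that the crude bound M', which already contains the time weights, has mass at most
  -- 1/64 over one step; the +1 guards against M' = 0.
  set τ := (64 * (M' + 1))⁻¹ with hτ
  have hτ0 : 0 < τ := by positivity
  have hτM : τ * M' ≤ 1 / 64 := by
    rw [hτ, inv_mul_eq_div, div_le_div_iff₀ (by positivity) (by norm_num)]; linarith
  -- The alternative T = 0 starts the induction: no decay is known yet, and the crude bound covers
  -- the whole interval.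
  have step : ∀ T ≥ 0, (T = 0 ∨ HasFieldDecay α A (field β K f) T) → ∀ T', T ≤ T' → T' ≤ T + τ →
      T' ≤ S → HasFieldDecay α A (field β K f) T' := by
    intro T hT hd T' h1 h2 h3
    have i1 : IntegrableOn (fun s => A * (1 + s) ^ (-α)) (Icc 0 T') :=
      (integrableOn_one_add_rpow _ _).const_mul A
    have i2 : IntegrableOn ((Icc T T').indicator fun _ => M') (Icc 0 T') :=
      ((integrable_indicator_iff measurableSet_Icc).2
        (integrableOn_const (by simp))).integrableOn
    have key : ∀ s ∈ Icc 0 T', s ∈ Icc T T' ∨ (s ∈ Icc 0 T ∧ HasFieldDecay α A (field β K f) T) := by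
      intro s hs
      rcases le_or_gt T s with h | h
      · exact Or.inl ⟨h, hs.2⟩
      · refine Or.inr ⟨⟨hs.1, h.le⟩, hd.resolve_left fun h0 => ?_⟩
        linarith [hs.1]
    have hn1 : ∀ s ∈ Icc 0 T', 0 ≤ A * (1 + s) ^ (-α) := fun s hs =>
      mul_nonneg hA (Real.rpow_nonneg (by linarith [hs.1]) _)
    have hn2 : ∀ s, 0 ≤ (Icc T T').indicator (fun _ => M') s := fun s =>
      indicator_nonneg (fun _ _ => hM'0) s
    refine hf.hasFieldDecay_of_isEnvelope hΦ hC hm hβ hc hf0 hη (κ := 1 / 32)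
      (a := fun s => A * (1 + s) ^ (-α) + (Icc T T').indicator (fun _ => M') s)
      (hf.isEnvelope (i1.add i2) ?_ (fun s hs x => ?_) (fun s hs x => ?_)) le_rfl
    · rw [integral_add i1 i2, integral_const_mul]
      have e1 : A * ∫ s in Icc 0 T', (1 + s) ^ (-α) ≤ A * (α - 1)⁻¹ :=
        mul_le_mul_of_nonneg_left (integral_one_add_rpow_le hα T') hA
      have e2 : ∫ s in Icc 0 T', (Icc T T').indicator (fun _ => M') s ≤ τ * M' := by
        rw [setIntegral_indicator measurableSet_Icc, inter_eq_right.2 (Icc_subset_Icc_left hT)]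
        simp only [integral_const, measureReal_restrict_apply_univ, Real.volume_real_Icc_of_le h1,
          smul_eq_mul]
        gcongr
        linarith
      linarith
    · rcases key s hs with h | ⟨h, hdec⟩
      · have := hM'E s ⟨hs.1, hs.2.trans h3⟩ x
        have := hn1 s hs
        rw [indicator_of_mem h]
        linarith
      · have := one_add_mul_le hs.1 (hdec s h x).1
        linarith [hn2 s]
    · rcases key s hs with h | ⟨h, hdec⟩
      · have := hM'D s ⟨hs.1, hs.2.trans h3⟩ x
        have := hn1 s hs
        rw [indicator_of_mem h]
        linarith
      · have := one_add_sq_mul_le hs.1 (hdec s h x).2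
        linarith [hn2 s]
  have ind : ∀ n : ℕ, HasFieldDecay α A (field β K f) (min (n * τ) S) := by
    intro n
    induction n with
    | zero =>
      have : min ((0 : ℕ) * τ) S = 0 := by simp [hS]
      rw [this]
      exact step 0 le_rfl (Or.inl rfl) 0 le_rfl (by linarith) hS
    | succ n ih =>
      refine step _ (le_min (by positivity) hS) (Or.inr ih) _ ?_ ?_ (min_le_right _ _)
      · refine min_le_min_right _ ?_
        push_cast; nlinarith
      · rw [← min_add_add_right]
        push_cast
        exact min_le_min (by linarith) (by linarith)
  obtain ⟨n, hn⟩ := exists_nat_ge (S / τ)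
  have h1 : S ≤ n * τ := (div_le_iff₀ hτ0).1 hn
  have := ind n
  rwa [min_eq_right h1] at this

end Field

/-! ### The density of one profile at speeds c and ∞. -/

section Shift
variable {m B : ℝ} {g : Phase → ℝ} {c : ℝ≥0∞} {t : ℝ}

/-- For |p| ≤ c one has γ² ≤ 2, so |p|² ≤ 2|v_c(p)|². -/
theorem jb_le_two_mul_jb_vel {p : E3} (hp : invSpeed c ^ 2 * ‖p‖ ^ 2 ≤ 1) :
    jb p ≤ 2 * jb (vel c p) := by
  have hg := gam_pos c p
  have h1 : ‖p‖ = gam c p * ‖vel c p‖ := by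
    rw [norm_vel, mul_inv_cancel_left₀ hg.ne']
  rw [jb, Real.sqrt_le_left (by have := jb_pos (vel c p); positivity), mul_pow, sq_jb, h1, mul_pow,
    sq_gam]
  nlinarith [sq_nonneg ‖vel c p‖]

theorem one_sub_inv_gam_pow_le (c : ℝ≥0∞) (p : E3) :
    1 - ((gam c p)⁻¹) ^ 5 ≤ 5 / 2 * (invSpeed c ^ 2 * ‖p‖ ^ 2) := by
  have h1 := one_sub_inv_gam_le c p
  have h2 := one_add_mul_le_pow (a := (gam c p)⁻¹ - 1) (by linarith [inv_gam_pos c p]) 5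
  rw [add_sub_cancel] at h2
  push_cast at h2
  linarith

/-- Mean value along the segment from v_c(p) to p, where momenta are at least |v_c(p)|, hence
brackets at least ⟨p⟩/2; 512 = 2⁹. The length c⁻²⟨p⟩³ consumes the surplus weight of the gradient.
-/
theorem IsProfileBound.abs_sub_vel_le (hg : IsProfileBound m B g) {p : E3}
    (hp : invSpeed c ^ 2 * ‖p‖ ^ 2 ≤ 1) (y : E3) :
    |g (freeFlowInv c t (y, p)) - g (y - t • vel c p, vel c p)|
      ≤ 512 * B * invSpeed c ^ 2 * modelWeight m c t y p := by
  have hB := hg.nonneg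
  set x := y - t • vel c p with hx
  set v := vel c p with hv
  have hj := jb_pos p
  have hjx := jb_pos x
  have hgd := hg.contDiff.differentiable one_ne_zero
  have hpv := jb_le_two_mul_jb_vel hp
  have hd : ∀ θ : ℝ, HasDerivAt (fun θ : ℝ => g (x, v + θ • (p - v)))
      (fderiv ℝ g (x, v + θ • (p - v)) (0, p - v)) θ := fun θ => by
    have h1 : HasDerivAt (fun θ : ℝ => ((x, v + θ • (p - v)) : Phase)) (0, p - v) θ := by
      have : HasDerivAt (fun θ : ℝ => v + θ • (p - v)) (p - v) θ := by
        simpa using ((hasDerivAt_id θ).smul_const (p - v)).const_add v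
      exact (hasDerivAt_const θ x).prodMk this
    exact (hgd _).hasFDerivAt.comp_hasDerivAt θ h1
  have hb : ∀ θ ∈ Ico (0 : ℝ) 1, ‖fderiv ℝ g (x, v + θ • (p - v)) (0, p - v)‖
      ≤ 512 * B * invSpeed c ^ 2 * modelWeight m c t y p := by
    intro θ hθ
    have e1 : v + θ • (p - v) = ((1 - θ) * (gam c p)⁻¹ + θ) • p := by
      rw [hv, vel]; module
    have e2 : ‖v‖ ≤ ‖v + θ • (p - v)‖ := by
      have h1 := inv_gam_le_one c p
      have h2 := inv_gam_pos c p
      have h3 : (gam c p)⁻¹ ≤ (1 - θ) * (gam c p)⁻¹ + θ := by nlinarith [hθ.1]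
      rw [e1, hv, norm_vel, norm_smul, Real.norm_of_nonneg (by linarith)]
      gcongr
    have e3 : jb p ≤ 2 * jb (v + θ • (p - v)) := hpv.trans (by linarith [jb_mono e2])
    have hj' := jb_pos (v + θ • (p - v))
    have e4 : (jb (v + θ • (p - v)) ^ 9)⁻¹ ≤ 512 * (jb p ^ 9)⁻¹ := by
      rw [← div_eq_mul_inv, inv_eq_one_div, div_le_div_iff₀ (by positivity) (by positivity)]
      calc 1 * jb p ^ 9 ≤ 1 * (2 * jb (v + θ • (p - v))) ^ 9 := by gcongr
        _ = _ := by ring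
    have e5 : ‖p - v‖ ≤ invSpeed c ^ 2 * jb p ^ 3 := by
      rw [norm_sub_rev]
      exact (norm_vel_sub_self_le c p).trans (by gcongr; exact norm_le_jb p)
    have e6 : ‖fderiv ℝ g (x, v + θ • (p - v))‖ ≤ B * (jb x ^ (-m) * (512 * (jb p ^ 9)⁻¹)) := by
      refine (hg.fderiv_bound _).trans ?_
      unfold wt
      gcongr
    refine ((fderiv ℝ g (x, v + θ • (p - v))).le_opNorm (0, p - v)).trans ?_
    calc _ ≤ B * (jb x ^ (-m) * (512 * (jb p ^ 9)⁻¹)) * (invSpeed c ^ 2 * jb p ^ 3) := by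
          gcongr
          exact (norm_inr_le _).trans e5
      _ = _ := by simp only [modelWeight, ← hx, ← hv]; field_simp
  have := norm_image_sub_le_of_norm_deriv_le_segment_01'
    (fun θ _ => (hd θ).hasDerivWithinAt) hb
  simpa [freeFlowInv] using this

/-- The densities of one profile for two speeds of light differ by `O(c⁻²)`. -/
theorem IsProfileBound.abs_rho_sub_rho_top_le (hg : IsProfileBound m B g) (hm : 0 ≤ m) (y : E3) :
    |rho c t g y - rho ⊤ t g y|
      ≤ 1152 * B * invSpeed c ^ 2 * (modelDensity m c t y + modelDensity m ⊤ t y) := by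
  have hB := hg.nonneg
  set k := invSpeed c
  set D : Set E3 := {p | k ^ 2 * ‖p‖ ^ 2 ≤ 1}
  have hD : MeasurableSet D :=
    (isClosed_le (by fun_prop : Continuous fun p : E3 => k ^ 2 * ‖p‖ ^ 2)
      continuous_const).measurableSet
  set V := vel c '' D
  have hV : MeasurableSet V := hD.image_of_continuousOn_injOn (continuous_vel c).continuousOn
    (vel_injective c).injOn
  set F : E3 → ℝ := fun u => g (freeFlowInv ⊤ t (y, u))
  set H : E3 → ℝ := fun p => g (freeFlowInv c t (y, p))
  set J : E3 → ℝ := fun p => ((gam c p)⁻¹) ^ 5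
  have hFi : Integrable F := hg.integrable hm ⊤ t y
  have hHi : Integrable H := hg.integrable hm c t y
  have hJF : IntegrableOn (fun p => J p * F (vel c p)) D :=
    (integrableOn_image_vel c hD F).1 hFi.integrableOn
  have hw := integrable_modelWeight hm c t y
  have hw' := integrable_modelWeight hm ⊤ t y
  -- Where c⁻²|p|² ≥ 1/2, the number 1 is at most 2c⁻²⟨p⟩², and the two surplus powers of ⟨p⟩ pay.
  have hmul : ∀ (c' : ℝ≥0∞) (p : E3), 1 / 2 ≤ k ^ 2 * ‖p‖ ^ 2 →
      |g (freeFlowInv c' t (y, p))| ≤ 2 * B * k ^ 2 * modelWeight m c' t y p := fun c' p hp => by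
    have h1 := hg.mul_sq_le c' t y p
    have h2 : 1 ≤ 2 * (k ^ 2 * jb p ^ 2) := by
      have : k ^ 2 * ‖p‖ ^ 2 ≤ k ^ 2 * jb p ^ 2 := by gcongr; exact norm_le_jb p
      linarith
    calc |g (freeFlowInv c' t (y, p))|
        ≤ |g (freeFlowInv c' t (y, p))| * (2 * (k ^ 2 * jb p ^ 2)) :=
          le_mul_of_one_le_right (abs_nonneg _) h2
      _ = 2 * k ^ 2 * (|g (freeFlowInv c' t (y, p))| * jb p ^ 2) := by ring
      _ ≤ 2 * k ^ 2 * (B * modelWeight m c' t y p) := by gcongr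
      _ = _ := by ring
  -- 1152 = 512 + 640: the shift of the momentum argument, plus the defect 1 - γ⁻⁵ ≤ (5/2) c⁻²|p|²
  -- of the Jacobian with 2⁸ from comparing brackets.
  have b1 : |∫ p in D, (H p - J p * F (vel c p))|
      ≤ ∫ p in D, 1152 * B * k ^ 2 * modelWeight m c t y p := by
    rw [← Real.norm_eq_abs]
    refine norm_integral_le_of_norm_le (hw.const_mul _).integrableOn ?_
    filter_upwards [ae_restrict_mem hD] with p hp
    have hp' : k ^ 2 * ‖p‖ ^ 2 ≤ 1 := hp
    have hj := jb_pos p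
    have hFv : F (vel c p) = g (y - t • vel c p, vel c p) := by simp [F, freeFlowInv, vel_top]
    have h1 := hg.abs_sub_vel_le (t := t) hp' y
    have hjv := jb_pos (vel c p)
    have hjx := jb_pos (y - t • vel c p)
    have e4 : (jb (vel c p) ^ 8)⁻¹ ≤ 256 * (jb p ^ 8)⁻¹ := by
      rw [← div_eq_mul_inv, inv_eq_one_div, div_le_div_iff₀ (by positivity) (by positivity)]
      calc 1 * jb p ^ 8 ≤ 1 * (2 * jb (vel c p)) ^ 8 := by
            gcongr; exact jb_le_two_mul_jb_vel hp'
        _ = _ := by ring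
    have h2 : (1 - J p) * |F (vel c p)| ≤ 640 * B * k ^ 2 * modelWeight m c t y p := by
      have h3 : |F (vel c p)| ≤ B * (jb (y - t • vel c p) ^ (-m) * (256 * (jb p ^ 8)⁻¹)) := by
        rw [hFv]
        refine (hg.bound _).trans ?_
        unfold wt
        gcongr
      have h4 : 1 - J p ≤ 5 / 2 * (k ^ 2 * jb p ^ 2) :=
        (one_sub_inv_gam_pow_le c p).trans (by gcongr; exact norm_le_jb p)
      calc _ ≤ 5 / 2 * (k ^ 2 * jb p ^ 2)
            * (B * (jb (y - t • vel c p) ^ (-m) * (256 * (jb p ^ 8)⁻¹))) := by gcongr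
        _ = _ := by simp only [modelWeight]; field_simp; ring
    have hJ1 : J p ≤ 1 := pow_le_one₀ (inv_gam_pos c p).le (inv_gam_le_one c p)
    have e : H p - J p * F (vel c p) = (H p - F (vel c p)) + (1 - J p) * F (vel c p) := by ring
    rw [e, Real.norm_eq_abs]
    refine (abs_add_le _ _).trans ?_
    rw [abs_mul, abs_of_nonneg (by linarith : 0 ≤ 1 - J p)]
    rw [← hFv] at h1
    linarith
  have b2 : |∫ p in Dᶜ, H p| ≤ ∫ p in Dᶜ, 1152 * B * k ^ 2 * modelWeight m c t y p := by
    rw [← Real.norm_eq_abs]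
    refine norm_integral_le_of_norm_le (hw.const_mul _).integrableOn ?_
    filter_upwards [ae_restrict_mem hD.compl] with p hp
    have hp' : 1 < k ^ 2 * ‖p‖ ^ 2 := not_le.1 hp
    refine (hmul c p (by linarith)).trans ?_
    have := modelWeight_nonneg m c t y p
    gcongr
    norm_num
  have b3 : |∫ u in Vᶜ, F u| ≤ ∫ u, 1152 * B * k ^ 2 * modelWeight m ⊤ t y u := by
    rw [← Real.norm_eq_abs]
    refine (norm_integral_le_of_norm_le (hw'.const_mul (1152 * B * k ^ 2)).integrableOn ?_).trans
      (setIntegral_le_integral (hw'.const_mul _) (Filter.Eventually.of_forall fun u =>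
        mul_nonneg (by positivity) (modelWeight_nonneg m ⊤ t y u)))
    filter_upwards [ae_restrict_mem hV.compl] with u hu
    -- Velocities missed by the substitution are fast, because every slower one is v_c of some p in
    -- D.
    have hu' : 1 / 2 < k ^ 2 * ‖u‖ ^ 2 := by
      by_contra hcon
      obtain ⟨p, hp, rfl⟩ := exists_vel_eq c (not_lt.1 hcon)
      exact hu ⟨p, hp, rfl⟩
    refine (hmul ⊤ u hu'.le).trans ?_
    have := modelWeight_nonneg m ⊤ t y u
    gcongr
    norm_num
  have e1 : rho c t g y = (∫ p in D, H p) + ∫ p in Dᶜ, H p := (integral_add_compl hD hHi).symm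
  have e2 : rho ⊤ t g y = (∫ p in D, J p * F (vel c p)) + ∫ u in Vᶜ, F u := by
    rw [← setIntegral_image_vel c hD F]
    exact (integral_add_compl hV hFi).symm
  have e3 : rho c t g y - rho ⊤ t g y
      = (∫ p in D, (H p - J p * F (vel c p))) + (∫ p in Dᶜ, H p) - ∫ u in Vᶜ, F u := by
    rw [integral_sub hHi.integrableOn hJF, e1, e2]; ring
  have e4 := integral_add_compl hD (hw.const_mul (1152 * B * k ^ 2))
  simp only [integral_const_mul] at b1 b2 b3 e4
  rw [e3]
  refine (abs_sub _ _).trans ?_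
  have e5 := abs_add_le (∫ p in D, (H p - J p * F (vel c p))) (∫ p in Dᶜ, H p)
  simp only [modelDensity]
  linarith

end Shift

/-! ### Contraction for the difference of the fields. -/

section Compare
variable {α m β C η₀ : ℝ} {K : E3 → E3} {c : ℝ≥0∞} {f0 : Phase → ℝ} {f f' : ℝ → Phase → ℝ}
  {Φ Φ' : ℝ → Phase → Phase} {T : ℝ} {q κ : ℝ} {a : ℝ → ℝ}

/-- The field difference is bounded by `q (1 + t)^{-(α+1)}` on `[0,T]`. -/
def FieldsClose (α q : ℝ) (E E' : ℝ → E3 → E3) (T : ℝ) : Prop :=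
  ∀ t ∈ Icc 0 T, ∀ x, ‖E t x - E' t x‖ ≤ q * (1 + t) ^ (-(α + 1))

theorem FieldsClose.norm_waveOp_sub_le {E E' : ℝ → E3 → E3} (h : IsEnvelope E T κ a)
    (h' : IsEnvelope E' T κ a) (hκ : κ ≤ 1 / 32) (hc : 1 ≤ c) (hΦ : IsCharFlow c E Φ)
    (hΦ' : IsCharFlow ⊤ E' Φ') (hα : 1 < α) (hq : 0 ≤ q) (hE : FieldsClose α q E E' T)
    {s t : ℝ} (hs : s ∈ Icc 0 T) (ht : t ∈ Icc 0 T) {z z' : Phase}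
    (heq : waveOp c Φ t z = waveOp ⊤ Φ' t z') :
    ‖waveOp c Φ s z - waveOp ⊤ Φ' s z'‖ ≤ 2 * (q * (α - 1)⁻¹
      + 24 * κ * invSpeed c ^ 2 * jb (waveOp ⊤ Φ' t z').2 ^ 3) := by
  refine (norm_waveOp_sub_waveOp_top_le h h' hκ hc hΦ hΦ' (D := fun s => q * (1 + s) ^ (-α))
    ((integrableOn_one_add_rpow _ _).const_mul q)
    (fun r hr x => one_add_mul_le hr.1 (hE r hr x)) hs ht heq).trans ?_
  rw [integral_const_mul]
  gcongr
  exact integral_one_add_rpow_le hα T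

theorem FieldsClose.norm_waveInv_sub_le {E E' : ℝ → E3 → E3} (h : IsEnvelope E T κ a)
    (h' : IsEnvelope E' T κ a) (hκ : κ ≤ 1 / 32) (hc : 1 ≤ c) (hΦ : IsCharFlow c E Φ)
    (hΦ' : IsCharFlow ⊤ E' Φ') (hα : 1 < α) (hq : 0 ≤ q) (hE : FieldsClose α q E E' T)
    {t : ℝ} (ht : t ∈ Icc 0 T) (z : Phase) :
    ‖waveInv c Φ t z - waveInv ⊤ Φ' t z‖ ≤ 2 * (q * (α - 1)⁻¹
      + 24 * κ * invSpeed c ^ 2 * jb z.2 ^ 3) := by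
  have h0 : (0 : ℝ) ∈ Icc 0 T := ⟨le_rfl, ht.1.trans ht.2⟩
  have e := h.waveOp_waveInv hκ hc hΦ ht z
  have e' := h'.waveOp_waveInv hκ le_top hΦ' ht z
  have := hE.norm_waveOp_sub_le h h' hκ hc hΦ hΦ' hα hq h0 ht (e.trans e'.symm)
  rwa [waveOp_zero hΦ, waveOp_zero hΦ', e'] at this

/-- One step of the contraction for the difference of the fields. -/
theorem FieldsClose.improve (hf : IsGlobalSolution β K c f0 f) (hf' : IsGlobalSolution β K ⊤ f0 f')
    (hΦ : IsCharFlow c (field β K f) Φ) (hΦ' : IsCharFlow ⊤ (field β K f') Φ')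
    (hC : IsConvolutionConst α m K C) (hα : 1 < α) (hm : 0 ≤ m) (hβ : |β| ≤ 1) (hc : 1 ≤ c)
    (hf0 : ContDiff ℝ 1 f0) (hη : dataSize m f0 < ENNReal.ofReal η₀)
    (h : IsEnvelope (field β K f) T κ a) (h' : IsEnvelope (field β K f') T κ a) (hκ : κ ≤ 1 / 32)
    (hq : 0 ≤ q) (hE : FieldsClose α q (field β K f) (field β K f') T) :
    FieldsClose α (profileConst m * η₀ * C * (q * (α - 1)⁻¹ + 2305 * invSpeed c ^ 2))
      (field β K f) (field β K f') T := by
  intro t ht x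
  have ht0 : 0 ≤ t := ht.1
  have hη0 := pos_of_dataSize_lt hη
  have hκ0 := h.const_nonneg
  have hα' : 0 < (α - 1)⁻¹ := inv_pos.2 (by linarith)
  set B := profileConst m * η₀ with hBdef
  have hB0 : 0 < B := mul_pos (profileConst_pos m) hη0
  set g := profile c f t
  set g' := profile ⊤ f' t
  set k := invSpeed c
  have hg : IsProfileBound m B g := hf.profileBound hΦ h hκ hc hm hf0 hη ht
  have hg' : IsProfileBound m B g' := hf'.profileBound hΦ' h' hκ le_top hm hf0 hη ht
  -- Both profiles are f⁰ evaluated at inverse wave operators. Here 24κ ≤ 1, and the loss ⟨p⟩³ is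
  -- exactly the surplus of the gradient weight.
  have hgg : ∀ z, |g z - g' z| ≤ B * (q * (α - 1)⁻¹ + k ^ 2) * (wt m 9 z * jb z.2 ^ 3) := by
    intro z
    have hw := wt_pos m 9 z
    have e1 : g z = f0 (waveInv c Φ t z) := hf.profile_eq hΦ h hκ hc ht z
    have e2 : g' z = f0 (waveInv ⊤ Φ' t z) := hf'.profile_eq hΦ' h' hκ le_top ht z
    have e3 := h.norm_waveInv_sub_le hκ hc hΦ ht z
    have e4 := h'.norm_waveInv_sub_le hκ le_top hΦ' ht z
    have e5 := initial_lip hm hf0 hη (e3.trans (by linarith)) (e4.trans (by linarith))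
    have e6 := hE.norm_waveInv_sub_le h h' hκ hc hΦ hΦ' hα hq ht z
    have hj1 : 1 ≤ jb z.2 ^ 3 := one_le_pow₀ (one_le_jb _)
    have e7 : q * (α - 1)⁻¹ + 24 * κ * k ^ 2 * jb z.2 ^ 3
        ≤ (q * (α - 1)⁻¹ + k ^ 2) * jb z.2 ^ 3 := by
      have h1 : q * (α - 1)⁻¹ ≤ q * (α - 1)⁻¹ * jb z.2 ^ 3 :=
        le_mul_of_one_le_right (by positivity) hj1
      have h2 : 24 * κ * k ^ 2 * jb z.2 ^ 3 ≤ 1 * k ^ 2 * jb z.2 ^ 3 := by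
        gcongr; linarith
      linarith
    rw [e1, e2]
    calc _ ≤ _ := e5
      _ ≤ 2 * (3 ^ m * 3 ^ 9) * η₀ * wt m 9 z
          * (2 * ((q * (α - 1)⁻¹ + k ^ 2) * jb z.2 ^ 3)) := by
        gcongr
        exact e6.trans (by gcongr)
      _ = _ := by rw [hBdef, profileConst]; ring
  have hρ1 : ∀ y, |rho c t g y - rho c t g' y|
      ≤ B * (q * (α - 1)⁻¹ + k ^ 2) * modelDensity m c t y := by
    intro y
    rw [rho, rho, ← integral_sub (hg.integrable hm c t y) (hg'.integrable hm c t y), modelDensity,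
      ← integral_const_mul, ← Real.norm_eq_abs]
    refine norm_integral_le_of_norm_le ((integrable_modelWeight hm c t y).const_mul _)
      (Filter.Eventually.of_forall fun p => ?_)
    rw [← wt_freeFlowInv_le m c t y p 3]
    exact hgg _
  -- First the profile is changed at fixed speed c, then the speed at fixed profile. With the 1 from
  -- the profiles, the c⁻² coefficients add up to 1 + 1152 + 1152 = 2305.
  have hρ2 : ∀ y, |rho c t g y - rho ⊤ t g' y|
      ≤ (B * (q * (α - 1)⁻¹ + k ^ 2) + 1152 * B * k ^ 2) * modelDensity m c t y
        + 1152 * B * k ^ 2 * modelDensity m ⊤ t y := by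
    intro y
    have h1 := hρ1 y
    have h2 := hg'.abs_rho_sub_rho_top_le (c := c) (t := t) hm y
    have h3 := abs_sub_le (rho c t g y) (rho c t g' y) (rho ⊤ t g' y)
    linarith
  set b1 := B * (q * (α - 1)⁻¹ + k ^ 2) + 1152 * B * k ^ 2
  set b2 := 1152 * B * k ^ 2
  have hb1 : 0 ≤ b1 := by positivity
  have hb2 : 0 ≤ b2 := by positivity
  have hdiff : field β K f t x - field β K f' t x
      = β • ∫ y, (rho c t g (x - y) - rho ⊤ t g' (x - y)) • K y := by
    rw [hf.field_eq ht0, hf'.field_eq ht0, ← smul_sub, ← integral_sub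
      (hC.integrable_smul hc ht0 (hg.aestronglyMeasurable_rho c t)
        (fun y => hg.abs_rho_le hm c t y) x)
      (hC.integrable_smul le_top ht0 (hg'.aestronglyMeasurable_rho ⊤ t)
        (fun y => hg'.abs_rho_le hm ⊤ t y) x)]
    simp only [sub_smul]
  rw [hdiff, norm_smul, Real.norm_eq_abs]
  refine (mul_le_of_le_one_left (norm_nonneg _) hβ).trans ?_
  have i1 := (hC.integrable c hc t ht0 x).const_mul b1
  have i2 := (hC.integrable ⊤ le_top t ht0 x).const_mul b2
  have hD0 : 0 ≤ (1 + t) ^ (-(α + 1)) := by positivity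
  calc _ ≤ ∫ y, (b1 * (modelDensity m c t (x - y) * ‖K y‖)
          + b2 * (modelDensity m ⊤ t (x - y) * ‖K y‖)) := by
        refine norm_integral_le_of_norm_le (i1.add i2) (Filter.Eventually.of_forall fun y => ?_)
        rw [norm_smul, Real.norm_eq_abs, ← mul_assoc, ← mul_assoc, ← add_mul]
        gcongr
        exact hρ2 _
    _ ≤ b1 * (C * (1 + t) ^ (-(α + 1))) + b2 * (C * (1 + t) ^ (-(α + 1))) := by
        rw [integral_add i1 i2, integral_const_mul, integral_const_mul]
        gcongr
        · exact hC.integral_le c hc t ht0 x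
        · exact hC.integral_le ⊤ le_top t ht0 x
    _ = _ := by simp only [b1, b2]; ring

/-- Decay of both fields gives a first bound with no smallness in c⁻²; each improvement halves the
excess over the fixed level D, and the limit removes it. The level uses 4610 = 2 · 2305, so that the
c⁻² source equals D/2. -/
theorem fieldsClose_of_hasFieldDecay (hf : IsGlobalSolution β K c f0 f)
    (hf' : IsGlobalSolution β K ⊤ f0 f')
    (hΦ : IsCharFlow c (field β K f) Φ) (hΦ' : IsCharFlow ⊤ (field β K f') Φ')
    (hC : IsConvolutionConst α m K C) (hα : 1 < α) (hm : 0 ≤ m) (hβ : |β| ≤ 1) (hc : 1 ≤ c)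
    (hf0 : ContDiff ℝ 1 f0) (hη : dataSize m f0 < ENNReal.ofReal η₀) {A : ℝ} (hA0 : 0 ≤ A)
    (h : HasFieldDecay α A (field β K f) T) (h' : HasFieldDecay α A (field β K f') T)
    (hA : A * (α - 1)⁻¹ ≤ 1 / 64) (hAC : profileConst m * η₀ * C ≤ A) :
    FieldsClose α (4610 * (profileConst m * η₀ * C) * invSpeed c ^ 2)
      (field β K f) (field β K f') T := by
  have hη0 := pos_of_dataSize_lt hη
  have hκ : A * (α - 1)⁻¹ ≤ 1 / 32 := by linarith
  have henv := hf.isEnvelope_of_hasFieldDecay hα hA0 h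
  have henv' := hf'.isEnvelope_of_hasFieldDecay hα hA0 h'
  have hα' : 0 < (α - 1)⁻¹ := inv_pos.2 (by linarith)
  set b := profileConst m * η₀ * C
  have hb : 0 ≤ b := mul_nonneg (mul_pos (profileConst_pos m) hη0).le hC.pos.le
  have hbα : b * (α - 1)⁻¹ ≤ 1 / 2 := by
    have : b * (α - 1)⁻¹ ≤ A * (α - 1)⁻¹ := by gcongr
    linarith
  set D := 4610 * b * invSpeed c ^ 2
  have hD : 0 ≤ D := by positivity
  have ind : ∀ n : ℕ, FieldsClose α (2 * A * (1 / 2) ^ n + D) (field β K f) (field β K f') T := by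
    intro n
    induction n with
    | zero =>
      intro t ht x
      have h0 : 0 ≤ (1 + t) ^ (-(α + 1)) := Real.rpow_nonneg (by linarith [ht.1]) _
      have h1 := (h t ht x).1
      have h2 := (h' t ht x).1
      have h3 := norm_sub_le (field β K f t x) (field β K f' t x)
      have h4 := mul_nonneg hD h0
      simp only [pow_zero]
      linarith
    | succ n ih =>
      have hq : 0 ≤ 2 * A * (1 / 2) ^ n + D := by positivity
      have := FieldsClose.improve hf hf' hΦ hΦ' hC hα hm hβ hc hf0 hη henv henv' hκ hq ih
      intro t ht x
      have h0 : 0 ≤ (1 + t) ^ (-(α + 1)) := Real.rpow_nonneg (by linarith [ht.1]) _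
      refine (this t ht x).trans ?_
      gcongr
      calc b * ((2 * A * (1 / 2) ^ n + D) * (α - 1)⁻¹ + 2305 * invSpeed c ^ 2)
          = (b * (α - 1)⁻¹) * (2 * A * (1 / 2) ^ n + D) + D / 2 := by
            simp only [D]; ring
        _ ≤ 1 / 2 * (2 * A * (1 / 2) ^ n + D) + D / 2 := by gcongr
        _ = _ := by rw [pow_succ]; ring
  intro t ht x
  have hlim : Filter.Tendsto (fun n : ℕ => (2 * A * (1 / 2) ^ n + D) * (1 + t) ^ (-(α + 1)))
      Filter.atTop (nhds ((2 * A * 0 + D) * (1 + t) ^ (-(α + 1)))) :=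
    (((tendsto_pow_atTop_nhds_zero_of_lt_one (by norm_num) (by norm_num)).const_mul _).add_const
      _).mul_const _
  have := ge_of_tendsto' hlim fun n => ind n t ht x
  simpa using this

end Compare

/-! ### L¹ estimate for compositions with near-identity maps. -/

/-- `S` is a perturbation of the identity with Lipschitz constant `1/4`. -/
def IsNearId (S : Phase → Phase) : Prop :=
  ∀ z z', ‖(S z - S z') - (z - z')‖ ≤ 1 / 4 * ‖z - z'‖

theorem IsNearId.antilipschitz {S : Phase → Phase} (hS : IsNearId S) : AntilipschitzWith 2 S := by
  refine AntilipschitzWith.of_le_mul_dist fun z z' => ?_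
  rw [dist_eq_norm, dist_eq_norm]
  have h := hS z z'
  have := norm_nonneg (z - z')
  push_cast
  have h4 := norm_sub_norm_le (z - z') (S z - S z')
  rw [norm_sub_rev (z - z') (S z - S z')] at h4
  linarith

theorem IsNearId.continuous {S : Phase → Phase} (hS : IsNearId S) : Continuous S := by
  refine (LipschitzWith.of_dist_le_mul (K := 2) fun z z' => ?_).continuous
  rw [dist_eq_norm, dist_eq_norm]
  have h1 := hS z z'
  have h2 := norm_add_le ((S z - S z') - (z - z')) (z - z')
  rw [sub_add_cancel] at h2
  push_cast
  linarith [norm_nonneg (z - z')]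

theorem IsNearId.interpolate {S S' : Phase → Phase} (hS : IsNearId S) (hS' : IsNearId S') {θ : ℝ}
    (hθ : θ ∈ Icc (0 : ℝ) 1) : IsNearId (fun z => S z + θ • (S' z - S z)) := by
  intro z z'
  have e : (S z + θ • (S' z - S z) - (S z' + θ • (S' z' - S z'))) - (z - z')
      = (1 - θ) • ((S z - S z') - (z - z')) + θ • ((S' z - S' z') - (z - z')) := by module
  rw [e]
  refine (norm_add_le _ _).trans ?_
  rw [norm_smul, norm_smul, Real.norm_of_nonneg hθ.1, Real.norm_of_nonneg (by linarith [hθ.2])]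
  have h1 : (1 - θ) * ‖(S z - S z') - (z - z')‖ ≤ (1 - θ) * (1 / 4 * ‖z - z'‖) :=
    mul_le_mul_of_nonneg_left (hS z z') (by linarith [hθ.2])
  have h2 : θ * ‖(S' z - S' z') - (z - z')‖ ≤ θ * (1 / 4 * ‖z - z'‖) :=
    mul_le_mul_of_nonneg_left (hS' z z') hθ.1
  linarith

/-- The inverse expands distances by at most 2, so it expands six-dimensional Hausdorff measure by
at most 2⁶. Volume is a multiple of that measure by uniqueness of Haar measure, and no
differentiability is needed. -/
theorem IsNearId.volume_preimage_le {S : Phase → Phase} (hS : IsNearId S) (A : Set Phase) :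
    volume (S ⁻¹' A) ≤ 64 * volume A := by
  have : (volume : Measure Phase).IsAddHaarMeasure :=
    inferInstanceAs (Measure.IsAddHaarMeasure ((volume : Measure E3).prod (volume : Measure E3)))
  have h := hS.antilipschitz.hausdorffMeasure_preimage_le
    (d := (Module.finrank ℝ Phase : ℝ)) (by positivity) A
  have e : (volume : Measure Phase) =
      Measure.addHaarScalarFactor volume (μH[(Module.finrank ℝ Phase : ℝ)] : Measure Phase) •
        (μH[(Module.finrank ℝ Phase : ℝ)] : Measure Phase) :=
    Measure.isAddLeftInvariant_eq_smul _ _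
  have hr : Module.finrank ℝ Phase = 6 := by simp [Module.finrank_prod]
  have h64 : ((2 : NNReal) : ℝ≥0∞) ^ (Module.finrank ℝ Phase : ℝ) = 64 := by
    rw [hr, ENNReal.rpow_natCast]; norm_num
  rw [h64] at h
  rw [e]
  simp only [Measure.smul_apply]
  calc _ ≤ Measure.addHaarScalarFactor volume (μH[(Module.finrank ℝ Phase : ℝ)] : Measure Phase) •
        (64 * (μH[(Module.finrank ℝ Phase : ℝ)] : Measure Phase) A) := by gcongr
    _ = _ := by simp only [ENNReal.smul_def, smul_eq_mul]; ring

theorem IsNearId.lintegral_comp_le {S : Phase → Phase} (hS : IsNearId S) {F : Phase → ℝ≥0∞}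
    (hF : Measurable F) : ∫⁻ z, F (S z) ≤ 64 * ∫⁻ z, F z := by
  have h : Measure.map S volume ≤ (64 : ℝ≥0∞) • (volume : Measure Phase) := by
    refine Measure.le_iff.2 fun A hA => ?_
    rw [Measure.map_apply hS.continuous.measurable hA]
    exact hS.volume_preimage_le A
  rw [← lintegral_map hF hS.continuous.measurable, ← smul_eq_mul, ← lintegral_smul_measure]
  exact lintegral_mono' h le_rfl

theorem enorm_sub_le_lintegral {f0 : Phase → ℝ} (hf : ContDiff ℝ 1 f0) (x y : Phase) :
    ‖f0 y - f0 x‖ₑ ≤ ∫⁻ θ in Icc (0 : ℝ) 1,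
      ENNReal.ofReal (2 * norm6 (grad6 f0 (x + θ • (y - x))) * ‖y - x‖) := by
  have hd := hf.differentiable one_ne_zero
  have h1 : ∀ θ ∈ uIcc (0 : ℝ) 1, HasDerivAt (fun θ : ℝ => f0 (x + θ • (y - x)))
      (fderiv ℝ f0 (x + θ • (y - x)) (y - x)) θ := fun θ _ => by
    have : HasDerivAt (fun θ : ℝ => x + θ • (y - x)) (y - x) θ := by
      simpa using ((hasDerivAt_id θ).smul_const (y - x)).const_add x
    exact (hd _).hasFDerivAt.comp_hasDerivAt θ this
  have hc : Continuous fun θ : ℝ => fderiv ℝ f0 (x + θ • (y - x)) (y - x) :=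
    ((hf.continuous_fderiv one_ne_zero).comp (by fun_prop : Continuous fun θ : ℝ =>
      x + θ • (y - x))).clm_apply continuous_const
  have h2 := intervalIntegral.integral_eq_sub_of_hasDerivAt h1 (hc.intervalIntegrable 0 1)
  simp only [one_smul, zero_smul, add_zero, add_sub_cancel] at h2
  rw [← h2, intervalIntegral.integral_of_le zero_le_one, ← integral_Icc_eq_integral_Ioc]
  refine (enorm_integral_le_lintegral_enorm _).trans (lintegral_mono fun θ => ?_)
  rw [← ofReal_norm, Real.norm_eq_abs]
  exact ENNReal.ofReal_le_ofReal (abs_fderiv_apply_le (hd _) _)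

/-- The increment of f⁰ is written along the segment from S(z) to S'(z). For each fixed θ the
interpolated map is again near the identity, so after Tonelli the z-integral is bounded by the
change-of-variables estimate. The constant is 2 (norms) · 2³ (brackets) · 64 (volume). -/
theorem eLpNorm_comp_sub_comp_le {f0 : Phase → ℝ} (hf : ContDiff ℝ 1 f0) {S S' : Phase → Phase}
    (hS : IsNearId S) (hS' : IsNearId S') (h1 : ∀ z, ‖S z - z‖ ≤ 1 / 2) (h1' : ∀ z, ‖S' z - z‖ ≤ 1 / 2)
    {L : ℝ} (hL : 0 ≤ L) (hle : ∀ z, ‖S' z - S z‖ ≤ L * jb z.2 ^ 3) :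
    eLpNorm (fun z => f0 (S' z) - f0 (S z)) 1 volume ≤ ENNReal.ofReal (1024 * L)
      * eLpNorm (fun z : Phase => jb z.2 ^ 3 * norm6 (grad6 f0 z)) 1 volume := by
  set F : Phase → ℝ := fun z => jb z.2 ^ 3 * norm6 (grad6 f0 z)
  have hFc : Continuous F :=
    ((continuous_jb.comp continuous_snd).pow 3).mul (continuous_norm6_grad6 hf)
  have hSc := hS.continuous
  have hS'c := hS'.continuous
  have hF0 : ∀ z, 0 ≤ F z := fun z => by
    have := jb_pos z.2
    have := norm6_nonneg (grad6 f0 z)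
    positivity
  rw [eLpNorm_one_eq_lintegral_enorm, eLpNorm_one_eq_lintegral_enorm]
  have key : ∀ z, ‖f0 (S' z) - f0 (S z)‖ₑ
      ≤ ∫⁻ θ in Icc (0 : ℝ) 1, ENNReal.ofReal (16 * L) * ‖F (S z + θ • (S' z - S z))‖ₑ := by
    intro z
    refine (enorm_sub_le_lintegral hf (S z) (S' z)).trans
      (setLIntegral_mono' measurableSet_Icc fun θ hθ => ?_)
    set y := S z + θ • (S' z - S z) with hy
    have e1 : ‖z - y‖ ≤ 1 := by
      have e' : z - y = -((1 - θ) • (S z - z) + θ • (S' z - z)) := by rw [hy]; module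
      rw [e', norm_neg]
      refine (norm_add_le _ _).trans ?_
      rw [norm_smul, norm_smul, Real.norm_of_nonneg hθ.1,
        Real.norm_of_nonneg (by linarith [hθ.2])]
      nlinarith [h1 z, h1' z, hθ.1, hθ.2]
    have e2 : jb z.2 ≤ 2 * jb y.2 := by
      have := jb_le_mul_jb ((norm_snd_le (z - y)).trans e1)
      norm_num at this
      exact this
    have hn := norm6_nonneg (grad6 f0 y)
    have hj := jb_pos z.2
    rw [← ofReal_norm, ← ENNReal.ofReal_mul (by positivity), Real.norm_of_nonneg (hF0 _)]
    refine ENNReal.ofReal_le_ofReal ?_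
    calc 2 * norm6 (grad6 f0 y) * ‖S' z - S z‖
        ≤ 2 * norm6 (grad6 f0 y) * (L * (2 * jb y.2) ^ 3) := by
          gcongr
          exact (hle z).trans (by gcongr)
      _ = _ := by simp only [F]; ring
  calc ∫⁻ z, ‖f0 (S' z) - f0 (S z)‖ₑ
      ≤ ∫⁻ z, ∫⁻ θ in Icc (0 : ℝ) 1, ENNReal.ofReal (16 * L) * ‖F (S z + θ • (S' z - S z))‖ₑ :=
        lintegral_mono key
    _ = ∫⁻ θ in Icc (0 : ℝ) 1, ∫⁻ z, ENNReal.ofReal (16 * L) * ‖F (S z + θ • (S' z - S z))‖ₑ := by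
        refine lintegral_lintegral_swap (Measurable.aemeasurable ?_)
        refine Measurable.const_mul ?_ _
        refine Continuous.measurable (Continuous.enorm (hFc.comp ?_))
        exact (hSc.comp continuous_fst).add (continuous_snd.smul
          ((hS'c.comp continuous_fst).sub (hSc.comp continuous_fst)))
    _ ≤ ∫⁻ θ in Icc (0 : ℝ) 1, ENNReal.ofReal (16 * L) * (64 * ∫⁻ z, ‖F z‖ₑ) := by
        refine setLIntegral_mono' measurableSet_Icc fun θ hθ => ?_
        have hm : Measurable fun z => ‖F z‖ₑ := hFc.enorm.measurable
        have hI := hS.interpolate hS' hθ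
        have hm' : Measurable fun z => ‖F (S z + θ • (S' z - S z))‖ₑ :=
          hm.comp hI.continuous.measurable
        rw [lintegral_const_mul _ hm']
        gcongr
        exact hI.lintegral_comp_le hm
    _ = _ := by
        have h64 : (64 : ℝ≥0∞) = ENNReal.ofReal 64 := by norm_num
        rw [lintegral_const, Measure.restrict_apply_univ, Real.volume_Icc, ← mul_assoc, h64,
          ← ENNReal.ofReal_mul (by positivity), sub_zero, ENNReal.ofReal_one, mul_one,
          show 16 * L * 64 = 1024 * L by ring]

end Vlasov
end

/-! ### Assembly of the three estimates. -/

theorem mainTheorem4 (α : ℝ) (hα1 : 1 < α) (hα2 : α < 2) (m : ℝ) (hm : 3 < m)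
    (β : ℝ) (hβ : β = -1 ∨ β = 0 ∨ β = 1)
    (w : E3 → ℝ) (K : E3 → E3) (hw : IsDecayingPotential α w K) :
    ∃ ε C : ℝ, 0 < ε ∧ 0 < C ∧
      ∀ f0 : Phase → ℝ, ContDiff ℝ 1 f0 → (∀ z, 0 ≤ f0 z) →
      ∀ η₀ : ℝ, dataSize m f0 < ENNReal.ofReal η₀ → η₀ ≤ ε →
      ∀ c : ℝ≥0∞, 1 ≤ c →
      ∀ fc fInf : ℝ → Phase → ℝ,
        IsGlobalSolution β K c f0 fc → IsGlobalSolution β K ⊤ f0 fInf →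
      ∀ Φc ΦInf : ℝ → Phase → Phase,
        IsCharFlow c (field β K fc) Φc → IsCharFlow ⊤ (field β K fInf) ΦInf →
        (∀ t : ℝ, 1 ≤ t →
          eLpNorm (fun z => profile c fc t z - profile ⊤ fInf t z) 1 volume
            ≤ ENNReal.ofReal (C * invSpeed c ^ 2)
              * eLpNorm (fun z : Phase => jb z.2 ^ 3 * norm6 (grad6 f0 z)) 1 volume) ∧
        (∀ t : ℝ, 0 ≤ t →
          Continuous (fun z => waveOp c Φc t z - waveOp ⊤ ΦInf t z) ∧
          ∀ z : Phase, (1 / jb z.2 ^ 3) * norm6 (waveOp c Φc t z - waveOp ⊤ ΦInf t z)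
            ≤ C * η₀ * invSpeed c ^ 2) ∧
        (∀ t : ℝ, 0 ≤ t → ∀ x : E3,
          ‖field β K fc t x - field β K fInf t x‖
            ≤ C * η₀ * invSpeed c ^ 2 * jb t ^ (-(α + 1))) := by
  obtain ⟨C, hC⟩ := exists_isConvolutionConst hα1 hα2 hm hw
  have hm0 : 0 ≤ m := by linarith
  have hβ1 : |β| ≤ 1 := by rcases hβ with rfl | rfl | rfl <;> norm_num
  have hC0 := hC.pos
  have hP := profileConst_pos m
  have hF : 0 < fieldConst m C := fieldConst_pos hC0
  have hα' : 0 < (α - 1)⁻¹ := inv_pos.2 (by linarith)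
  set A := fieldConst m C
  set b := profileConst m * C
  have hb : 0 < b := mul_pos hP hC0
  have hbA : b ≤ A := profileConst_mul_le_fieldConst hm0 hC0
  -- ε makes the envelope mass A η₀/(α - 1) at most 1/64. The three summands of the constant serve
  -- claims 1, 3 and 2 in this order; 160000 = 1024 · 10000/64.
  refine ⟨(64 * (A * (α - 1)⁻¹))⁻¹, 160000 + 4610 * b + 20000 * (A * (α - 1)⁻¹), by positivity,
    by positivity, ?_⟩
  intro f0 hf0 _ η₀ hη hηε c hc fc fInf hfc hfI Φc ΦInf hΦc hΦI
  have hη0 := pos_of_dataSize_lt hη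
  set k2 := invSpeed c ^ 2
  have hk2 : 0 ≤ k2 := sq_nonneg _
  have hκ : A * η₀ * (α - 1)⁻¹ ≤ 1 / 64 := by
    calc A * η₀ * (α - 1)⁻¹ = (A * (α - 1)⁻¹) * η₀ := by ring
      _ ≤ (A * (α - 1)⁻¹) * (64 * (A * (α - 1)⁻¹))⁻¹ := by gcongr
      _ = 1 / 64 := by
        have : α - 1 ≠ 0 := by linarith
        field_simp
  have hκ2 : A * η₀ * (α - 1)⁻¹ ≤ 1 / 32 := by linarith
  have hAη : 0 ≤ A * η₀ := by positivity
  have hbη : profileConst m * η₀ * C ≤ A * η₀ := by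
    calc _ = b * η₀ := by ring
      _ ≤ _ := by gcongr
  have hdec : ∀ {t : ℝ}, 0 ≤ t → HasFieldDecay α (A * η₀) (field β K fc) t := fun ht =>
    hfc.hasFieldDecay hΦc hC hα1 hm0 hβ1 hc hf0 hη hκ ht
  have hdec' : ∀ {t : ℝ}, 0 ≤ t → HasFieldDecay α (A * η₀) (field β K fInf) t := fun ht =>
    hfI.hasFieldDecay hΦI hC hα1 hm0 hβ1 le_top hf0 hη hκ ht
  have henv : ∀ {t : ℝ}, 0 ≤ t → IsEnvelope (field β K fc) t (A * η₀ * (α - 1)⁻¹)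
      (fun s => A * η₀ * (1 + s) ^ (-α)) := fun ht =>
    hfc.isEnvelope_of_hasFieldDecay hα1 hAη (hdec ht)
  have henv' : ∀ {t : ℝ}, 0 ≤ t → IsEnvelope (field β K fInf) t (A * η₀ * (α - 1)⁻¹)
      (fun s => A * η₀ * (1 + s) ^ (-α)) := fun ht =>
    hfI.isEnvelope_of_hasFieldDecay hα1 hAη (hdec' ht)
  set q := 4610 * (profileConst m * η₀ * C) * k2 with hq
  have hq0 : 0 ≤ q := by positivity
  have hclose : ∀ {t : ℝ}, 0 ≤ t → FieldsClose α q (field β K fc) (field β K fInf) t := fun ht =>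
    fieldsClose_of_hasFieldDecay hfc hfI hΦc hΦI hC hα1 hm0 hβ1 hc hf0 hη hAη (hdec ht)
      (hdec' ht) hκ hbη
  -- 2 · (4610 + 24) ≤ 10000, after bounding 1 by ⟨p⟩³.
  have hbound : ∀ z : Phase, 2 * (q * (α - 1)⁻¹ + 24 * (A * η₀ * (α - 1)⁻¹) * k2 * jb z.2 ^ 3)
      ≤ 10000 * (A * η₀ * (α - 1)⁻¹) * k2 * jb z.2 ^ 3 := by
    intro z
    have hj1 : 1 ≤ jb z.2 ^ 3 := one_le_pow₀ (one_le_jb _)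
    have h1 : q * (α - 1)⁻¹ ≤ 4610 * (A * η₀ * (α - 1)⁻¹) * k2 := by
      calc q * (α - 1)⁻¹ ≤ 4610 * (A * η₀) * k2 * (α - 1)⁻¹ := by rw [hq]; gcongr
        _ = _ := by ring
    have h0 : 0 ≤ (A * η₀ * (α - 1)⁻¹) * k2 := by positivity
    have h2 : (A * η₀ * (α - 1)⁻¹) * k2 * 1 ≤ (A * η₀ * (α - 1)⁻¹) * k2 * jb z.2 ^ 3 := by gcongr
    linarith
  refine ⟨fun t ht => ?_, fun t ht => ⟨?_, fun z => ?_⟩, fun t ht x => ?_⟩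
  · have ht0 : 0 ≤ t := by linarith
    have hmem : t ∈ Icc 0 t := ⟨ht0, le_rfl⟩
    have h1 := eLpNorm_comp_sub_comp_le hf0 (S := waveInv ⊤ ΦInf t) (S' := waveInv c Φc t)
      (L := 10000 * (1 / 64) * k2)
      (fun z z' => (henv' ht0).waveInv_lip hκ2 le_top hΦI hmem z z')
      (fun z z' => (henv ht0).waveInv_lip hκ2 hc hΦc hmem z z')
      (fun z => ((henv' ht0).norm_waveInv_sub_le hκ2 le_top hΦI hmem z).trans (by linarith))
      (fun z => ((henv ht0).norm_waveInv_sub_le hκ2 hc hΦc hmem z).trans (by linarith))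
      (by positivity) fun z => by
        refine ((hclose ht0).norm_waveInv_sub_le (henv ht0) (henv' ht0) hκ2 hc hΦc hΦI hα1 hq0
          hmem z).trans ((hbound z).trans ?_)
        have := jb_pos z.2
        gcongr
    have e : (fun z => profile c fc t z - profile ⊤ fInf t z)
        = fun z => f0 (waveInv c Φc t z) - f0 (waveInv ⊤ ΦInf t z) := by
      ext z
      rw [hfc.profile_eq hΦc (henv ht0) hκ2 hc hmem, hfI.profile_eq hΦI (henv' ht0) hκ2 le_top hmem]
    rw [e]
    refine h1.trans ?_
    rw [← mul_assoc]
    gcongr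
    have : 0 ≤ 4610 * b + 20000 * (A * (α - 1)⁻¹) := by positivity
    linarith
  · have hmem : t ∈ Icc 0 t := ⟨ht, le_rfl⟩
    exact ((henv ht).continuous_waveOp hκ2 hc hΦc hmem).sub
      ((henv' ht).continuous_waveOp hκ2 le_top hΦI hmem)
  · have hmem : t ∈ Icc 0 t := ⟨ht, le_rfl⟩
    have h0 : (0 : ℝ) ∈ Icc 0 t := ⟨le_rfl, ht⟩
    -- Trajectories matched at time 0, where both wave operators are the identity.
    have h1 := (hclose ht).norm_waveOp_sub_le (henv ht) (henv' ht) hκ2 hc hΦc hΦI hα1 hq0 hmem h0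
      (z := z) (z' := z) (by rw [waveOp_zero hΦc, waveOp_zero hΦI])
    rw [waveOp_zero hΦI] at h1
    have hj : 0 < jb z.2 ^ 3 := pow_pos (jb_pos _) 3
    have h2 := norm6_le (waveOp c Φc t z - waveOp ⊤ ΦInf t z)
    rw [one_div, inv_mul_le_iff₀ hj]
    have h3 : 0 ≤ (160000 + 4610 * b) * (η₀ * k2 * jb z.2 ^ 3) := by positivity
    calc _ ≤ 2 * (10000 * (A * η₀ * (α - 1)⁻¹) * k2 * jb z.2 ^ 3) :=
          h2.trans (by linarith [hbound z])
      _ ≤ _ := by linarith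
  · have hmem : t ∈ Icc 0 t := ⟨ht, le_rfl⟩
    have h1 := hclose ht t hmem x
    have h2 : (1 + t) ^ (-(α + 1)) ≤ jb t ^ (-(α + 1)) := by
      refine Real.rpow_le_rpow_of_nonpos (jb_pos t) ?_ (by linarith)
      simpa [abs_of_nonneg ht] using jb_le_one_add_norm t
    have hr : 0 < jb t ^ (-(α + 1)) := Real.rpow_pos_of_pos (jb_pos t) _
    have h3 : 0 ≤ (160000 + 20000 * (A * (α - 1)⁻¹)) * (η₀ * k2 * jb t ^ (-(α + 1))) := by
      positivity
    calc _ ≤ q * (1 + t) ^ (-(α + 1)) := h1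
      _ ≤ q * jb t ^ (-(α + 1)) := by gcongr
      _ = 4610 * b * η₀ * k2 * jb t ^ (-(α + 1)) := by rw [hq]; ring
      _ ≤ _ := by linarith
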